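/- Consider the class $\mathcal Q^+$ of real, autonomous, multilinear equations on the square lattice for $u:\mathbb Z^2\to\mathbb R$, $$\begin{aligned} &a_1 (u_{n,m} + u_{n+1,m+1}) + a_2 (u_{n+1,m} + u_{n,m+1}) + (\alpha_1-\alpha_2) u_{n,m}u_{n+1,m} + (\alpha_1+\alpha_2) u_{n,m+1}u_{n+1,m+1}\\ &+ (\beta_1-\beta_2) u_{n,m}u_{n,m+1} + (\beta_1+\beta_2) u_{n+1,m}u_{n+1,m+1} + \gamma_1 u_{n,m}u_{n+1,m+1} + \gamma_2 u_{n+1,m}u_{n,m+1}\\ &+ (\xi_1-\xi_3) u_{n,m}u_{n+1,m}u_{n,m+1} + (\xi_1+\xi_3) u_{n,m}u_{n+1,m}u_{n+1,m+1} + (\xi_2-\xi_4) u_{n+1,m}u_{n,m+1}u_{n+1,m+1}\\ &+ (\xi_2+\xi_4) u_{n,m}u_{n,m+1}u_{n+1,m+1} + \zeta u_{n,m} u_{n+1,m} u_{n,m+1} u_{n+1,m+1}=0, \end{aligned}$$ with real coefficients, $a_1,a_2\neq 0$, $|a_1|\neq|a_2|$. *Multiscale expansion.* Let $K=e^{i\kappa}$,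 $\Omega=e^{-i\omega}$ with $\kappa,\omega$ real, and $L_\alpha=a_1(1+K^\alpha\Omega^\alpha)+a_2(K^\alpha+\Omega^\alpha)$. The pair $(\kappa,\omega)$ is called an admissible carrier if $L_1=0$ (dispersion relation), $\sin\kappa\ne0$ (so that $\omega''(\kappa)\neq0$) and $L_2,L_3,L_4\neq0$ (no resonance of the higher harmonics). Insert $$u_{n,m}=\sum_{j\ge1}\varepsilon^{j}\sum_{|\alpha|\le j}K^{\alpha n}\Omega^{\alpha m}u_j^{(\alpha)},\qquad u_j^{(-\alpha)}=\overline{u_j^{(\alpha)}},$$ where the $u_j^{(\alpha)}$ depend on $\xi=\varepsilon(n- v m)$ and on the slow times $m_k=\varepsilon^k m$, $k\geq2$, and where lattice shifts act on the $u^{(\alpha)}_j$ by their Taylor expansions; let $\mathcal W_j^{(\alpha)}$ be the coefficient of $\varepsilon^jK^{\alpha n}\Omega^{\alpha m}$ in the left-hand side of the equation. Write $u(j)=u_j^{(1)}$, treated as independent functions of $\xi$, with the other harmonics being differential polynomials in the $u(j)$ and $\overline{u(j)}$. The equations $\mathcal W_j^{(\alpha)}=0$ for $j\le4$ and all $\alpha$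 amount, for the amplitudes $u(1)$, $u(2)$, to reduced equations of the form $$\partial_{m_2}u(1)=K_2[u(1)],\qquad \partial_{m_3}u(1)=K_3[u(1)],\qquad \partial_{m_2}u(2)=K_2'[u(1)]\,u(2)+f_2(2),$$ where $$K_2[u]=-i\rho_1\Big[u_{\xi\xi}+\tfrac{\rho_2}{\rho_1}|u|^2u\Big],\qquad K_3[u]=B\Big[u_{\xi\xi\xi}+\tfrac{3\rho_2}{\rho_1}|u|^2u_\xi\Big],$$ $K_2'[u]$ is the linearization of $K_2$ at $u$, and $f_2(2)=a\,u_\xi(1)|u(1)|^2+b\,\bar u_\xi(1)u(1)^2$, with $v,\rho_1,B$ real, $\rho_1\ne0$, and $\rho_2,a,b$ complex numbers that depend on the carrier. The equation satisfies the integrability conditions up to order $\varepsilon^4$ (it is $A_2$-integrable) if, for every admissible carrier, $\rho_2$ is real (the $A_1$-condition, order $\varepsilon^3$) and $a,b$ are real (the $A_2$-conditions, order $\varepsilon^4$). **Proposition.** An equation of the class $\mathcal Q^+$ satisfies the integrability conditions up to order $\varepsilon^4$ if and only if its coefficients belong to one of the following two cases: * Case 1 (nine free parameters): $\alpha_2=\beta_2=0$,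 $\xi_1=\xi_2$, $\xi_3=\xi_4$. * Case 4 (eight free parameters): $\alpha_1=\beta_1=\frac{(a_1+a_2)\gamma_1}{2a_1}$, $\gamma_2=\frac{a_2\gamma_1}{a_1}$, $a_1(\xi_1-\xi_2)=-\alpha_2\gamma_1$, $a_1(\xi_3-\xi_4)=\beta_2\gamma_1$, $(\alpha_2,\beta_2)\neq(0,0)$. The two subclasses do not overlap, and each of them is invariant under the restricted Möbius transformations: for all real $C$ and $D\neq 0$, replacing $u$ by $u/(Cu+D)$ at all lattice points and clearing denominators turns an equation of $\mathcal Q^+$ into an equation of $\mathcal Q^+$, and the new equation belongs to Case 1 (respectively Case 4) if and only if the original one does. Nine (eight) free parameters means: $a_1,a_2,\alpha_1,\beta_1,\gamma_1,\gamma_2,\xi_1,\xi_3,\zeta$ can be prescribed arbitrarily in Case 1, and $a_1,a_2,\alpha_2,\beta_2,\gamma_1,\xi_1,\xi_3,\zeta$ in Case 4 (subject to $a_1\neq0$ and $(\alpha_2,\beta_2)\neq(0,0)$), and they determine the other coefficients. -/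

import Mathlib

open scoped LaurentPolynomial

noncomputable section

/-- The thirteen real coefficients of a multilinear equation on the square lattice, with
`x00 = u_{n,m}`, `x10 = u_{n+1,m}`, `x01 = u_{n,m+1}`, `x11 = u_{n+1,m+1}` (see `quad`). -/
@[ext]
structure QCoeffs where
  (a₁ a₂ α₁ α₂ β₁ β₂ γ₁ γ₂ ξ₁ ξ₂ ξ₃ ξ₄ ζ : ℝ)

namespace QCoeffs

/-- The multilinear polynomial `𝒬⁺`, evaluated in any commutative real algebra. -/
def quad (p : QCoeffs) {A : Type*} [CommRing A] [Algebra ℝ A] (x00 x10 x01 x11 : A) : A :=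
  p.a₁ • (x00 + x11) + p.a₂ • (x10 + x01)
  + (p.α₁ - p.α₂) • (x00 * x10) + (p.α₁ + p.α₂) • (x01 * x11)
  + (p.β₁ - p.β₂) • (x00 * x01) + (p.β₁ + p.β₂) • (x10 * x11)
  + p.γ₁ • (x00 * x11) + p.γ₂ • (x10 * x01)
  + (p.ξ₁ - p.ξ₃) • (x00 * x10 * x01) + (p.ξ₁ + p.ξ₃) • (x00 * x10 * x11)
  + (p.ξ₂ - p.ξ₄) • (x10 * x01 * x11) + (p.ξ₂ + p.ξ₄) • (x00 * x01 * x11)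
  + p.ζ • (x00 * x10 * x01 * x11)

/-- Membership in the class `𝒬⁺`: the linear part has a nontrivial dispersion relation. -/
def IsDispersive (p : QCoeffs) : Prop :=
  p.a₁ ≠ 0 ∧ p.a₂ ≠ 0 ∧ |p.a₁| ≠ |p.a₂|

/-- Case 1. -/
def Case1 (p : QCoeffs) : Prop :=
  p.α₂ = 0 ∧ p.β₂ = 0 ∧ p.ξ₁ = p.ξ₂ ∧ p.ξ₃ = p.ξ₄

/-- The restricted Case 4. -/
def Case4 (p : QCoeffs) : Prop :=
  p.α₁ = (p.a₁ + p.a₂) * p.γ₁ / (2 * p.a₁) ∧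
  p.β₁ = (p.a₁ + p.a₂) * p.γ₁ / (2 * p.a₁) ∧
  p.γ₂ = p.a₂ * p.γ₁ / p.a₁ ∧
  p.a₁ * (p.ξ₁ - p.ξ₂) = -(p.α₂ * p.γ₁) ∧
  p.a₁ * (p.ξ₃ - p.ξ₄) = p.β₂ * p.γ₁ ∧
  (p.α₂, p.β₂) ≠ (0, 0)

/-! ### The restricted Möbius transformation -/

/-- The coefficients of the equation obtained by substituting `u / (C u + D)` for `u` at every
lattice point and clearing denominators; `quad_mobius` proves that this is what they are. -/
def mobius (C D : ℝ) (p : QCoeffs) : QCoeffs where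
  a₁ := D ^ 3 * p.a₁
  a₂ := D ^ 3 * p.a₂
  α₁ := D ^ 2 * (p.α₁ + C * (p.a₁ + p.a₂))
  α₂ := D ^ 2 * p.α₂
  β₁ := D ^ 2 * (p.β₁ + C * (p.a₁ + p.a₂))
  β₂ := D ^ 2 * p.β₂
  γ₁ := D ^ 2 * (p.γ₁ + 2 * C * p.a₁)
  γ₂ := D ^ 2 * (p.γ₂ + 2 * C * p.a₂)
  ξ₁ := D * p.ξ₁ + 1 / 2 * C * D *
    (3 * C * (p.a₁ + p.a₂) + p.γ₁ + p.γ₂ + 2 * (p.α₁ - p.α₂ + p.β₁))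
  ξ₂ := D * p.ξ₂ + 1 / 2 * C * D *
    (3 * C * (p.a₁ + p.a₂) + p.γ₁ + p.γ₂ + 2 * (p.α₁ + p.α₂ + p.β₁))
  ξ₃ := D * p.ξ₃ + 1 / 2 * C * D * (C * (p.a₁ - p.a₂) + p.γ₁ - p.γ₂ + 2 * p.β₂)
  ξ₄ := D * p.ξ₄ + 1 / 2 * C * D * (C * (p.a₁ - p.a₂) + p.γ₁ - p.γ₂ - 2 * p.β₂)
  ζ := p.ζ + C ^ 2 * (2 * C * (p.a₁ + p.a₂) + p.γ₁ + p.γ₂ + 2 * (p.α₁ + p.β₁))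
    + 2 * C * (p.ξ₁ + p.ξ₂)

theorem quad_mobius (p : QCoeffs) (C D x y z w : ℝ) (hx : C * x + D ≠ 0) (hy : C * y + D ≠ 0)
    (hz : C * z + D ≠ 0) (hw : C * w + D ≠ 0) :
    (p.mobius C D).quad x y z w =
      (C * x + D) * (C * y + D) * (C * z + D) * (C * w + D) *
        p.quad (x / (C * x + D)) (y / (C * y + D)) (z / (C * z + D)) (w / (C * w + D)) := by
  have key : ∀ a b c d : ℝ, a ≠ 0 → b ≠ 0 → c ≠ 0 → d ≠ 0 →
      a * b * c * d * p.quad (x / a) (y / b) (z / c) (w / d) =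
        p.a₁ * (x * b * c * d + a * b * c * w) + p.a₂ * (a * y * c * d + a * b * z * d)
        + (p.α₁ - p.α₂) * (x * y * c * d) + (p.α₁ + p.α₂) * (a * b * z * w)
        + (p.β₁ - p.β₂) * (x * b * z * d) + (p.β₁ + p.β₂) * (a * y * c * w)
        + p.γ₁ * (x * b * c * w) + p.γ₂ * (a * y * z * d)
        + (p.ξ₁ - p.ξ₃) * (x * y * z * d) + (p.ξ₁ + p.ξ₃) * (x * y * c * w)
        + (p.ξ₂ - p.ξ₄) * (a * y * z * w) + (p.ξ₂ + p.ξ₄) * (x * b * z * w)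
        + p.ζ * (x * y * z * w) := by
    intro a b c d ha hb hc hd
    obtain ⟨x', rfl⟩ : ∃ t, x = t * a := ⟨x / a, by field_simp⟩
    obtain ⟨y', rfl⟩ : ∃ t, y = t * b := ⟨y / b, by field_simp⟩
    obtain ⟨z', rfl⟩ : ∃ t, z = t * c := ⟨z / c, by field_simp⟩
    obtain ⟨w', rfl⟩ : ∃ t, w = t * d := ⟨w / d, by field_simp⟩
    rw [mul_div_cancel_right₀ _ ha, mul_div_cancel_right₀ _ hb, mul_div_cancel_right₀ _ hc,
      mul_div_cancel_right₀ _ hd]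
    simp only [quad, smul_eq_mul]
    ring
  rw [key _ _ _ _ hx hy hz hw]
  simp only [quad, mobius, smul_eq_mul]
  ring

end QCoeffs

/-! ### Differential polynomials in the slowly varying amplitudes -/

/-- Jet variables: `amp j k` is `∂_ξ^k u_j^{(1)}` and `ampBar j k` is its complex conjugate. -/
inductive JetVar where
  | amp (j k : ℕ) : JetVar
  | ampBar (j k : ℕ) : JetVar

/-- Differential polynomials in the amplitudes `u_j^{(1)}` and their conjugates. -/
abbrev DiffPoly : Type := MvPolynomial JetVar ℂ

namespace DiffPoly

/-- `∂_ξ^k u_j^{(1)}`. -/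
def u (j k : ℕ) : DiffPoly := MvPolynomial.X (JetVar.amp j k)

/-- The complex conjugate of `∂_ξ^k u_j^{(1)}`. -/
def ubar (j k : ℕ) : DiffPoly := MvPolynomial.X (JetVar.ampBar j k)

/-- A complex constant. -/
def const (z : ℂ) : DiffPoly := MvPolynomial.C z

/-- Complex conjugation of differential polynomials. -/
def conj : DiffPoly →+* DiffPoly :=
  MvPolynomial.eval₂Hom (MvPolynomial.C.comp (starRingEnd ℂ)) fun
    | .amp j k => ubar j k
    | .ampBar j k => u j k

/-- The total derivative `∂_ξ`. -/
def dξ : Derivation ℂ DiffPoly DiffPoly :=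
  MvPolynomial.mkDerivation ℂ fun
    | .amp j k => u j (k + 1)
    | .ampBar j k => ubar j (k + 1)

/-- The derivative with respect to a slow time along which the amplitudes evolve according to
`∂_t u_j^{(1)} = F j` (and the complex conjugate equations). -/
def flow (F : ℕ → DiffPoly) : Derivation ℂ DiffPoly DiffPoly :=
  MvPolynomial.mkDerivation ℂ fun
    | .amp j k => dξ^[k] (F j)
    | .ampBar j k => dξ^[k] (conj (F j))

/-- The nonlinear Schrödinger flow `K₂[u] = -iρ₁(u_ξξ + (ρ₂/ρ₁)|u|²u)` at `u = u_1^{(1)}`. -/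
def K₂ (ρ₁ : ℝ) (ρ₂ : ℂ) : DiffPoly :=
  const (-Complex.I * ρ₁) * (u 1 2 + const (ρ₂ / ρ₁) * (u 1 0 ^ 2 * ubar 1 0))

/-- The linearization `K₂'[u]v = -iρ₁(v_ξξ + (ρ₂/ρ₁)(u² v̄ + 2|u|²v))` at `u = u_1^{(1)}`,
`v = u_2^{(1)}`. -/
def K₂' (ρ₁ : ℝ) (ρ₂ : ℂ) : DiffPoly :=
  const (-Complex.I * ρ₁) *
    (u 2 2 + const (ρ₂ / ρ₁) * (u 1 0 ^ 2 * ubar 2 0 + 2 * (u 1 0 * ubar 1 0 * u 2 0)))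

/-- The next flow of the hierarchy, `K₃[u] = B(u_ξξξ + (3ρ₂/ρ₁)|u|²u_ξ)` at `u = u_1^{(1)}`. -/
def K₃ (ρ₁ : ℝ) (ρ₂ : ℂ) (B : ℝ) : DiffPoly :=
  const B * (u 1 3 + const (3 * ρ₂ / ρ₁) * (u 1 0 * ubar 1 0 * u 1 1))

/-- The forcing term `f₂(2) = a u_ξ |u|² + b ū_ξ u²` at `u = u_1^{(1)}`. -/
def f₂ (a b : ℂ) : DiffPoly :=
  const a * (u 1 1 * (u 1 0 * ubar 1 0)) + const b * (ubar 1 1 * u 1 0 ^ 2)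

/-- The coefficient of `ε^i` in `exp(ε δ₁ + ε² δ₂ + ε³ δ₃)`, for commuting `δ`'s and `i ≤ 3`.
Since the field starts at order `ε`, only these are needed at the orders `≤ 4` used below. -/
def shiftOp (δ₁ δ₂ δ₃ : Derivation ℂ DiffPoly DiffPoly) (i : ℕ) (f : DiffPoly) : DiffPoly :=
  match i with
  | 0 => f
  | 1 => δ₁ f
  | 2 => (1 / 2 : ℂ) • δ₁ (δ₁ f) + δ₂ f
  | 3 => (1 / 6 : ℂ) • δ₁ (δ₁ (δ₁ f)) + δ₁ (δ₂ f) + δ₃ f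
  | _ => 0

/-- Formal power series in `ε` (the variable of `PowerSeries`) whose coefficients are finite sums
of harmonics; `LaurentPolynomial.T α` stands for the carrier `K^{αn} Ω^{αm}`. -/
abbrev Expansion : Type := PowerSeries (LaurentPolynomial DiffPoly)

/-- The expansion of the field `u = ε w` at a lattice point shifted from `(n, m)`: `op` is the
family of operators describing the effect of the shift on the slowly varying amplitudes
`h ℓ α = u_ℓ^{(α)}`, `|α| ≤ ℓ`, and `z` is the factor which the carrier `K^n Ω^m` acquires. -/
def field (op : ℕ → DiffPoly → DiffPoly) (z : ℂ) (h : ℕ → ℤ → DiffPoly) : Expansion :=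
  PowerSeries.mk fun j =>
    ∑ α ∈ Finset.Icc (-(j : ℤ)) (j : ℤ),
      LaurentPolynomial.C
          (const (z ^ α) * ∑ ℓ ∈ Finset.Icc (max 1 α.natAbs) j, op (j - ℓ) (h ℓ α)) *
        LaurentPolynomial.T α

end DiffPoly

/-! ### The multiscale expansion -/

namespace QCoeffs

/-- `K = e^{iκ}` -/
def carrierK (κ : ℝ) : ℂ := Complex.exp (Complex.I * κ)

/-- `Ω = e^{-iω}` -/
def carrierΩ (ω : ℝ) : ℂ := Complex.exp (-(Complex.I * ω))

/-- The result of applying the linear part of the equation to `(K^n Ω^m)^α`, divided by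
`(K^n Ω^m)^α`. -/
def linSymbol (p : QCoeffs) (κ ω : ℝ) (α : ℕ) : ℂ :=
  p.a₁ * (1 + (carrierK κ * carrierΩ ω) ^ α) + p.a₂ * (carrierK κ ^ α + carrierΩ ω ^ α)

/-- The carrier waves around which one expands up to order `ε⁴`: `(κ, ω)` satisfies the dispersion
relation, the dispersion is nonlinear at `κ` (`ω''(κ) ≠ 0`, i.e. `sin κ ≠ 0`), and the higher
harmonics generated up to this order are not resonant. -/
structure IsCarrier (p : QCoeffs) (κ ω : ℝ) : Prop where
  dispersion : p.linSymbol κ ω 1 = 0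
  sin_ne_zero : Real.sin κ ≠ 0
  nonresonant : ∀ α : ℕ, 2 ≤ α → α ≤ 4 → p.linSymbol κ ω α ≠ 0

open DiffPoly in
/-- The expansion in `ε` of the left-hand side of the equation; its coefficient at `ε^j T^α` is
`𝒲_j^{(α)}`. The slow derivatives are `∂_{n₁} = ∂_ξ` and `∂_{m₁} = -v ∂_ξ`, that is,
`ξ = n₁ - v m₁`, while `∂_{m₂}`, `∂_{m₃}` are the flows with right-hand sides `F₂`, `F₃`. -/
def expansion (p : QCoeffs) (κ ω v : ℝ) (F₂ F₃ : ℕ → DiffPoly) (h : ℕ → ℤ → DiffPoly) :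
    Expansion :=
  let δn₁ := dξ
  let δm₁ := (-v : ℂ) • dξ
  let δm₂ := flow F₂
  let δm₃ := flow F₃
  p.quad
    (field (shiftOp 0 0 0) 1 h)
    (field (shiftOp δn₁ 0 0) (carrierK κ) h)
    (field (shiftOp δm₁ δm₂ δm₃) (carrierΩ ω) h)
    (field (shiftOp (δn₁ + δm₁) δm₂ δm₃) (carrierK κ * carrierΩ ω) h)

open DiffPoly in
/-- The multiscale expansion up to order `ε⁴` around the carrier `(κ, ω)` has the reduced equations
`∂_{t₂} u(1) = K₂[u(1)]`, `∂_{t₃} u(1) = K₃[u(1)]`, `∂_{t₂} u(2) = K₂'[u(1)] u(2) + f₂(2)`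
with the coefficients `ρ₁`, `ρ₂`, `B`, `a`, `b`: with the amplitudes `u(j) = u_j^{(1)}` as
independent functions of `ξ` which evolve in this way, and with the other harmonics suitable
differential polynomials in them, `𝒲_j^{(α)} = 0` for all `j ≤ 4` and all `α`. -/
def HasReduction (p : QCoeffs) (κ ω v ρ₁ : ℝ) (ρ₂ : ℂ) (B : ℝ) (a b : ℂ) : Prop :=
  ρ₁ ≠ 0 ∧
  ∃ (F₂ F₃ : ℕ → DiffPoly) (h : ℕ → ℤ → DiffPoly),
    F₂ 1 = K₂ ρ₁ ρ₂ ∧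
    F₂ 2 = K₂' ρ₁ ρ₂ + f₂ a b ∧
    F₃ 1 = K₃ ρ₁ ρ₂ B ∧
    (∀ j, h j 1 = u j 0) ∧
    (∀ j α, h j (-α) = conj (h j α)) ∧
    ∀ j ≤ 4, PowerSeries.coeff j (p.expansion κ ω v F₂ F₃ h) = 0

/-- The equation satisfies the `A₁`-integrability condition (`ρ₂` is real, for all carriers) and
the `A₂`-integrability conditions (`a` and `b` are real, for all carriers). -/
def IsA2Integrable (p : QCoeffs) : Prop :=
  ∀ κ ω : ℝ, p.IsCarrier κ ω →
    ∃ (v ρ₁ : ℝ) (ρ₂ : ℂ) (B : ℝ) (a b : ℂ),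
      p.HasReduction κ ω v ρ₁ ρ₂ B a b ∧ ρ₂.im = 0 ∧ a.im = 0 ∧ b.im = 0

end QCoeffs

end

/-! The multiscale expansion is first turned into finite algebra. Let `z c`, `s c`, `t c` be the
carrier factor and the slow shifts at the four corners of the square. Nonresonance lets every
harmonic other than `±1` be solved order by order (`exists_harmonics`), and up to `ε³` the solutions
which matter have the form `μ|u|²`, `νu²` and their analogues with `u(2)` and `u_ξ`
(`exists_slave_coeffs`). The first harmonic at `ε³` and `ε⁴` is then a combination of independent
monomials, so a reduction exists exactly when the scalar system `ReducedEqs` is solvable. The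
quartic coefficient `ζ` never enters, by parity of the harmonics.

The system is simplest about the centre of the square. With `κ = φ + ψ` and `ω = ψ - φ`, the corner
factors become `e^{∓iφ}`, `e^{±iψ}` up to a common phase, the shifts become odd under the point
reflection, and the dispersion relation reads `a₁ cos φ + a₂ cos ψ = 0`
(`IsCarrier.hasReduction_iff`). The substitution `u/(Cu+1)` only moves `μ` by `2C` and `ν` by `C`
(`ReducedEqs.mobius`). Hence integrability is Möbius invariant, and so are both cases; choosing `C`
suitably gives `γ₁ = 0`.

Sufficiency: the point reflection acts on the centred carrier factors as complex conjugation. In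
Case 1 it fixes the quadratic part of the equation; in Case 4 with `γ₁ = 0` it changes the sign of
the quadratic part; in both it fixes the cubic part. The amplitude coefficients are quadratic in the
quadratic part plus linear in the cubic part, so the sign cancels and `ρ₂`, `a`, `b` are real
(`IsReversible.real_of_reducedEqs`). A reduction always exists (`IsCarrier.exists_reducedEqs`).

Necessity, for `γ₁ = 0`: eliminating `μ`, `ν`, `σ'` from reality of `ρ₂` and `b` leaves two real
identities, `cubicIm = 0` and `conjDerivRe = 0`. Along the carriers `cos φ = a₂x`, `cos ψ = -a₁x`
with small `x > 0` and arbitrary signs of the sines, each separates into polynomials in `x²` which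
must vanish identically. They are linear in the products of `α₂ ± β₂` with `α₁ ± β₁` and `γ₂`, and
in two differences of cubic coefficients. Because `a₁² ≠ a₂²`, all of these are zero, so either `α₂
= β₂ = 0` or `α₁ = β₁ = γ₂ = 0` (`case1_or_case4_of_isA2Integrable`). -/

noncomputable section

/-! ### Coefficients of products of graded series -/

namespace DiffPoly

/-- The coefficient of `ε^j T^α`, as a real-linear map. -/
def cf (j : ℕ) (α : ℤ) : Expansion →ₗ[ℝ] DiffPoly where
  toFun f := (PowerSeries.coeff j f).coeff α
  map_add' _ _ := rfl
  map_smul' _ _ := rfl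

theorem cf_apply (j : ℕ) (α : ℤ) (f : Expansion) : cf j α f = (PowerSeries.coeff j f).coeff α := rfl

theorem coeff_eq_zero_iff (j : ℕ) (f : Expansion) :
    PowerSeries.coeff j f = 0 ↔ ∀ α, cf j α f = 0 :=
  ⟨fun h α => by rw [cf_apply, h]; rfl, fun h => LaurentPolynomial.ext fun α => h α⟩

theorem laurent_coeff_mul (a b : LaurentPolynomial DiffPoly) (β : ℤ) (s : Finset ℤ)
    (hs : ∀ α ∉ s, a.coeff α = 0) :
    (a * b).coeff β = ∑ α ∈ s, a.coeff α * b.coeff (β - α) := by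
  classical
  rw [AddMonoidAlgebra.coeff_mul, Finsupp.sum_of_support_subset (s := s)]
  · refine Finset.sum_congr rfl fun α _ => ?_
    rw [Finsupp.sum, Finset.sum_eq_single (β - α)]
    · simp
    · intro γ _ hγ
      rw [if_neg]
      omega
    · intro h
      simp [Finsupp.notMem_support_iff.mp h]
  · intro α hα
    by_contra h
    exact (Finsupp.mem_support_iff.mp hα) (hs α h)
  · intro α _
    simp

/-- Series without constant term whose coefficient of `ε^j` contains only harmonics of index at
most `j` in absolute value. -/
structure IsGraded (f : Expansion) : Prop where
  cf_zero : ∀ α, cf 0 α f = 0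
  cf_eq_zero : ∀ (j : ℕ) (α : ℤ), (j : ℤ) < |α| → cf j α f = 0

/-- Gradedness bounds the harmonics of `f` at each order, which makes the convolution an explicit
finite sum. -/
theorem cf_mul {f : Expansion} (hf : IsGraded f) (g : Expansion) (j : ℕ) (β : ℤ) :
    cf j β (f * g) = ∑ i ∈ Finset.HasAntidiagonal.antidiagonal j, ∑ α ∈ Finset.Icc (-(i.1 : ℤ)) i.1,
      cf i.1 α f * cf i.2 (β - α) g := by
  rw [cf_apply, PowerSeries.coeff_mul, AddMonoidAlgebra.coeff_sum, Finsupp.finsetSum_apply]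
  refine Finset.sum_congr rfl fun i _ => ?_
  refine laurent_coeff_mul _ _ _ _ fun α hα => hf.cf_eq_zero i.1 α ?_
  rw [Finset.mem_Icc, ← abs_le] at hα
  exact not_le.mp hα

theorem IsGraded.mul {f g : Expansion} (hf : IsGraded f) (hg : IsGraded g) : IsGraded (f * g) where
  cf_zero α := by
    rw [cf_mul hf]
    simp [hf.cf_zero]
  cf_eq_zero j β hβ := by
    rw [cf_mul hf]
    refine Finset.sum_eq_zero fun i hi => Finset.sum_eq_zero fun α hα => ?_
    rw [Finset.HasAntidiagonal.mem_antidiagonal] at hi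
    rw [Finset.mem_Icc, ← abs_le] at hα
    rw [hg.cf_eq_zero i.2 (β - α), mul_zero]
    have := abs_sub_abs_le_abs_sub β α
    omega

theorem IsGraded.add {f g : Expansion} (hf : IsGraded f) (hg : IsGraded g) : IsGraded (f + g) where
  cf_zero α := by rw [map_add, hf.cf_zero, hg.cf_zero, add_zero]
  cf_eq_zero j β hβ := by rw [map_add, hf.cf_eq_zero j β hβ, hg.cf_eq_zero j β hβ, add_zero]

theorem IsGraded.smul {f : Expansion} (hf : IsGraded f) (r : ℝ) : IsGraded (r • f) where
  cf_zero α := by rw [map_smul, hf.cf_zero, smul_zero]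
  cf_eq_zero j β hβ := by rw [map_smul, hf.cf_eq_zero j β hβ, smul_zero]

/-- Graded series whose coefficient of `ε` has no zeroth harmonic. -/
structure IsWave (f : Expansion) : Prop extends IsGraded f where
  cf_one_zero : cf 1 0 f = 0

section products

variable {f g k : Expansion}

theorem cf_one_mul (hf : IsGraded f) (hg : IsGraded g) (α : ℤ) : cf 1 α (f * g) = 0 := by
  rw [cf_mul hf]
  refine Finset.sum_eq_zero fun i hi => Finset.sum_eq_zero fun α hα => ?_
  rw [Finset.HasAntidiagonal.mem_antidiagonal] at hi
  obtain h | h : i.1 = 0 ∨ i.2 = 0 := by omega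
  · rw [h, hf.cf_zero, zero_mul]
  · rw [h, hg.cf_zero, mul_zero]

theorem cf_two_mul (hf : IsWave f) (hg : IsWave g) :
    cf 2 0 (f * g) = cf 1 1 f * cf 1 (-1) g + cf 1 (-1) f * cf 1 1 g ∧
    cf 2 2 (f * g) = cf 1 1 f * cf 1 1 g ∧
    cf 2 1 (f * g) = 0 ∧ cf 2 (-1) (f * g) = 0 := by
  have e1 : Finset.Icc (-1 : ℤ) 1 = {-1, 0, 1} := by decide
  have hz := hg.cf_eq_zero
  refine ⟨?_, ?_, ?_, ?_⟩ <;>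
  · rw [cf_mul hf.toIsGraded]
    simp [Finset.Nat.antidiagonal_succ, hf.cf_zero, hg.cf_zero, e1, hf.cf_one_zero, hg.cf_one_zero,
      hz, add_comm]

theorem cf_three_mul (hf : IsWave f) (hg : IsWave g) :
    cf 3 0 (f * g) = cf 1 1 f * cf 2 (-1) g + cf 1 (-1) f * cf 2 1 g
      + cf 2 1 f * cf 1 (-1) g + cf 2 (-1) f * cf 1 1 g ∧
    cf 3 2 (f * g) = cf 1 1 f * cf 2 1 g + cf 2 1 f * cf 1 1 g ∧
    cf 3 1 (f * g) = cf 1 1 f * cf 2 0 g + cf 1 (-1) f * cf 2 2 g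
      + cf 2 0 f * cf 1 1 g + cf 2 2 f * cf 1 (-1) g := by
  have e1 : Finset.Icc (-1 : ℤ) 1 = {-1, 0, 1} := by decide
  have e2 : Finset.Icc (-2 : ℤ) 2 = {-2, -1, 0, 1, 2} := by decide
  have hz := hg.cf_eq_zero
  refine ⟨?_, ?_, ?_⟩ <;>
  · rw [cf_mul hf.toIsGraded]
    simp [Finset.Nat.antidiagonal_succ, hf.cf_zero, hg.cf_zero, e1, e2, hf.cf_one_zero,
      hg.cf_one_zero, hz]
    try ring

/-- Third harmonics are absent: they start at order three and need a harmonic `-2`, of order at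
least two, to reach the first harmonic. This is why only the harmonics `0`, `±1`, `2` are tracked at
lower orders. -/
theorem cf_four_mul (hf : IsWave f) (hg : IsWave g) :
    cf 4 1 (f * g) = cf 1 1 f * cf 3 0 g + cf 1 (-1) f * cf 3 2 g
      + cf 2 (-1) f * cf 2 2 g + cf 2 0 f * cf 2 1 g + cf 2 1 f * cf 2 0 g
      + cf 2 2 f * cf 2 (-1) g + cf 3 0 f * cf 1 1 g + cf 3 2 f * cf 1 (-1) g := by
  have e1 : Finset.Icc (-1 : ℤ) 1 = {-1, 0, 1} := by decide
  have e2 : Finset.Icc (-2 : ℤ) 2 = {-2, -1, 0, 1, 2} := by decide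
  have e3 : Finset.Icc (-3 : ℤ) 3 = {-3, -2, -1, 0, 1, 2, 3} := by decide
  have hz := hg.cf_eq_zero
  rw [cf_mul hf.toIsGraded]
  simp [Finset.Nat.antidiagonal_succ, hf.cf_zero, hg.cf_zero, e1, e2, e3, hf.cf_one_zero,
    hg.cf_one_zero, hz]
  ring

theorem IsWave.mul (hf : IsWave f) (hg : IsWave g) : IsWave (f * g) where
  toIsGraded := hf.toIsGraded.mul hg.toIsGraded
  cf_one_zero := cf_one_mul hf.toIsGraded hg.toIsGraded 0

theorem cf_two_mul_mul (hf : IsWave f) (hg : IsWave g) (hk : IsWave k) (α : ℤ) :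
    cf 2 α (f * g * k) = 0 := by
  rw [cf_mul (hf.mul hg).toIsGraded]
  refine Finset.sum_eq_zero fun i hi => Finset.sum_eq_zero fun α hα => ?_
  rw [Finset.HasAntidiagonal.mem_antidiagonal] at hi
  obtain h | h | h : i.1 = 0 ∨ i.1 = 1 ∨ i.2 = 0 := by omega
  · rw [h, (hf.mul hg).cf_zero, zero_mul]
  · rw [h, cf_one_mul hf.toIsGraded hg.toIsGraded, zero_mul]
  · rw [h, hk.cf_zero, mul_zero]

theorem cf_three_mul_mul (hf : IsWave f) (hg : IsWave g) (hk : IsWave k) :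
    cf 3 0 (f * g * k) = 0 ∧ cf 3 2 (f * g * k) = 0 ∧
    cf 3 1 (f * g * k) = cf 1 1 f * cf 1 1 g * cf 1 (-1) k + cf 1 1 f * cf 1 (-1) g * cf 1 1 k
      + cf 1 (-1) f * cf 1 1 g * cf 1 1 k := by
  obtain ⟨h0, h2, h1, h1'⟩ := cf_two_mul hf hg
  have ho := cf_one_mul hf.toIsGraded hg.toIsGraded
  obtain ⟨k0, k2, k1⟩ := cf_three_mul (hf.mul hg) hk
  rw [k0, k2, k1, h0, h2, h1, h1', ho, ho]
  refine ⟨?_, ?_, ?_⟩ <;> ring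

theorem cf_four_mul_mul (hf : IsWave f) (hg : IsWave g) (hk : IsWave k) :
    cf 4 1 (f * g * k) =
      cf 1 1 f * cf 1 1 g * cf 2 (-1) k + cf 1 1 f * cf 1 (-1) g * cf 2 1 k
      + cf 1 (-1) f * cf 1 1 g * cf 2 1 k + cf 1 1 f * cf 2 (-1) g * cf 1 1 k
      + cf 1 1 f * cf 2 1 g * cf 1 (-1) k + cf 1 (-1) f * cf 2 1 g * cf 1 1 k
      + cf 2 (-1) f * cf 1 1 g * cf 1 1 k + cf 2 1 f * cf 1 (-1) g * cf 1 1 k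
      + cf 2 1 f * cf 1 1 g * cf 1 (-1) k := by
  obtain ⟨h0, h2, h1, h1'⟩ := cf_two_mul hf hg
  obtain ⟨k0, k2, k1⟩ := cf_three_mul hf hg
  have ho := cf_one_mul hf.toIsGraded hg.toIsGraded
  rw [cf_four_mul (hf.mul hg) hk, h0, h2, h1, h1', k0, k2, ho, ho]
  ring

/-- Four waves first meet at order four, where four harmonics `±1` have an even sum. So the `ζ` term
does not reach any coefficient used for the amplitude equations. -/
theorem cf_mul_mul_mul {l : Expansion} (hf : IsWave f) (hg : IsWave g) (hk : IsWave k)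
    (hl : IsWave l) :
    cf 2 0 (f * g * k * l) = 0 ∧ cf 2 2 (f * g * k * l) = 0 ∧ cf 2 1 (f * g * k * l) = 0 ∧
    cf 3 0 (f * g * k * l) = 0 ∧ cf 3 2 (f * g * k * l) = 0 ∧ cf 3 1 (f * g * k * l) = 0 ∧
    cf 4 1 (f * g * k * l) = 0 := by
  have hfg := hf.mul hg
  have hfgk := hfg.mul hk
  have o1 := cf_one_mul hfg.toIsGraded hk.toIsGraded
  have o2 := cf_two_mul_mul hf hg hk
  obtain ⟨k0, k2, k1⟩ := cf_three_mul_mul hf hg hk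
  obtain ⟨a0, a2, a1, -⟩ := cf_two_mul hfgk hl
  obtain ⟨b0, b2, b1⟩ := cf_three_mul hfgk hl
  rw [cf_four_mul hfgk hl, a0, a2, a1, b0, b2, b1, k0, k2]
  simp [o1, o2]

end products

end DiffPoly

/-! ### Weighted sums over the corners of the square -/

namespace QCoeffs

section sums

variable (p : QCoeffs) {M M' : Type*} [AddCommGroup M] [Module ℝ M] [AddCommGroup M'] [Module ℝ M']

/-- The linear part of the equation; the lattice points `(0,0)`, `(1,0)`, `(0,1)`, `(1,1)` are
numbered `0`, `1`, `2`, `3`. -/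
def linSum (x : Fin 4 → M) : M := p.a₁ • (x 0 + x 3) + p.a₂ • (x 1 + x 2)

/-- The sum over pairs of lattice points, with the quadratic coefficients as weights. -/
def pairSum (B : Fin 4 → Fin 4 → M) : M :=
  (p.α₁ - p.α₂) • B 0 1 + (p.α₁ + p.α₂) • B 2 3 + (p.β₁ - p.β₂) • B 0 2 + (p.β₁ + p.β₂) • B 1 3
    + p.γ₁ • B 0 3 + p.γ₂ • B 1 2

/-- The sum over triples of lattice points, with the cubic coefficients as weights. -/
def tripleSum (B : Fin 4 → Fin 4 → Fin 4 → M) : M :=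
  (p.ξ₁ - p.ξ₃) • B 0 1 2 + (p.ξ₁ + p.ξ₃) • B 0 1 3 + (p.ξ₂ - p.ξ₄) • B 1 2 3
    + (p.ξ₂ + p.ξ₄) • B 0 2 3

theorem quad_eq {A : Type*} [CommRing A] [Algebra ℝ A] (x : Fin 4 → A) :
    p.quad (x 0) (x 1) (x 2) (x 3) = p.linSum x + p.pairSum (fun c d => x c * x d)
      + p.tripleSum (fun c d e => x c * x d * x e) + p.ζ • (x 0 * x 1 * x 2 * x 3) := by
  simp only [quad, linSum, pairSum, tripleSum]
  abel

theorem map_linSum (φ : M →ₗ[ℝ] M') (x : Fin 4 → M) :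
    φ (p.linSum x) = p.linSum fun c => φ (x c) := by
  simp only [linSum, map_add, map_smul]

theorem map_pairSum (φ : M →ₗ[ℝ] M') (B : Fin 4 → Fin 4 → M) :
    φ (p.pairSum B) = p.pairSum fun c d => φ (B c d) := by
  simp only [pairSum, map_add, map_smul]

theorem map_tripleSum (φ : M →ₗ[ℝ] M') (B : Fin 4 → Fin 4 → Fin 4 → M) :
    φ (p.tripleSum B) = p.tripleSum fun c d e => φ (B c d e) := by
  simp only [tripleSum, map_add, map_smul]

theorem linSum_add (x y : Fin 4 → M) :
    p.linSum (fun c => x c + y c) = p.linSum x + p.linSum y := by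
  simp only [linSum, smul_add]; abel

theorem pairSum_add (B B' : Fin 4 → Fin 4 → M) :
    p.pairSum (fun c d => B c d + B' c d) = p.pairSum B + p.pairSum B' := by
  simp only [pairSum, smul_add]; abel

theorem tripleSum_add (B B' : Fin 4 → Fin 4 → Fin 4 → M) :
    p.tripleSum (fun c d e => B c d e + B' c d e) = p.tripleSum B + p.tripleSum B' := by
  simp only [tripleSum, smul_add]; abel

theorem linSum_sub (x y : Fin 4 → M) :
    p.linSum (fun c => x c - y c) = p.linSum x - p.linSum y := by
  simp only [linSum, smul_add, smul_sub]; abel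

/-- Stated for an abstract property so that gradedness and reality of the whole left-hand side both
follow from those of the monomials. -/
theorem sum_induction {P : M → Prop} (hadd : ∀ {x y}, P x → P y → P (x + y))
    (hsmul : ∀ (r : ℝ) {x}, P x → P (r • x)) {x : Fin 4 → M} {B : Fin 4 → Fin 4 → M}
    {D : Fin 4 → Fin 4 → Fin 4 → M} {y : M} (hx : ∀ c, P (x c)) (hB : ∀ c d, P (B c d))
    (hD : ∀ c d e, P (D c d e)) (hy : P y) :
    P (p.linSum x + p.pairSum B + p.tripleSum D + p.ζ • y) :=
  hadd (hadd (hadd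
    (hadd (hsmul _ (hadd (hx _) (hx _))) (hsmul _ (hadd (hx _) (hx _))))
    (hadd (hadd (hadd (hadd (hadd (hsmul _ (hB _ _)) (hsmul _ (hB _ _))) (hsmul _ (hB _ _)))
      (hsmul _ (hB _ _))) (hsmul _ (hB _ _))) (hsmul _ (hB _ _))))
    (hadd (hadd (hadd (hsmul _ (hD _ _ _)) (hsmul _ (hD _ _ _))) (hsmul _ (hD _ _ _)))
      (hsmul _ (hD _ _ _)))) (hsmul _ hy)

end sums

end QCoeffs

/-! ### Complex conjugation, shifted fields and reality -/

namespace DiffPoly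

section conj

@[simp] theorem conj_C (z : ℂ) : conj (MvPolynomial.C z) = MvPolynomial.C (starRingEnd ℂ z) := by
  simp [conj]

@[simp] theorem conj_const (z : ℂ) : conj (const z) = const (starRingEnd ℂ z) := conj_C z

@[simp] theorem conj_u (j k : ℕ) : conj (u j k) = ubar j k := by simp [conj, u]

@[simp] theorem conj_ubar (j k : ℕ) : conj (ubar j k) = u j k := by simp [conj, ubar]

theorem conj_conj (f : DiffPoly) : conj (conj f) = f := by
  induction f using MvPolynomial.induction_on with
  | C a => simp
  | add f g hf hg => rw [map_add, map_add, hf, hg]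
  | mul_X f i hf =>
    rw [map_mul, map_mul, hf]
    cases i with
    | amp j k => exact congrArg (f * ·) ((congrArg conj (conj_u j k)).trans (conj_ubar j k))
    | ampBar j k => exact congrArg (f * ·) ((congrArg conj (conj_ubar j k)).trans (conj_u j k))

theorem conj_smul (r : ℝ) (f : DiffPoly) : conj (r • f) = r • conj f := by
  rw [Algebra.smul_def, Algebra.smul_def, map_mul]
  congr 1
  exact (conj_C _).trans (congrArg MvPolynomial.C (Complex.conj_ofReal r))

theorem conj_complex_smul (z : ℂ) (f : DiffPoly) : conj (z • f) = starRingEnd ℂ z • conj f := by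
  rw [MvPolynomial.smul_eq_C_mul, MvPolynomial.smul_eq_C_mul, map_mul, conj_C]

/-- Conjugation is only conjugate-linear, but derivations kill constants, so agreement on the
variables propagates through the Leibniz rule. -/
theorem conj_derivation (D : Derivation ℂ DiffPoly DiffPoly)
    (hD : ∀ i, conj (D (MvPolynomial.X i)) = D (conj (MvPolynomial.X i))) (f : DiffPoly) :
    conj (D f) = D (conj f) := by
  induction f using MvPolynomial.induction_on with
  | C a => rw [conj_C, MvPolynomial.derivation_C, MvPolynomial.derivation_C, map_zero]
  | add f g hf hg => rw [map_add, map_add, map_add, map_add, hf, hg]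
  | mul_X f i hf =>
    rw [Derivation.leibniz, map_mul conj, Derivation.leibniz, map_add, smul_eq_mul, smul_eq_mul,
      smul_eq_mul, smul_eq_mul, map_mul, map_mul, hD, hf]

@[simp] theorem dξ_u (j k : ℕ) : dξ (u j k) = u j (k + 1) := by
  rw [u, dξ, MvPolynomial.mkDerivation_X]

@[simp] theorem dξ_ubar (j k : ℕ) : dξ (ubar j k) = ubar j (k + 1) := by
  rw [ubar, dξ, MvPolynomial.mkDerivation_X]

@[simp] theorem dξ_const (z : ℂ) : dξ (const z) = 0 := MvPolynomial.derivation_C _ _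

theorem flow_u (F : ℕ → DiffPoly) (j k : ℕ) : flow F (u j k) = dξ^[k] (F j) := by
  rw [u, flow, MvPolynomial.mkDerivation_X]

theorem flow_ubar (F : ℕ → DiffPoly) (j k : ℕ) : flow F (ubar j k) = dξ^[k] (conj (F j)) := by
  rw [ubar, flow, MvPolynomial.mkDerivation_X]

theorem conj_dξ (f : DiffPoly) : conj (dξ f) = dξ (conj f) := by
  refine conj_derivation dξ (fun i => ?_) f
  cases i with
  | amp j k =>
    exact (congrArg conj (dξ_u j k)).trans
      ((conj_u _ _).trans ((congrArg dξ (conj_u j k)).trans (dξ_ubar j k)).symm)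
  | ampBar j k =>
    exact (congrArg conj (dξ_ubar j k)).trans
      ((conj_ubar _ _).trans ((congrArg dξ (conj_ubar j k)).trans (dξ_u j k)).symm)

theorem conj_dξ_iterate (k : ℕ) (f : DiffPoly) : conj (dξ^[k] f) = dξ^[k] (conj f) := by
  induction k generalizing f with
  | zero => rfl
  | succ k ih => rw [Function.iterate_succ_apply, ih, conj_dξ, Function.iterate_succ_apply]

theorem conj_flow (F : ℕ → DiffPoly) (f : DiffPoly) : conj (flow F f) = flow F (conj f) := by
  refine conj_derivation _ (fun i => ?_) f
  cases i with
  | amp j k =>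
    rw [← u, conj_u, flow_u, flow_ubar, conj_dξ_iterate]
  | ampBar j k =>
    rw [← ubar, conj_ubar, flow_u, flow_ubar, conj_dξ_iterate, conj_conj]

theorem conj_shiftOp {δ₁ δ₂ δ₃ : Derivation ℂ DiffPoly DiffPoly}
    (h₁ : ∀ f, conj (δ₁ f) = δ₁ (conj f)) (h₂ : ∀ f, conj (δ₂ f) = δ₂ (conj f))
    (h₃ : ∀ f, conj (δ₃ f) = δ₃ (conj f)) (i : ℕ) (f : DiffPoly) :
    conj (shiftOp δ₁ δ₂ δ₃ i f) = shiftOp δ₁ δ₂ δ₃ i (conj f) := by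
  match i with
  | 0 => rfl
  | 1 => exact h₁ f
  | 2 => simp [shiftOp, conj_complex_smul, h₁, h₂, map_ofNat]
  | 3 => simp [shiftOp, conj_complex_smul, h₁, h₂, h₃, map_ofNat]
  | _ + 4 => simp [shiftOp]

end conj

/-- The operators describing a shift which acts by `s ∂_ξ` on the first slow scale, and by `t` times
the flows `F₂` and `F₃` on the next ones. -/
def cornerOp (F₂ F₃ : ℕ → DiffPoly) (s t : ℝ) : ℕ → DiffPoly → DiffPoly :=
  shiftOp ((s : ℂ) • dξ) ((t : ℂ) • flow F₂) ((t : ℂ) • flow F₃)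

theorem conj_cornerOp (F₂ F₃ : ℕ → DiffPoly) (s t : ℝ) (i : ℕ) (f : DiffPoly) :
    conj (cornerOp F₂ F₃ s t i f) = cornerOp F₂ F₃ s t i (conj f) := by
  refine conj_shiftOp (fun f => ?_) (fun f => ?_) (fun f => ?_) i f <;>
  simp [conj_smul, conj_dξ, conj_flow]

theorem const_smul (r : ℝ) (z : ℂ) : const (r • z) = r • const z := by
  rw [Algebra.smul_def, Algebra.smul_def]
  exact MvPolynomial.C_mul

/-- Multiplication of constants with a fixed differential polynomial. -/
def constMul (f : DiffPoly) : ℂ →ₗ[ℝ] DiffPoly where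
  toFun z := const z * f
  map_add' z w := by rw [const, MvPolynomial.C_add, add_mul]; rfl
  map_smul' r z := by rw [const_smul, smul_mul_assoc]; rfl

theorem cf_field (op : ℕ → DiffPoly → DiffPoly) (z : ℂ) (h : ℕ → ℤ → DiffPoly) (j : ℕ) (β : ℤ) :
    cf j β (field op z h) =
      const (z ^ β) * ∑ ℓ ∈ Finset.Icc (max 1 β.natAbs) j, op (j - ℓ) (h ℓ β) := by
  have e : ∀ (c : DiffPoly) (α : ℤ),
      (LaurentPolynomial.C c * LaurentPolynomial.T α).coeff β = if α = β then c else 0 := by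
    intro c α
    rw [← LaurentPolynomial.single_eq_C_mul_T]
    exact Finsupp.single_apply
  rw [cf_apply, field, PowerSeries.coeff_mk, AddMonoidAlgebra.coeff_sum, Finsupp.finsetSum_apply]
  simp only [e]
  rw [Finset.sum_ite_eq']
  split_ifs with h
  · rfl
  · rw [Finset.Icc_eq_empty, Finset.sum_empty, mul_zero]
    rw [Finset.mem_Icc] at h
    omega

theorem isGraded_field (op : ℕ → DiffPoly → DiffPoly) (z : ℂ) (h : ℕ → ℤ → DiffPoly) :
    IsGraded (field op z h) where
  cf_zero α := by
    rw [cf_field, Finset.Icc_eq_empty (by omega), Finset.sum_empty, mul_zero]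
  cf_eq_zero j α hα := by
    rw [Int.abs_eq_natAbs] at hα
    rw [cf_field, Finset.Icc_eq_empty (by omega), Finset.sum_empty, mul_zero]

/-- Two series have the same coefficients up to `ε^n`. -/
def AgreeUpTo (n : ℕ) (f f' : Expansion) : Prop := ∀ j ≤ n, ∀ α, cf j α f = cf j α f'

theorem AgreeUpTo.mono {m n : ℕ} {f f' : Expansion} (h : AgreeUpTo n f f') (hm : m ≤ n) :
    AgreeUpTo m f f' := fun j hj => h j (hj.trans hm)

/-- One order is gained because neither factor has a constant term: at order `n + 1`, both indices
are at most `n` or one of them is zero. Hence the amplitudes of top order enter only the linear part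
of the equation. -/
theorem AgreeUpTo.mul {n : ℕ} {f f' g g' : Expansion} (h : AgreeUpTo n f f')
    (h' : AgreeUpTo n g g') (hf : IsGraded f) (hf' : IsGraded f') (hg : IsGraded g)
    (hg' : IsGraded g') : AgreeUpTo (n + 1) (f * g) (f' * g') := by
  intro j hj α
  rw [cf_mul hf, cf_mul hf']
  refine Finset.sum_congr rfl fun i hi => Finset.sum_congr rfl fun α hα => ?_
  rw [Finset.HasAntidiagonal.mem_antidiagonal] at hi
  obtain h0 | h0 | ⟨h1, h2⟩ : i.1 = 0 ∨ i.2 = 0 ∨ (i.1 ≤ n ∧ i.2 ≤ n) := by omega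
  · rw [h0, hf.cf_zero, hf'.cf_zero, zero_mul, zero_mul]
  · rw [h0, hg.cf_zero, hg'.cf_zero, mul_zero, mul_zero]
  · rw [h _ h1, h' _ h2]

theorem agreeUpTo_field (op : ℕ → DiffPoly → DiffPoly) (z : ℂ) {h h' : ℕ → ℤ → DiffPoly} {n : ℕ}
    (hh : ∀ ℓ ≤ n, ∀ α, h ℓ α = h' ℓ α) : AgreeUpTo n (field op z h) (field op z h') := by
  intro j hj α
  rw [cf_field, cf_field]
  congr 1
  refine Finset.sum_congr rfl fun ℓ hℓ => ?_
  rw [Finset.mem_Icc] at hℓ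
  rw [hh ℓ (by omega)]

theorem cf_field_sub (op : ℕ → DiffPoly → DiffPoly) (hop : ∀ f, op 0 f = f) (z : ℂ)
    {h h' : ℕ → ℤ → DiffPoly} {n : ℕ} (hh : ∀ ℓ ≤ n, ∀ α, h ℓ α = h' ℓ α) {α : ℤ}
    (hα : α.natAbs ≤ n + 1) :
    cf (n + 1) α (field op z h) - cf (n + 1) α (field op z h') =
      const (z ^ α) * (h (n + 1) α - h' (n + 1) α) := by
  rw [cf_field, cf_field, Finset.sum_Icc_succ_top (by omega), Finset.sum_Icc_succ_top (by omega),
    Nat.sub_self, hop, hop, ← mul_sub]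
  congr 1
  have : ∑ ℓ ∈ Finset.Icc (max 1 α.natAbs) n, op (n + 1 - ℓ) (h ℓ α) =
      ∑ ℓ ∈ Finset.Icc (max 1 α.natAbs) n, op (n + 1 - ℓ) (h' ℓ α) := by
    refine Finset.sum_congr rfl fun ℓ hℓ => ?_
    rw [Finset.mem_Icc] at hℓ
    rw [hh ℓ hℓ.2]
  rw [this]
  ring

/-- Series which represent real fields. -/
def IsReal (f : Expansion) : Prop := ∀ j α, cf j (-α) f = conj (cf j α f)

theorem IsReal.add {f g : Expansion} (hf : IsReal f) (hg : IsReal g) : IsReal (f + g) :=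
  fun j α => by rw [map_add, map_add, map_add, hf, hg]

theorem IsReal.smul {f : Expansion} (hf : IsReal f) (r : ℝ) : IsReal (r • f) :=
  fun j α => by rw [map_smul, map_smul, conj_smul, hf]

theorem IsReal.mul {f g : Expansion} (hf : IsReal f) (hg : IsReal g) (hf' : IsGraded f) :
    IsReal (f * g) := by
  intro j β
  rw [cf_mul hf', cf_mul hf', map_sum]
  refine Finset.sum_congr rfl fun i _ => ?_
  rw [map_sum]
  -- The sum over harmonics is symmetric, so conjugation amounts to the reindexing `α ↦ -α`.
  refine Finset.sum_nbij' (fun α => -α) (fun α => -α) ?_ ?_ ?_ ?_ ?_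
  · intro α hα
    rw [Finset.mem_Icc] at hα ⊢
    omega
  · intro α hα
    rw [Finset.mem_Icc] at hα ⊢
    omega
  · intro α _
    exact neg_neg α
  · intro α _
    exact neg_neg α
  · intro α _
    rw [map_mul, ← hf, ← hg, neg_neg]
    congr 2
    ring_nf

theorem isReal_field {op : ℕ → DiffPoly → DiffPoly} (hop : ∀ i f, conj (op i f) = op i (conj f))
    {z : ℂ} (hz : starRingEnd ℂ z = z⁻¹) {h : ℕ → ℤ → DiffPoly}
    (hh : ∀ j α, h j (-α) = conj (h j α)) : IsReal (field op z h) := by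
  intro j α
  rw [cf_field, cf_field, map_mul, conj_const, map_sum, map_zpow₀, hz, Int.natAbs_neg, zpow_neg,
    inv_zpow]
  simp only [hh, hop]

end DiffPoly

/-! ### The expansion in terms of corner data -/

namespace QCoeffs

open DiffPoly

/-- The left-hand side of the equation, for a field with carrier factors `z` and slow shifts `s`,
`t` at the four lattice points. -/
def cornerExpansion (p : QCoeffs) (z : Fin 4 → ℂ) (s t : Fin 4 → ℝ) (F₂ F₃ : ℕ → DiffPoly)
    (h : ℕ → ℤ → DiffPoly) : Expansion :=
  p.quad (field (cornerOp F₂ F₃ (s 0) (t 0)) (z 0) h) (field (cornerOp F₂ F₃ (s 1) (t 1)) (z 1) h)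
    (field (cornerOp F₂ F₃ (s 2) (t 2)) (z 2) h) (field (cornerOp F₂ F₃ (s 3) (t 3)) (z 3) h)

theorem expansion_eq (p : QCoeffs) (κ ω v : ℝ) (F₂ F₃ : ℕ → DiffPoly) (h : ℕ → ℤ → DiffPoly) :
    p.expansion κ ω v F₂ F₃ h =
      p.cornerExpansion ![1, carrierK κ, carrierΩ ω, carrierK κ * carrierΩ ω] ![0, 1, -v, 1 - v]
        ![0, 0, 1, 1] F₂ F₃ h := by
  have e : dξ + (-(v : ℂ)) • dξ = ((1 - v : ℝ) : ℂ) • dξ := by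
    push_cast
    module
  simp only [expansion, cornerExpansion, cornerOp, e]
  simp

variable (p : QCoeffs) {z : Fin 4 → ℂ} {s t : Fin 4 → ℝ} {F₂ F₃ : ℕ → DiffPoly}

theorem cornerExpansion_eq (h : ℕ → ℤ → DiffPoly) :
    p.cornerExpansion z s t F₂ F₃ h =
      let x : Fin 4 → Expansion := fun c => field (cornerOp F₂ F₃ (s c) (t c)) (z c) h
      p.linSum x + p.pairSum (fun c d => x c * x d)
        + p.tripleSum (fun c d e => x c * x d * x e) + p.ζ • (x 0 * x 1 * x 2 * x 3) :=
  p.quad_eq fun c => field (cornerOp F₂ F₃ (s c) (t c)) (z c) h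

theorem isGraded_cornerExpansion (h : ℕ → ℤ → DiffPoly) :
    IsGraded (p.cornerExpansion z s t F₂ F₃ h) := by
  have hx : ∀ c, IsGraded (field (cornerOp F₂ F₃ (s c) (t c)) (z c) h) :=
    fun c => isGraded_field _ _ _
  have hxx := fun c d => (hx c).mul (hx d)
  have hxxx := fun c d e => (hxx c d).mul (hx e)
  have h4 := (hxxx 0 1 2).mul (hx 3)
  rw [cornerExpansion_eq]
  exact p.sum_induction (fun h h' => h.add h') (fun r _ h => h.smul r) hx hxx hxxx h4

theorem isReal_cornerExpansion {h : ℕ → ℤ → DiffPoly} (hz : ∀ c, starRingEnd ℂ (z c) = (z c)⁻¹)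
    (hh : ∀ j α, h j (-α) = conj (h j α)) : IsReal (p.cornerExpansion z s t F₂ F₃ h) := by
  have hg : ∀ c, IsGraded (field (cornerOp F₂ F₃ (s c) (t c)) (z c) h) :=
    fun c => isGraded_field _ _ _
  have hx : ∀ c, IsReal (field (cornerOp F₂ F₃ (s c) (t c)) (z c) h) :=
    fun c => isReal_field (conj_cornerOp _ _ _ _) (hz c) hh
  have hxx := fun c d => (hx c).mul (hx d) (hg c)
  have hxxx := fun c d e => (hxx c d).mul (hx e) ((hg c).mul (hg d))
  have h4 := (hxxx 0 1 2).mul (hx 3) (((hg 0).mul (hg 1)).mul (hg 2))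
  rw [cornerExpansion_eq]
  exact p.sum_induction (fun h h' => h.add h') (fun r _ h => h.smul r) hx hxx hxxx h4

/-- Changing the amplitudes of order `n + 1` changes the coefficient of `ε^(n+1)` only through the
linear part of the equation. -/
theorem cf_cornerExpansion_sub {h h' : ℕ → ℤ → DiffPoly} {n : ℕ}
    (hh : ∀ ℓ ≤ n, ∀ α, h ℓ α = h' ℓ α) :
    (∀ j ≤ n, ∀ α, cf j α (p.cornerExpansion z s t F₂ F₃ h) =
      cf j α (p.cornerExpansion z s t F₂ F₃ h')) ∧
    ∀ α : ℤ, α.natAbs ≤ n + 1 → cf (n + 1) α (p.cornerExpansion z s t F₂ F₃ h) =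
      cf (n + 1) α (p.cornerExpansion z s t F₂ F₃ h')
        + const (p.linSum fun c => z c ^ α) * (h (n + 1) α - h' (n + 1) α) := by
  have hg : ∀ h c, IsGraded (field (cornerOp F₂ F₃ (s c) (t c)) (z c) h) :=
    fun h c => isGraded_field _ _ _
  have hx : ∀ c, AgreeUpTo n (field (cornerOp F₂ F₃ (s c) (t c)) (z c) h)
      (field (cornerOp F₂ F₃ (s c) (t c)) (z c) h') := fun c => agreeUpTo_field _ _ hh
  have hxx := fun c d => (hx c).mul (hx d) (hg _ c) (hg _ c) (hg _ d) (hg _ d)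
  have hxxx := fun c d e => ((hxx c d).mono n.le_succ).mul (hx e) ((hg _ c).mul (hg _ d))
    ((hg _ c).mul (hg _ d)) (hg _ e) (hg _ e)
  have h4 := ((hxxx 0 1 2).mono n.le_succ).mul (hx 3) (((hg _ 0).mul (hg _ 1)).mul (hg _ 2))
    (((hg _ 0).mul (hg _ 1)).mul (hg _ 2)) (hg _ 3) (hg _ 3)
  have hdiff : ∀ j ≤ n + 1, ∀ α, cf j α (p.cornerExpansion z s t F₂ F₃ h) =
      cf j α (p.cornerExpansion z s t F₂ F₃ h') +
      p.linSum (fun c => cf j α (field (cornerOp F₂ F₃ (s c) (t c)) (z c) h) -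
        cf j α (field (cornerOp F₂ F₃ (s c) (t c)) (z c) h')) := by
    intro j hj α
    rw [cornerExpansion_eq, cornerExpansion_eq, linSum_sub]
    simp only [map_add, map_linSum, map_pairSum, map_tripleSum, map_smul, hxx _ _ j hj,
      hxxx _ _ _ j hj, h4 j hj]
    abel
  constructor
  · intro j hj α
    rw [hdiff j (by omega) α]
    simp only [hx _ j hj, sub_self]
    simp [linSum]
  · intro α hα
    rw [hdiff _ le_rfl α]
    congr 1
    simp only [cf_field_sub (cornerOp F₂ F₃ _ _) (fun _ => rfl) _ hh hα]
    exact (p.map_linSum (constMul (h (n + 1) α - h' (n + 1) α)) fun c => z c ^ α).symm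

end QCoeffs

/-! ### Solving for the slave harmonics -/

namespace QCoeffs

open DiffPoly

/-- Induction on the order: at order `n + 1` a new amplitude of harmonic `α` is multiplied by the
linear symbol at `α`, which can be inverted away from `±1`. The correction is compatible with
conjugation because the left-hand side is real. -/
theorem exists_harmonics (p : QCoeffs) {z : Fin 4 → ℂ} {s t : Fin 4 → ℝ} (F₂ F₃ : ℕ → DiffPoly)
    (hz : ∀ c, starRingEnd ℂ (z c) = (z c)⁻¹) (N : ℕ)
    (hL : ∀ α : ℤ, α ≠ 1 → α ≠ -1 → α.natAbs ≤ N → p.linSum (fun c => z c ^ α) ≠ 0) :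
    ∃ h : ℕ → ℤ → DiffPoly, (∀ j, h j 1 = u j 0) ∧ (∀ j α, h j (-α) = conj (h j α)) ∧
      ∀ j ≤ N, ∀ α, α ≠ 1 → α ≠ -1 → cf j α (p.cornerExpansion z s t F₂ F₃ h) = 0 := by
  suffices H : ∀ n ≤ N, ∃ h : ℕ → ℤ → DiffPoly, (∀ j, h j 1 = u j 0) ∧
      (∀ j α, h j (-α) = conj (h j α)) ∧
      ∀ j ≤ n, ∀ α, α ≠ 1 → α ≠ -1 → cf j α (p.cornerExpansion z s t F₂ F₃ h) = 0 from H N le_rfl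
  intro n
  induction n with
  | zero =>
    intro _
    refine ⟨fun j α => if α = 1 then u j 0 else if α = -1 then ubar j 0 else 0, fun j => ?_,
      fun j α => ?_, fun j hj α _ _ => ?_⟩
    · simp
    · dsimp only
      split_ifs <;> first | omega | simp
    · rw [Nat.le_zero.mp hj]
      exact (p.isGraded_cornerExpansion _).cf_zero α
  | succ n ih =>
    intro hn
    obtain ⟨h, h1, hconj, hW⟩ := ih (by omega)
    set W := fun α => cf (n + 1) α (p.cornerExpansion z s t F₂ F₃ h) with hWdef
    set c : ℤ → ℂ := fun α => (p.linSum fun c => z c ^ α)⁻¹ with hc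
    -- One Newton step, exact since the dependence on top-order amplitudes is affine. Harmonics
    -- beyond `n + 1` are left alone because the field of this order does not contain them.
    let h' : ℕ → ℤ → DiffPoly := fun ℓ α =>
      if ℓ = n + 1 ∧ α ≠ 1 ∧ α ≠ -1 ∧ α.natAbs ≤ n + 1 then h ℓ α - const (c α) * W α else h ℓ α
    have hWr : ∀ α, W (-α) = conj (W α) := p.isReal_cornerExpansion hz hconj (n + 1)
    have hcr : ∀ α, c (-α) = starRingEnd ℂ (c α) := by
      intro α
      simp only [hc, map_inv₀]
      congr 1
      have := p.map_linSum (Complex.conjAe.toLinearMap) fun c => z c ^ α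
      refine Eq.trans ?_ this.symm
      congr 1
      funext d
      change _ = starRingEnd ℂ (z d ^ α)
      rw [map_zpow₀, hz, zpow_neg, inv_zpow]
    have hagree : ∀ ℓ ≤ n, ∀ α, h' ℓ α = h ℓ α := fun ℓ hℓ α => if_neg (by omega)
    obtain ⟨hlow, htop⟩ := p.cf_cornerExpansion_sub (z := z) (s := s) (t := t) (F₂ := F₂)
      (F₃ := F₃) hagree
    refine ⟨h', fun j => ?_, fun j α => ?_, fun j hj α hα hα' => ?_⟩
    · exact (if_neg (by omega)).trans (h1 j)
    · by_cases hα : j = n + 1 ∧ α ≠ 1 ∧ α ≠ -1 ∧ α.natAbs ≤ n + 1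
      · have hα' : j = n + 1 ∧ -α ≠ 1 ∧ -α ≠ -1 ∧ (-α).natAbs ≤ n + 1 := by omega
        simp only [h']
        rw [if_pos hα, if_pos hα', map_sub, map_mul, hconj, hWr, conj_const, hcr]
      · have hα' : ¬ (j = n + 1 ∧ -α ≠ 1 ∧ -α ≠ -1 ∧ (-α).natAbs ≤ n + 1) := by omega
        simp only [h']
        rw [if_neg hα, if_neg hα', hconj]
    · obtain hj' | rfl : j ≤ n ∨ j = n + 1 := by omega
      · rw [hlow j hj', hW j hj' α hα hα']
      · by_cases hle : α.natAbs ≤ n + 1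
        · rw [htop α hle]
          simp only [h']
          rw [if_pos ⟨trivial, hα, hα', hle⟩, sub_sub_cancel_left, mul_neg, ← mul_assoc]
          have : const (p.linSum fun c => z c ^ α) * const (c α) = 1 := by
            rw [const, const, ← MvPolynomial.C_mul, hc,
              mul_inv_cancel₀ (hL α hα hα' (by omega)), MvPolynomial.C_1]
          rw [this, one_mul]
          exact add_neg_cancel _
        · exact (p.isGraded_cornerExpansion _).cf_eq_zero _ _ (by
            rw [Int.abs_eq_natAbs]; omega)

end QCoeffs

/-! ### Coefficients of the fields up to fourth order -/

namespace DiffPoly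

variable {F₂ F₃ : ℕ → DiffPoly} {s t : ℝ} {z : ℂ} {h : ℕ → ℤ → DiffPoly}

theorem cornerOp_zero (f : DiffPoly) : cornerOp F₂ F₃ s t 0 f = f := rfl

theorem cornerOp_one (f : DiffPoly) : cornerOp F₂ F₃ s t 1 f = const s * dξ f := by
  simp [cornerOp, shiftOp, const, Algebra.smul_def]

theorem cornerOp_two (f : DiffPoly) :
    cornerOp F₂ F₃ s t 2 f = const (s ^ 2) * (const (1 / 2) * dξ (dξ f)) + const t * flow F₂ f := by
  simp only [cornerOp, shiftOp, const, Derivation.smul_apply, Derivation.map_smul]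
  simp only [MvPolynomial.smul_eq_C_mul, MvPolynomial.C_pow]
  ring

theorem cornerOp_three (f : DiffPoly) :
    cornerOp F₂ F₃ s t 3 f = const (s ^ 3) * (const (1 / 6) * dξ (dξ (dξ f)))
      + const (s * t) * dξ (flow F₂ f) + const t * flow F₃ f := by
  simp only [cornerOp, shiftOp, const, Derivation.smul_apply, Derivation.map_smul]
  simp only [MvPolynomial.smul_eq_C_mul, MvPolynomial.C_pow, MvPolynomial.C_mul]
  ring

/-- The coefficients which enter the equations for the first harmonic. -/
theorem cf_cornerField (h10 : h 1 0 = 0) (h1 : ∀ j, h j 1 = u j 0)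
    (hc : ∀ j α, h j (-α) = conj (h j α)) :
    let f := field (cornerOp F₂ F₃ s t) z h
    cf 1 1 f = const z * u 1 0 ∧ cf 1 (-1) f = const z⁻¹ * ubar 1 0 ∧
    cf 2 0 f = h 2 0 ∧ cf 2 1 f = const z * (u 2 0 + const s * u 1 1) ∧
    cf 2 (-1) f = const z⁻¹ * (ubar 2 0 + const s * ubar 1 1) ∧
    cf 2 2 f = const (z ^ 2) * h 2 2 ∧
    cf 3 0 f = h 3 0 + const s * dξ (h 2 0) ∧
    cf 3 2 f = const (z ^ 2) * (h 3 2 + const s * dξ (h 2 2)) ∧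
    cf 3 1 f = const z * (u 3 0 + const s * u 2 1 + const (s ^ 2) * (const (1 / 2) * u 1 2)
      + const t * F₂ 1) ∧
    cf 4 1 f = const z * (u 4 0 + const s * u 3 1 + const (s ^ 2) * (const (1 / 2) * u 2 2)
      + const t * F₂ 2 + const (s ^ 3) * (const (1 / 6) * u 1 3) + const (s * t) * dξ (F₂ 1)
      + const t * F₃ 1) := by
  have hm : ∀ j, h j (-1) = ubar j 0 := fun j => by rw [hc, h1, conj_u]
  have i12 : Finset.Icc 1 2 = {1, 2} := by decide
  have i13 : Finset.Icc 1 3 = {1, 2, 3} := by decide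
  have i23 : Finset.Icc 2 3 = {2, 3} := by decide
  have i14 : Finset.Icc 1 4 = {1, 2, 3, 4} := by decide
  have c1 : const 1 = 1 := MvPolynomial.C_1
  refine ⟨?_, ?_, ?_, ?_, ?_, ?_, ?_, ?_, ?_, ?_⟩ <;> rw [cf_field] <;>
  simp [i12, i13, i23, i14, hm, h1, h10, cornerOp_zero, cornerOp_one, cornerOp_two, cornerOp_three,
    flow_u, c1, -mul_eq_mul_left_iff] <;> try ring

theorem isWave_cornerField (h10 : h 1 0 = 0) : IsWave (field (cornerOp F₂ F₃ s t) z h) where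
  toIsGraded := isGraded_field _ _ _
  cf_one_zero := by simp [cf_field, h10, cornerOp_zero]

end DiffPoly

namespace DiffPoly

theorem const_add (z w : ℂ) : const (z + w) = const z + const w := MvPolynomial.C_add
theorem const_mul (z w : ℂ) : const (z * w) = const z * const w := MvPolynomial.C_mul
theorem const_pow (z : ℂ) (n : ℕ) : const (z ^ n) = const z ^ n := MvPolynomial.C_pow z n
theorem const_two : const 2 = 2 := map_ofNat MvPolynomial.C 2
theorem const_zero : const 0 = 0 := MvPolynomial.C_0
theorem const_one : const 1 = 1 := MvPolynomial.C_1

end DiffPoly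

/-! ### The equations of each harmonic up to fourth order -/

namespace QCoeffs

open DiffPoly

variable (p : QCoeffs)

theorem linSum_const (x : Fin 4 → ℂ) (f : DiffPoly) :
    p.linSum (fun c => const (x c) * f) = const (p.linSum x) * f :=
  (p.map_linSum (constMul f) x).symm

theorem pairSum_const (B : Fin 4 → Fin 4 → ℂ) (f : DiffPoly) :
    p.pairSum (fun c d => const (B c d) * f) = const (p.pairSum B) * f :=
  (p.map_pairSum (constMul f) B).symm

theorem tripleSum_const (B : Fin 4 → Fin 4 → Fin 4 → ℂ) (f : DiffPoly) :
    p.tripleSum (fun c d e => const (B c d e) * f) = const (p.tripleSum B) * f :=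
  (p.map_tripleSum (constMul f) B).symm

theorem linSum_const_add (x : Fin 4 → ℂ) (f : DiffPoly) (y : Fin 4 → DiffPoly) :
    p.linSum (fun c => const (x c) * f + y c) = const (p.linSum x) * f + p.linSum y := by
  rw [linSum_add, linSum_const]

theorem pairSum_const_add (B : Fin 4 → Fin 4 → ℂ) (f : DiffPoly) (B' : Fin 4 → Fin 4 → DiffPoly) :
    p.pairSum (fun c d => const (B c d) * f + B' c d)
      = const (p.pairSum B) * f + p.pairSum B' := by
  rw [pairSum_add, pairSum_const]

theorem tripleSum_const_add (B : Fin 4 → Fin 4 → Fin 4 → ℂ) (f : DiffPoly)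
    (B' : Fin 4 → Fin 4 → Fin 4 → DiffPoly) :
    p.tripleSum (fun c d e => const (B c d e) * f + B' c d e)
      = const (p.tripleSum B) * f + p.tripleSum B' := by
  rw [tripleSum_add, tripleSum_const]

theorem tripleSum_zero : p.tripleSum (fun _ _ _ => (0 : DiffPoly)) = 0 := by
  simp [tripleSum]

theorem pairSum_zero : p.pairSum (fun _ _ => (0 : DiffPoly)) = 0 := by
  simp [pairSum]

/-- The coefficient of `|u|²u`, when the harmonics of order two are `μ |u|²` and `ν u²`. -/
def cubicCoeff (z : Fin 4 → ℂ) (μ ν : ℂ) : ℂ :=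
  p.pairSum (fun c d => μ * (z c + z d) + ν * (z c ^ 2 * (z d)⁻¹ + z d ^ 2 * (z c)⁻¹))
    + p.tripleSum (fun c d e =>
        z c * z d * (z e)⁻¹ + z c * z e * (z d)⁻¹ + z d * z e * (z c)⁻¹)

/-- The coefficient of `u_ξ |u|²`, when moreover the harmonics of order three contain the terms
`σ u_ξ ū` and `τ u u_ξ`. -/
def cubicCoeffDeriv (z s : Fin 4 → ℂ) (μ ν σ τ : ℂ) : ℂ :=
  p.pairSum (fun c d => μ * (s c + s d) * (z c + z d) + σ * (z c + z d)
      + 2 * ν * (z c ^ 2 * (z d)⁻¹ * s c + z d ^ 2 * (z c)⁻¹ * s d)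
      + τ * (z c ^ 2 * (z d)⁻¹ + z d ^ 2 * (z c)⁻¹))
    + p.tripleSum (fun c d e => z c * z d * (z e)⁻¹ * (s c + s d)
        + z c * z e * (z d)⁻¹ * (s c + s e) + z d * z e * (z c)⁻¹ * (s d + s e))

/-- The coefficient of `ū_ξ u²`, when moreover the zeroth harmonic of order three contains the term
`σ u ū_ξ`. -/
def cubicCoeffConjDeriv (z s : Fin 4 → ℂ) (μ ν σ : ℂ) : ℂ :=
  p.pairSum (fun c d => μ * (z c * s d + z d * s c) + σ * (z c + z d)
      + ν * (z c ^ 2 * (z d)⁻¹ * s d + z d ^ 2 * (z c)⁻¹ * s c))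
    + p.tripleSum (fun c d e => z c * z d * (z e)⁻¹ * s e
        + z c * z e * (z d)⁻¹ * s d + z d * z e * (z c)⁻¹ * s c)

section expansion

variable {z : Fin 4 → ℂ} {s t : Fin 4 → ℝ} {F₂ F₃ : ℕ → DiffPoly} {h : ℕ → ℤ → DiffPoly}

theorem cf_one_cornerExpansion (α : ℤ) (hα : α.natAbs ≤ 1) :
    cf 1 α (p.cornerExpansion z s t F₂ F₃ h) = const (p.linSum fun c => z c ^ α) * h 1 α := by
  have hg : ∀ c, IsGraded (field (cornerOp F₂ F₃ (s c) (t c)) (z c) h) :=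
    fun c => isGraded_field _ _ _
  rw [cornerExpansion_eq]
  simp only [map_add, map_linSum, map_pairSum, map_tripleSum, map_smul,
    fun c d => cf_one_mul (hg c) (hg d), fun c d e => cf_one_mul ((hg c).mul (hg d)) (hg e),
    cf_one_mul (((hg 0).mul (hg 1)).mul (hg 2)) (hg 3)]
  simp only [cf_field, max_eq_left hα, Finset.Icc_self, Finset.sum_singleton, Nat.sub_self,
    cornerOp_zero, linSum_const]
  simp [pairSum, tripleSum]

variable (h10 : h 1 0 = 0) (h1 : ∀ j, h j 1 = u j 0) (hc : ∀ j α, h j (-α) = conj (h j α))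

include h10 h1 hc

/-- Keeps the fields opaque: the computations below use only their coefficients, not their
definition. -/
theorem exists_cornerFields : ∃ x : Fin 4 → Expansion,
    p.cornerExpansion z s t F₂ F₃ h = p.linSum x + p.pairSum (fun c d => x c * x d)
      + p.tripleSum (fun c d e => x c * x d * x e) + p.ζ • (x 0 * x 1 * x 2 * x 3) ∧
    (∀ c, IsWave (x c)) ∧ ∀ c,
    cf 1 1 (x c) = const (z c) * u 1 0 ∧ cf 1 (-1) (x c) = const (z c)⁻¹ * ubar 1 0 ∧
    cf 2 0 (x c) = h 2 0 ∧ cf 2 1 (x c) = const (z c) * (u 2 0 + const (s c) * u 1 1) ∧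
    cf 2 (-1) (x c) = const (z c)⁻¹ * (ubar 2 0 + const (s c) * ubar 1 1) ∧
    cf 2 2 (x c) = const (z c ^ 2) * h 2 2 ∧
    cf 3 0 (x c) = h 3 0 + const (s c) * dξ (h 2 0) ∧
    cf 3 2 (x c) = const (z c ^ 2) * (h 3 2 + const (s c) * dξ (h 2 2)) ∧
    cf 3 1 (x c) = const (z c) * (u 3 0 + const (s c) * u 2 1
      + const (s c ^ 2) * (const (1 / 2) * u 1 2) + const (t c) * F₂ 1) ∧
    cf 4 1 (x c) = const (z c) * (u 4 0 + const (s c) * u 3 1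
      + const (s c ^ 2) * (const (1 / 2) * u 2 2) + const (t c) * F₂ 2
      + const (s c ^ 3) * (const (1 / 6) * u 1 3) + const (s c * t c) * dξ (F₂ 1)
      + const (t c) * F₃ 1) :=
  ⟨_, p.cornerExpansion_eq h, fun _ => isWave_cornerField h10, fun _ => cf_cornerField h10 h1 hc⟩

theorem cf_two_cornerExpansion :
    cf 2 0 (p.cornerExpansion z s t F₂ F₃ h) = const (p.linSum fun _ => 1) * h 2 0
      + const (p.pairSum fun c d => z c * (z d)⁻¹ + z d * (z c)⁻¹) * (u 1 0 * ubar 1 0) ∧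
    cf 2 2 (p.cornerExpansion z s t F₂ F₃ h) = const (p.linSum fun c => z c ^ 2) * h 2 2
      + const (p.pairSum fun c d => z c * z d) * (u 1 0 ^ 2) ∧
    cf 2 1 (p.cornerExpansion z s t F₂ F₃ h) = const (p.linSum z) * u 2 0
      + const (p.linSum fun c => z c * s c) * u 1 1 := by
  obtain ⟨x, hE, hw, hv⟩ := p.exists_cornerFields (z := z) (s := s) (t := t) (F₂ := F₂) (F₃ := F₃)
    h10 h1 hc
  have hp := fun c d => cf_two_mul (hw c) (hw d)
  have hq := cf_mul_mul_mul (hw 0) (hw 1) (hw 2) (hw 3)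
  rw [hE]
  refine ⟨?_, ?_, ?_⟩
  · have e1 : ∀ c, cf 2 0 (x c) = const 1 * h 2 0 := fun c => by
      rw [(hv c).2.2.1, const_one, one_mul]
    have e2 : ∀ c d, cf 2 0 (x c * x d) =
        const (z c * (z d)⁻¹ + z d * (z c)⁻¹) * (u 1 0 * ubar 1 0) := fun c d => by
      rw [(hp c d).1, (hv c).1, (hv d).1, (hv c).2.1, (hv d).2.1]
      simp only [const_add, const_mul]
      ring
    simp only [map_add, map_linSum, map_pairSum, map_tripleSum, map_smul, e1, e2,
      fun c d e => cf_two_mul_mul (hw c) (hw d) (hw e), hq, linSum_const, pairSum_const,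
      tripleSum_zero, smul_zero, add_zero]
  · have e2 : ∀ c d, cf 2 2 (x c * x d) = const (z c * z d) * (u 1 0 ^ 2) := fun c d => by
      rw [(hp c d).2.1, (hv c).1, (hv d).1]
      simp only [const_mul]
      ring
    simp only [map_add, map_linSum, map_pairSum, map_tripleSum, map_smul,
      fun c => (hv c).2.2.2.2.2.1, e2,
      fun c d e => cf_two_mul_mul (hw c) (hw d) (hw e), hq, linSum_const, pairSum_const,
      tripleSum_zero, smul_zero, add_zero]
  · have e1 : ∀ c, cf 2 1 (x c) = const (z c) * u 2 0 + const (z c * s c) * u 1 1 := fun c => by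
      rw [(hv c).2.2.2.1, const_mul]
      ring
    simp only [map_add, map_linSum, map_pairSum, map_tripleSum, map_smul, e1,
      fun c d => (hp c d).2.2.1,
      fun c d e => cf_two_mul_mul (hw c) (hw d) (hw e), hq, linSum_const, linSum_const_add,
      tripleSum_zero, pairSum_zero, smul_zero, add_zero]

variable {μ ν : ℂ} (h20 : h 2 0 = const μ * (u 1 0 * ubar 1 0)) (h22 : h 2 2 = const ν * u 1 0 ^ 2)

include h20 h22

theorem cf_three_cornerExpansion :
    cf 3 0 (p.cornerExpansion z s t F₂ F₃ h) = const (p.linSum fun _ => 1) * h 3 0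
      + const (p.pairSum fun c d => z c * (z d)⁻¹ + z d * (z c)⁻¹)
        * (u 1 0 * ubar 2 0 + u 2 0 * ubar 1 0)
      + const (μ * p.linSum (fun c => (s c : ℂ))
          + p.pairSum fun c d => z c * (z d)⁻¹ * s c + z d * (z c)⁻¹ * s d) * (u 1 1 * ubar 1 0)
      + const (μ * p.linSum (fun c => (s c : ℂ))
          + p.pairSum fun c d => z c * (z d)⁻¹ * s d + z d * (z c)⁻¹ * s c) * (u 1 0 * ubar 1 1) ∧
    cf 3 2 (p.cornerExpansion z s t F₂ F₃ h) = const (p.linSum fun c => z c ^ 2) * h 3 2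
      + const (p.pairSum fun c d => z c * z d) * (2 * u 1 0 * u 2 0)
      + const (2 * ν * p.linSum (fun c => z c ^ 2 * s c)
          + p.pairSum fun c d => z c * z d * (s c + s d)) * (u 1 0 * u 1 1) ∧
    cf 3 1 (p.cornerExpansion z s t F₂ F₃ h) = const (p.linSum z) * u 3 0
      + const (p.linSum fun c => z c * s c) * u 2 1
      + const (p.linSum fun c => z c * s c ^ 2) * (const (1 / 2) * u 1 2)
      + const (p.linSum fun c => z c * t c) * F₂ 1
      + const (p.cubicCoeff z μ ν) * (u 1 0 ^ 2 * ubar 1 0) := by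
  obtain ⟨x, hE, hw, hv⟩ := p.exists_cornerFields (z := z) (s := s) (t := t) (F₂ := F₂) (F₃ := F₃)
    h10 h1 hc
  have hp := fun c d => cf_three_mul (hw c) (hw d)
  have ht := fun c d e => cf_three_mul_mul (hw c) (hw d) (hw e)
  have hq := cf_mul_mul_mul (hw 0) (hw 1) (hw 2) (hw 3)
  rw [hE]
  have lin_mul : ∀ (w : ℂ) (y : Fin 4 → ℂ), w * p.linSum y = p.linSum fun c => w * y c :=
    fun w y => p.map_linSum (LinearMap.mulLeft ℝ w) y
  refine ⟨?_, ?_, ?_⟩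
  · have e1 : ∀ c, cf 3 0 (x c) = const 1 * h 3 0 + (const (μ * s c) * (u 1 1 * ubar 1 0)
        + const (μ * s c) * (u 1 0 * ubar 1 1)) := fun c => by
      rw [(hv c).2.2.2.2.2.2.1, h20, const_one, const_mul]
      simp [-mul_eq_mul_left_iff]
      ring
    have e2 : ∀ c d, cf 3 0 (x c * x d) =
        const (z c * (z d)⁻¹ + z d * (z c)⁻¹) * (u 1 0 * ubar 2 0 + u 2 0 * ubar 1 0)
        + (const (z c * (z d)⁻¹ * s c + z d * (z c)⁻¹ * s d) * (u 1 1 * ubar 1 0)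
        + const (z c * (z d)⁻¹ * s d + z d * (z c)⁻¹ * s c) * (u 1 0 * ubar 1 1)) := fun c d => by
      rw [(hp c d).1, (hv c).1, (hv d).1, (hv c).2.1, (hv d).2.1, (hv c).2.2.2.1, (hv d).2.2.2.1,
        (hv c).2.2.2.2.1, (hv d).2.2.2.2.1]
      simp only [const_add, const_mul]
      ring
    simp only [map_add, map_linSum, map_pairSum, map_tripleSum, map_smul, e1, e2,
      fun c d e => (ht c d e).1, hq, linSum_const, pairSum_const, linSum_const_add, pairSum_const_add,
      tripleSum_zero, smul_zero, add_zero, lin_mul]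
    simp only [const_add]
    ring
  · have e1 : ∀ c, cf 3 2 (x c) = const (z c ^ 2) * h 3 2
        + const (2 * ν * (z c ^ 2 * s c)) * (u 1 0 * u 1 1) := fun c => by
      rw [(hv c).2.2.2.2.2.2.2.1, h22]
      simp [const_mul, const_pow, const_two, Derivation.leibniz_pow, -mul_eq_mul_left_iff]
      ring
    have e2 : ∀ c d, cf 3 2 (x c * x d) = const (z c * z d) * (2 * u 1 0 * u 2 0)
        + const (z c * z d * (s c + s d)) * (u 1 0 * u 1 1) := fun c d => by
      rw [(hp c d).2.1, (hv c).1, (hv d).1, (hv c).2.2.2.1, (hv d).2.2.2.1]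
      simp only [const_mul, const_add]
      ring
    simp only [map_add, map_linSum, map_pairSum, map_tripleSum, map_smul, e1, e2,
      fun c d e => (ht c d e).2.1, hq, linSum_const, pairSum_const, linSum_const_add, pairSum_const_add,
      tripleSum_zero, smul_zero, add_zero, lin_mul]
    simp only [const_add]
    ring
  · have e1 : ∀ c, cf 3 1 (x c) = const (z c) * u 3 0 + (const (z c * s c) * u 2 1
        + (const (z c * s c ^ 2) * (const (1 / 2) * u 1 2) + const (z c * t c) * F₂ 1)) :=
      fun c => by
      rw [(hv c).2.2.2.2.2.2.2.2.1]
      simp only [const_mul]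
      ring
    have e2 : ∀ c d, cf 3 1 (x c * x d) =
        const (μ * (z c + z d) + ν * (z c ^ 2 * (z d)⁻¹ + z d ^ 2 * (z c)⁻¹))
          * (u 1 0 ^ 2 * ubar 1 0) := fun c d => by
      rw [(hp c d).2.2, (hv c).1, (hv d).1, (hv c).2.1, (hv d).2.1, (hv c).2.2.1, (hv d).2.2.1,
        (hv c).2.2.2.2.2.1, (hv d).2.2.2.2.2.1, h20, h22]
      simp only [const_mul, const_add]
      ring
    have e3 : ∀ c d e, cf 3 1 (x c * x d * x e) =
        const (z c * z d * (z e)⁻¹ + z c * z e * (z d)⁻¹ + z d * z e * (z c)⁻¹)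
          * (u 1 0 ^ 2 * ubar 1 0) := fun c d e => by
      rw [(ht c d e).2.2, (hv c).1, (hv d).1, (hv e).1, (hv c).2.1, (hv d).2.1, (hv e).2.1]
      simp only [const_mul, const_add]
      ring
    simp only [map_add, map_linSum, map_pairSum, map_tripleSum, map_smul, e1, e2, e3,
      hq, linSum_const, pairSum_const, tripleSum_const, linSum_const_add,
      cubicCoeff, smul_zero, add_zero]
    simp only [const_add]
    ring

theorem cf_four_cornerExpansion {σ σ' τ : ℂ}
    (h30 : h 3 0 = const μ * (u 1 0 * ubar 2 0 + u 2 0 * ubar 1 0) + const σ * (u 1 1 * ubar 1 0)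
      + const σ' * (u 1 0 * ubar 1 1))
    (h32 : h 3 2 = const ν * (2 * u 1 0 * u 2 0) + const τ * (u 1 0 * u 1 1)) :
    cf 4 1 (p.cornerExpansion z s t F₂ F₃ h) = const (p.linSum z) * u 4 0
      + const (p.linSum fun c => z c * s c) * u 3 1
      + const (p.linSum fun c => z c * s c ^ 2) * (const (1 / 2) * u 2 2)
      + const (p.linSum fun c => z c * t c) * F₂ 2
      + const (p.linSum fun c => z c * s c ^ 3) * (const (1 / 6) * u 1 3)
      + const (p.linSum fun c => z c * (s c * t c)) * dξ (F₂ 1)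
      + const (p.linSum fun c => z c * t c) * F₃ 1
      + const (p.cubicCoeff z μ ν) * (2 * (u 1 0 * ubar 1 0 * u 2 0) + u 1 0 ^ 2 * ubar 2 0)
      + const (p.cubicCoeffDeriv z (fun c => s c) μ ν σ τ) * (u 1 1 * (u 1 0 * ubar 1 0))
      + const (p.cubicCoeffConjDeriv z (fun c => s c) μ ν σ') * (ubar 1 1 * u 1 0 ^ 2) := by
  obtain ⟨x, hE, hw, hv⟩ := p.exists_cornerFields (z := z) (s := s) (t := t) (F₂ := F₂) (F₃ := F₃)
    h10 h1 hc
  have hq := cf_mul_mul_mul (hw 0) (hw 1) (hw 2) (hw 3)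
  rw [hE]
  have e1 : ∀ c, cf 4 1 (x c) = const (z c) * u 4 0 + (const (z c * s c) * u 3 1
      + (const (z c * s c ^ 2) * (const (1 / 2) * u 2 2) + (const (z c * t c) * F₂ 2
      + (const (z c * s c ^ 3) * (const (1 / 6) * u 1 3)
      + (const (z c * (s c * t c)) * dξ (F₂ 1) + const (z c * t c) * F₃ 1))))) := fun c => by
    rw [(hv c).2.2.2.2.2.2.2.2.2]
    simp only [const_mul]
    ring
  have d20 : dξ (h 2 0) = const μ * (u 1 1 * ubar 1 0 + u 1 0 * ubar 1 1) := by
    rw [h20]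
    simp [-mul_eq_mul_left_iff]
    ring
  have d22 : dξ (h 2 2) = const ν * (2 * u 1 0 * u 1 1) := by
    rw [h22]
    simp [Derivation.leibniz_pow, -mul_eq_mul_left_iff]
    ring
  have e2 : ∀ c d, cf 4 1 (x c * x d) =
      const (μ * (z c + z d) + ν * (z c ^ 2 * (z d)⁻¹ + z d ^ 2 * (z c)⁻¹))
          * (2 * (u 1 0 * ubar 1 0 * u 2 0) + u 1 0 ^ 2 * ubar 2 0)
      + (const (μ * (s c + s d) * (z c + z d) + σ * (z c + z d)
        + 2 * ν * (z c ^ 2 * (z d)⁻¹ * s c + z d ^ 2 * (z c)⁻¹ * s d)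
        + τ * (z c ^ 2 * (z d)⁻¹ + z d ^ 2 * (z c)⁻¹)) * (u 1 1 * (u 1 0 * ubar 1 0))
      + const (μ * (z c * s d + z d * s c) + σ' * (z c + z d)
        + ν * (z c ^ 2 * (z d)⁻¹ * s d + z d ^ 2 * (z c)⁻¹ * s c)) * (ubar 1 1 * u 1 0 ^ 2)) :=
    fun c d => by
    rw [cf_four_mul (hw c) (hw d), (hv c).1, (hv d).1, (hv c).2.1, (hv d).2.1, (hv c).2.2.1,
      (hv d).2.2.1, (hv c).2.2.2.1, (hv d).2.2.2.1, (hv c).2.2.2.2.1, (hv d).2.2.2.2.1,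
      (hv c).2.2.2.2.2.1, (hv d).2.2.2.2.2.1, (hv c).2.2.2.2.2.2.1, (hv d).2.2.2.2.2.2.1,
      (hv c).2.2.2.2.2.2.2.1, (hv d).2.2.2.2.2.2.2.1, d20, d22, h20, h22, h30, h32]
    simp only [const_mul, const_add, const_pow, const_two]
    ring
  have e3 : ∀ c d e, cf 4 1 (x c * x d * x e) =
      const (z c * z d * (z e)⁻¹ + z c * z e * (z d)⁻¹ + z d * z e * (z c)⁻¹)
        * (2 * (u 1 0 * ubar 1 0 * u 2 0) + u 1 0 ^ 2 * ubar 2 0)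
      + (const (z c * z d * (z e)⁻¹ * (s c + s d)
        + z c * z e * (z d)⁻¹ * (s c + s e) + z d * z e * (z c)⁻¹ * (s d + s e))
        * (u 1 1 * (u 1 0 * ubar 1 0))
      + const (z c * z d * (z e)⁻¹ * s e
        + z c * z e * (z d)⁻¹ * s d + z d * z e * (z c)⁻¹ * s c) * (ubar 1 1 * u 1 0 ^ 2)) :=
    fun c d e => by
    rw [cf_four_mul_mul (hw c) (hw d) (hw e), (hv c).1, (hv d).1, (hv e).1, (hv c).2.1, (hv d).2.1,
      (hv e).2.1, (hv c).2.2.2.1, (hv d).2.2.2.1, (hv e).2.2.2.1, (hv c).2.2.2.2.1,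
      (hv d).2.2.2.2.1, (hv e).2.2.2.2.1]
    simp only [const_mul, const_add]
    ring
  simp only [map_add, map_linSum, map_pairSum, map_tripleSum, map_smul, e1, e2, e3,
    hq, linSum_const, pairSum_const, tripleSum_const, linSum_const_add, pairSum_const_add,
    tripleSum_const_add, cubicCoeff, cubicCoeffDeriv, cubicCoeffConjDeriv, smul_zero, add_zero]
  simp only [const_add]
  ring

end expansion

end QCoeffs

/-! ### Equivalence with a finite algebraic system -/

namespace QCoeffs

open DiffPoly

/-- The equations for the coefficients `μ`, `ν`, `σ`, `σ'`, `τ` of the slave harmonics and for the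
coefficients of the reduced equations. -/
structure ReducedEqs (p : QCoeffs) (z s t : Fin 4 → ℂ) (ρ₁ ρ₂ B a b μ ν σ σ' τ : ℂ) : Prop where
  eq_μ : p.linSum (fun _ => (1 : ℂ)) * μ
    + p.pairSum (fun c d => z c * (z d)⁻¹ + z d * (z c)⁻¹) = 0
  eq_ν : p.linSum (fun c => z c ^ 2) * ν + p.pairSum (fun c d => z c * z d) = 0
  eq_σ : p.linSum (fun _ => (1 : ℂ)) * σ + (μ * p.linSum s
    + p.pairSum fun c d => z c * (z d)⁻¹ * s c + z d * (z c)⁻¹ * s d) = 0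
  eq_σ' : p.linSum (fun _ => (1 : ℂ)) * σ' + (μ * p.linSum s
    + p.pairSum fun c d => z c * (z d)⁻¹ * s d + z d * (z c)⁻¹ * s c) = 0
  eq_τ : p.linSum (fun c => z c ^ 2) * τ + (2 * ν * p.linSum (fun c => z c ^ 2 * s c)
    + p.pairSum fun c d => z c * z d * (s c + s d)) = 0
  velocity : p.linSum (fun c => z c * s c) = 0
  dispersion₂ : p.linSum (fun c => z c * t c) * (-Complex.I * ρ₁)
    + p.linSum (fun c => z c * s c ^ 2) * (1 / 2) = 0
  cubic : p.linSum (fun c => z c * t c) * (-Complex.I * ρ₂) + p.cubicCoeff z μ ν = 0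
  dispersion₃ : p.linSum (fun c => z c * t c) * B
    + p.linSum (fun c => z c * (s c * t c)) * (-Complex.I * ρ₁)
    + p.linSum (fun c => z c * s c ^ 3) * (1 / 6) = 0
  deriv : p.linSum (fun c => z c * t c) * (3 * B * ρ₂ / ρ₁ + a)
    + 2 * p.linSum (fun c => z c * (s c * t c)) * (-Complex.I * ρ₂)
    + p.cubicCoeffDeriv z s μ ν σ τ = 0
  conjDeriv : p.linSum (fun c => z c * t c) * b
    + p.linSum (fun c => z c * (s c * t c)) * (-Complex.I * ρ₂)
    + p.cubicCoeffConjDeriv z s μ ν σ' = 0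

theorem eq_const_mul_of_add_eq_zero {L Q : ℂ} (hL : L ≠ 0) {f g : DiffPoly}
    (h : const L * f + const Q * g = 0) : f = const (-Q / L) * g := by
  have e : const L⁻¹ * const L = 1 := by rw [← const_mul, inv_mul_cancel₀ hL, const_one]
  have e' : const (-Q / L) = - (const L⁻¹ * const Q) := by
    rw [← const_mul]
    exact (congrArg const (by field_simp)).trans (map_neg MvPolynomial.C (L⁻¹ * Q))
  rw [e']
  linear_combination const L⁻¹ * h - f * e

section evaluation

/-- Evaluation of differential polynomials at prescribed values of the amplitudes. -/
def evalAt (x y : ℕ → ℕ → ℂ) : DiffPoly →+* ℂ :=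
  MvPolynomial.eval fun
    | .amp j k => x j k
    | .ampBar j k => y j k

variable (x y : ℕ → ℕ → ℂ)

@[simp] theorem evalAt_const (z : ℂ) : evalAt x y (const z) = z := by simp [evalAt, const]

@[simp] theorem evalAt_u (j k : ℕ) : evalAt x y (u j k) = x j k := by simp [evalAt, u]

@[simp] theorem evalAt_ubar (j k : ℕ) : evalAt x y (ubar j k) = y j k := by simp [evalAt, ubar]

end evaluation

section reduction

variable (p : QCoeffs) {z : Fin 4 → ℂ} {s t : Fin 4 → ℝ} {F₂ F₃ : ℕ → DiffPoly}
  {h : ℕ → ℤ → DiffPoly} {ρ₁ B : ℝ} {ρ₂ a b : ℂ}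

theorem cf_three_one_of_flows {μ ν : ℂ} (hρ : ρ₁ ≠ 0) (hF₂ : F₂ 1 = K₂ ρ₁ ρ₂)
    (hS : p.linSum z = 0) (h10 : h 1 0 = 0) (h1 : ∀ j, h j 1 = u j 0)
    (hc : ∀ j α, h j (-α) = conj (h j α)) (h20 : h 2 0 = const μ * (u 1 0 * ubar 1 0))
    (h22 : h 2 2 = const ν * u 1 0 ^ 2) :
    cf 3 1 (p.cornerExpansion z s t F₂ F₃ h) =
      const (p.linSum fun c => z c * s c) * u 2 1
      + const (p.linSum (fun c => z c * t c) * (-Complex.I * ρ₁)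
          + p.linSum (fun c => z c * s c ^ 2) * (1 / 2)) * u 1 2
      + const (p.linSum (fun c => z c * t c) * (-Complex.I * ρ₂) + p.cubicCoeff z μ ν)
          * (u 1 0 ^ 2 * ubar 1 0) := by
  have hρ' : (ρ₁ : ℂ) ≠ 0 := Complex.ofReal_ne_zero.mpr hρ
  have e : const (-Complex.I * ρ₂) = const (-Complex.I * ρ₁) * const (ρ₂ / ρ₁) := by
    rw [← const_mul]
    congr 1
    field_simp
  rw [(p.cf_three_cornerExpansion h10 h1 hc h20 h22).2.2, hF₂, K₂, hS, const_zero]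
  simp only [const_add, const_mul _ (-Complex.I * ρ₂), e, const_mul _ (-Complex.I * ρ₁),
    const_mul _ (1 / 2)]
  ring

/-- Since `u(2)` evolves by the linearised flow plus a forcing term, the brackets of order three
reappear here. The new conditions are those on `u_ξξξ`, `u_ξ|u|²` and `ū_ξu²`; the factors `2` and
`1` in the last two come from differentiating `|u|²u` inside `K₂`. -/
theorem cf_four_one_of_flows {μ ν σ σ' τ : ℂ} (hρ : ρ₁ ≠ 0) (hF₂ : F₂ 1 = K₂ ρ₁ ρ₂)
    (hF₂' : F₂ 2 = K₂' ρ₁ ρ₂ + f₂ a b) (hF₃ : F₃ 1 = K₃ ρ₁ ρ₂ B)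
    (hS : p.linSum z = 0) (h10 : h 1 0 = 0) (h1 : ∀ j, h j 1 = u j 0)
    (hc : ∀ j α, h j (-α) = conj (h j α)) (h20 : h 2 0 = const μ * (u 1 0 * ubar 1 0))
    (h22 : h 2 2 = const ν * u 1 0 ^ 2)
    (h30 : h 3 0 = const μ * (u 1 0 * ubar 2 0 + u 2 0 * ubar 1 0) + const σ * (u 1 1 * ubar 1 0)
      + const σ' * (u 1 0 * ubar 1 1))
    (h32 : h 3 2 = const ν * (2 * u 1 0 * u 2 0) + const τ * (u 1 0 * u 1 1)) :
    cf 4 1 (p.cornerExpansion z s t F₂ F₃ h) =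
      const (p.linSum fun c => z c * s c) * u 3 1
      + const (p.linSum (fun c => z c * t c) * (-Complex.I * ρ₁)
          + p.linSum (fun c => z c * s c ^ 2) * (1 / 2)) * u 2 2
      + const (p.linSum (fun c => z c * t c) * (-Complex.I * ρ₂) + p.cubicCoeff z μ ν)
          * (2 * (u 1 0 * ubar 1 0 * u 2 0) + u 1 0 ^ 2 * ubar 2 0)
      + const (p.linSum (fun c => z c * t c) * B
          + p.linSum (fun c => z c * (s c * t c)) * (-Complex.I * ρ₁)
          + p.linSum (fun c => z c * s c ^ 3) * (1 / 6)) * u 1 3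
      + const (p.linSum (fun c => z c * t c) * (3 * B * ρ₂ / ρ₁ + a)
          + 2 * p.linSum (fun c => z c * (s c * t c)) * (-Complex.I * ρ₂)
          + p.cubicCoeffDeriv z (fun c => s c) μ ν σ τ) * (u 1 1 * (u 1 0 * ubar 1 0))
      + const (p.linSum (fun c => z c * t c) * b
          + p.linSum (fun c => z c * (s c * t c)) * (-Complex.I * ρ₂)
          + p.cubicCoeffConjDeriv z (fun c => s c) μ ν σ') * (ubar 1 1 * u 1 0 ^ 2) := by
  have hρ' : (ρ₁ : ℂ) ≠ 0 := Complex.ofReal_ne_zero.mpr hρ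
  have e : const (-Complex.I * ρ₂) = const (-Complex.I * ρ₁) * const (ρ₂ / ρ₁) := by
    rw [← const_mul]
    congr 1
    field_simp
  have e' : const (3 * B * ρ₂ / ρ₁) = const B * const (3 * ρ₂ / ρ₁) := by
    rw [← const_mul]
    congr 1
    ring
  have d : dξ (K₂ ρ₁ ρ₂) = const (-Complex.I * ρ₁) * (u 1 3 + const (ρ₂ / ρ₁)
      * (2 * (u 1 1 * (u 1 0 * ubar 1 0)) + ubar 1 1 * u 1 0 ^ 2)) := by
    simp [K₂, Derivation.leibniz_pow, -mul_eq_mul_left_iff]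
    ring
  rw [p.cf_four_cornerExpansion h10 h1 hc h20 h22 h30 h32, hF₂, d, hF₂', hF₃, K₂', K₃, f₂, hS,
    const_zero]
  simp only [const_add, const_mul _ (-Complex.I * ρ₂), e, const_mul _ (-Complex.I * ρ₁),
    const_mul _ (1 / 2), const_mul _ (1 / 6), const_mul _ (_ + _ : ℂ), const_mul 2, const_mul _ b,
    e', const_two, const_mul _ (B : ℂ)]
  ring

/-- The equations of harmonics `0` and `2` are linear with invertible leading symbol, so these
amplitudes are forced. In particular the zeroth harmonic at order one vanishes, which makes the
fields waves. -/
theorem exists_slave_coeffs (h1 : ∀ j, h j 1 = u j 0) (hc : ∀ j α, h j (-α) = conj (h j α))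
    (hL₀ : p.linSum (fun _ => (1 : ℂ)) ≠ 0) (hL₂ : p.linSum (fun c => z c ^ 2) ≠ 0)
    (hW : ∀ j ≤ 3, ∀ α, α ≠ 1 → α ≠ -1 → cf j α (p.cornerExpansion z s t F₂ F₃ h) = 0) :
    ∃ μ ν σ σ' τ : ℂ,
      (p.linSum (fun _ => (1 : ℂ)) * μ
        + p.pairSum (fun c d => z c * (z d)⁻¹ + z d * (z c)⁻¹) = 0 ∧
      p.linSum (fun c => z c ^ 2) * ν + p.pairSum (fun c d => z c * z d) = 0 ∧
      p.linSum (fun _ => (1 : ℂ)) * σ + (μ * p.linSum (fun c => (s c : ℂ))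
        + p.pairSum fun c d => z c * (z d)⁻¹ * s c + z d * (z c)⁻¹ * s d) = 0 ∧
      p.linSum (fun _ => (1 : ℂ)) * σ' + (μ * p.linSum (fun c => (s c : ℂ))
        + p.pairSum fun c d => z c * (z d)⁻¹ * s d + z d * (z c)⁻¹ * s c) = 0 ∧
      p.linSum (fun c => z c ^ 2) * τ + (2 * ν * p.linSum (fun c => z c ^ 2 * s c)
        + p.pairSum fun c d => z c * z d * (s c + s d)) = 0) ∧
      h 1 0 = 0 ∧ h 2 0 = const μ * (u 1 0 * ubar 1 0) ∧ h 2 2 = const ν * u 1 0 ^ 2 ∧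
      h 3 0 = const μ * (u 1 0 * ubar 2 0 + u 2 0 * ubar 1 0) + const σ * (u 1 1 * ubar 1 0)
        + const σ' * (u 1 0 * ubar 1 1) ∧
      h 3 2 = const ν * (2 * u 1 0 * u 2 0) + const τ * (u 1 0 * u 1 1) := by
  have h10 : h 1 0 = 0 := by
    have e := hW 1 (by norm_num) 0 (by norm_num) (by norm_num)
    rw [p.cf_one_cornerExpansion 0 (by norm_num)] at e
    simp only [zpow_zero] at e
    have := eq_const_mul_of_add_eq_zero (Q := 0) (g := 0) hL₀ (by rw [e, mul_zero, add_zero])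
    rw [this, mul_zero]
  obtain ⟨e20, e22, -⟩ := p.cf_two_cornerExpansion (z := z) (s := s) (t := t) (F₂ := F₂) (F₃ := F₃)
    h10 h1 hc
  have h20 := eq_const_mul_of_add_eq_zero hL₀
    (e20.symm.trans (hW 2 (by norm_num) 0 (by norm_num) (by norm_num)))
  have h22 := eq_const_mul_of_add_eq_zero hL₂
    (e22.symm.trans (hW 2 (by norm_num) 2 (by norm_num) (by norm_num)))
  set μ : ℂ := -p.pairSum (fun c d => z c * (z d)⁻¹ + z d * (z c)⁻¹)
    / p.linSum (fun _ => (1 : ℂ)) with hμ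
  set ν : ℂ := -p.pairSum (fun c d => z c * z d) / p.linSum (fun c => z c ^ 2) with hν
  obtain ⟨e30, e32, -⟩ := p.cf_three_cornerExpansion (z := z) (s := s) (t := t) (F₂ := F₂)
    (F₃ := F₃) h10 h1 hc h20 h22
  rw [hW 3 le_rfl 0 (by norm_num) (by norm_num)] at e30
  rw [hW 3 le_rfl 2 (by norm_num) (by norm_num)] at e32
  have inv : ∀ {L : ℂ}, L ≠ 0 → const L⁻¹ * const L = 1 := fun hL => by
    rw [← const_mul, inv_mul_cancel₀ hL, const_one]
  have div : ∀ Q L : ℂ, const (-Q / L) = -(const L⁻¹ * const Q) := fun Q L => by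
    rw [← const_mul]
    exact (congrArg const (by field_simp)).trans (map_neg MvPolynomial.C (L⁻¹ * Q))
  refine ⟨μ, ν,
    -(μ * p.linSum (fun c => (s c : ℂ))
        + p.pairSum fun c d => z c * (z d)⁻¹ * s c + z d * (z c)⁻¹ * s d) / p.linSum fun _ => 1,
    -(μ * p.linSum (fun c => (s c : ℂ))
        + p.pairSum fun c d => z c * (z d)⁻¹ * s d + z d * (z c)⁻¹ * s c) / p.linSum fun _ => 1,
    -(2 * ν * p.linSum (fun c => z c ^ 2 * s c)
        + p.pairSum fun c d => z c * z d * (s c + s d)) / p.linSum fun c => z c ^ 2,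
    ⟨?_, ?_, ?_, ?_, ?_⟩, h10, h20, h22, ?_, ?_⟩
  · exact add_eq_zero_iff_eq_neg.mpr (mul_div_cancel₀ _ hL₀)
  · exact add_eq_zero_iff_eq_neg.mpr (mul_div_cancel₀ _ hL₂)
  · exact add_eq_zero_iff_eq_neg.mpr (mul_div_cancel₀ _ hL₀)
  · exact add_eq_zero_iff_eq_neg.mpr (mul_div_cancel₀ _ hL₀)
  · exact add_eq_zero_iff_eq_neg.mpr (mul_div_cancel₀ _ hL₂)
  · rw [hμ, div, div, div, ← hμ]
    linear_combination -const (p.linSum fun _ => (1 : ℂ))⁻¹ * e30 - h 3 0 * inv hL₀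
  · rw [hν, div, div, ← hν]
    linear_combination -const (p.linSum fun c => z c ^ 2)⁻¹ * e32 - h 3 2 * inv hL₂

theorem reducedEqs_of_expansion (hρ : ρ₁ ≠ 0) (hF₂ : F₂ 1 = K₂ ρ₁ ρ₂)
    (hF₂' : F₂ 2 = K₂' ρ₁ ρ₂ + f₂ a b) (hF₃ : F₃ 1 = K₃ ρ₁ ρ₂ B) (h1 : ∀ j, h j 1 = u j 0)
    (hc : ∀ j α, h j (-α) = conj (h j α)) (hS : p.linSum z = 0)
    (hL₀ : p.linSum (fun _ => (1 : ℂ)) ≠ 0) (hL₂ : p.linSum (fun c => z c ^ 2) ≠ 0)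
    (hW : ∀ j ≤ 4, ∀ α, cf j α (p.cornerExpansion z s t F₂ F₃ h) = 0) :
    ∃ μ ν σ σ' τ : ℂ, p.ReducedEqs z (fun c => s c) (fun c => t c) ρ₁ ρ₂ B a b μ ν σ σ' τ := by
  obtain ⟨μ, ν, σ, σ', τ, ⟨e1, e2, e3, e4, e5⟩, h10, h20, h22, h30, h32⟩ :=
    p.exists_slave_coeffs h1 hc hL₀ hL₂ fun j hj α _ _ => hW j (by omega) α
  have e31 := p.cf_three_one_of_flows (z := z) (s := s) (t := t) (F₃ := F₃) hρ hF₂ hS h10 h1 hc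
    h20 h22
  have e41 := p.cf_four_one_of_flows (z := z) (s := s) (t := t) hρ hF₂ hF₂' hF₃ hS h10 h1 hc
    h20 h22 h30 h32
  rw [hW 3 (by norm_num)] at e31
  rw [hW 4 le_rfl] at e41
  have ev := fun x y => congrArg (evalAt x y) e31
  have ev' := fun x y => congrArg (evalAt x y) e41
  simp only [map_add, map_mul, map_zero, map_pow, evalAt_const, evalAt_u, evalAt_ubar] at ev ev'
  refine ⟨μ, ν, σ, σ', τ, e1, e2, e3, e4, e5, ?_, ?_, ?_, ?_, ?_, ?_⟩
  -- Coefficients of distinct monomials are separated by evaluation. The values of the jet variables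
  -- and of their conjugates are prescribed independently, as `0` or `1`, so that in each case a
  -- single monomial survives.
  · simpa using (ev (fun j k => if j = 2 then 1 else 0) 0).symm
  · simpa using (ev (fun j k => if k = 2 then 1 else 0) 0).symm
  · simpa using (ev (fun j k => if j = 1 ∧ k = 0 then 1 else 0) 1).symm
  · simpa using (ev' (fun j k => if j = 1 then 1 else 0) 0).symm
  · simpa using (ev' (fun j k => if j = 1 ∧ k ≤ 1 then 1 else 0)
      (fun j k => if j = 1 ∧ k = 0 then 1 else 0)).symm
  · simpa using (ev' (fun j k => if j = 1 ∧ k = 0 then 1 else 0)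
      (fun j k => if k = 1 then 1 else 0)).symm

theorem exists_expansion_of_reducedEqs (hρ : ρ₁ ≠ 0) (hz : ∀ c, starRingEnd ℂ (z c) = (z c)⁻¹)
    (hS : p.linSum z = 0)
    (hL : ∀ α : ℤ, α ≠ 1 → α ≠ -1 → α.natAbs ≤ 4 → p.linSum (fun c => z c ^ α) ≠ 0)
    {μ ν σ σ' τ : ℂ}
    (H : p.ReducedEqs z (fun c => s c) (fun c => t c) ρ₁ ρ₂ B a b μ ν σ σ' τ) :
    ∃ (F₂ F₃ : ℕ → DiffPoly) (h : ℕ → ℤ → DiffPoly), F₂ 1 = K₂ ρ₁ ρ₂ ∧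
      F₂ 2 = K₂' ρ₁ ρ₂ + f₂ a b ∧ F₃ 1 = K₃ ρ₁ ρ₂ B ∧ (∀ j, h j 1 = u j 0) ∧
      (∀ j α, h j (-α) = conj (h j α)) ∧
      ∀ j ≤ 4, ∀ α, cf j α (p.cornerExpansion z s t F₂ F₃ h) = 0 := by
  have hL₀ : p.linSum (fun _ => (1 : ℂ)) ≠ 0 := by
    have := hL 0 (by norm_num) (by norm_num) (by norm_num)
    simpa only [zpow_zero] using this
  have hL₂ : p.linSum (fun c => z c ^ 2) ≠ 0 := by
    have := hL 2 (by norm_num) (by norm_num) (by norm_num)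
    exact_mod_cast this
  let F₂ : ℕ → DiffPoly := fun j => if j = 1 then K₂ ρ₁ ρ₂ else K₂' ρ₁ ρ₂ + f₂ a b
  let F₃ : ℕ → DiffPoly := fun _ => K₃ ρ₁ ρ₂ B
  obtain ⟨h, h1, hc, hW⟩ := p.exists_harmonics (s := s) (t := t) F₂ F₃ hz 4 hL
  refine ⟨F₂, F₃, h, rfl, rfl, rfl, h1, hc, ?_⟩
  obtain ⟨μ', ν', σ₁, σ₂, τ', ⟨e1, e2, e3, e4, e5⟩, h10, h20, h22, h30, h32⟩ :=
    p.exists_slave_coeffs h1 hc hL₀ hL₂ fun j hj α => hW j (by omega) α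
  -- The harmonics just constructed have some slave coefficients; uniqueness in the linear equations
  -- identifies them with the given ones.
  obtain rfl : μ' = μ := mul_left_cancel₀ hL₀ (by linear_combination e1 - H.eq_μ)
  obtain rfl : ν' = ν := mul_left_cancel₀ hL₂ (by linear_combination e2 - H.eq_ν)
  obtain rfl : σ₁ = σ := mul_left_cancel₀ hL₀ (by linear_combination e3 - H.eq_σ)
  obtain rfl : σ₂ = σ' := mul_left_cancel₀ hL₀ (by linear_combination e4 - H.eq_σ')
  obtain rfl : τ' = τ := mul_left_cancel₀ hL₂ (by linear_combination e5 - H.eq_τ)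
  have key : ∀ j ≤ 4, cf j 1 (p.cornerExpansion z s t F₂ F₃ h) = 0 := by
    intro j hj
    interval_cases j
    · exact (p.isGraded_cornerExpansion h).cf_zero 1
    · rw [p.cf_one_cornerExpansion 1 (by norm_num)]
      simp only [zpow_one]
      rw [hS, const_zero, zero_mul]
    · rw [(p.cf_two_cornerExpansion h10 h1 hc).2.2, hS, H.velocity, const_zero]
      ring
    · rw [p.cf_three_one_of_flows hρ rfl hS h10 h1 hc h20 h22, H.velocity, H.dispersion₂, H.cubic,
        const_zero]
      ring
    · rw [p.cf_four_one_of_flows hρ rfl rfl rfl hS h10 h1 hc h20 h22 h30 h32, H.velocity,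
        H.dispersion₂, H.cubic, H.dispersion₃, H.deriv, H.conjDeriv, const_zero]
      ring
  intro j hj α
  by_cases hα : α = 1
  · rw [hα, key j hj]
  · by_cases hα' : α = -1
    -- The harmonic `-1` is the conjugate of the harmonic `1`.
    · rw [hα', p.isReal_cornerExpansion hz hc, key j hj, map_zero]
    · exact hW j hj α hα hα'

end reduction

end QCoeffs

/-! ### Gauge freedom and Möbius invariance of the system -/

namespace QCoeffs

section gauge

variable {p : QCoeffs} {z s t : Fin 4 → ℂ} {ρ₁ ρ₂ B a b μ ν σ σ' τ : ℂ}

/-- A common phase of the carrier factors is harmless because each equation is homogeneous in them,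
of degree `0`, `1` or `2`. -/
theorem ReducedEqs.gauge_factor (H : p.ReducedEqs z s t ρ₁ ρ₂ B a b μ ν σ σ' τ) {A : ℂ}
    (hA : A ≠ 0) : p.ReducedEqs (fun c => A * z c) s t ρ₁ ρ₂ B a b μ ν σ σ' τ := by
  obtain ⟨h1, h2, h3, h4, h5, h6, h7, h8, h9, h10, h11⟩ := H
  have e : ∀ c d, A * z c * (A * z d)⁻¹ = z c * (z d)⁻¹ := fun c d => by field_simp
  have e2 : ∀ c d, (A * z c) ^ 2 * (A * z d)⁻¹ = A * (z c ^ 2 * (z d)⁻¹) := fun c d => by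
    field_simp
  have e3 : ∀ c d e, A * z c * (A * z d) * (A * z e)⁻¹ = A * (z c * z d * (z e)⁻¹) :=
    fun c d e => by field_simp
  have lin : ∀ y : Fin 4 → ℂ, p.linSum (fun c => A * z c * y c) =
      A * p.linSum (fun c => z c * y c) := fun y => by
    simp only [linSum, Complex.real_smul]; ring
  have sq : ∀ y : Fin 4 → ℂ, p.linSum (fun c => (A * z c) ^ 2 * y c) =
      A ^ 2 * p.linSum (fun c => z c ^ 2 * y c) := fun y => by
    simp only [linSum, Complex.real_smul]; ring
  have sq' : p.linSum (fun c => (A * z c) ^ 2) = A ^ 2 * p.linSum (fun c => z c ^ 2) := by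
    simp only [linSum, Complex.real_smul]; ring
  refine ⟨by simpa only [e] using h1, ?_, by simpa only [e] using h3, by simpa only [e] using h4,
    ?_, ?_, ?_, ?_, ?_, ?_, ?_⟩
  · rw [sq', show p.pairSum (fun c d => A * z c * (A * z d)) =
      A ^ 2 * p.pairSum (fun c d => z c * z d) by
        simp only [pairSum, Complex.real_smul]; ring]
    linear_combination A ^ 2 * h2
  · rw [sq', sq, show p.pairSum (fun c d => A * z c * (A * z d) * (s c + s d)) =
      A ^ 2 * p.pairSum (fun c d => z c * z d * (s c + s d)) by
        simp only [pairSum, Complex.real_smul]; ring]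
    linear_combination A ^ 2 * h5
  · rw [lin, h6, mul_zero]
  · rw [lin, lin]
    linear_combination A * h7
  · rw [lin, show p.cubicCoeff (fun c => A * z c) μ ν = A * p.cubicCoeff z μ ν by
      simp only [cubicCoeff, e2, e3, pairSum, tripleSum, Complex.real_smul]; ring]
    linear_combination A * h8
  · rw [lin, lin, lin]
    linear_combination A * h9
  · rw [lin, lin, show p.cubicCoeffDeriv (fun c => A * z c) s μ ν σ τ =
        A * p.cubicCoeffDeriv z s μ ν σ τ by
      simp only [cubicCoeffDeriv, e2, e3, pairSum, tripleSum, Complex.real_smul]; ring]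
    linear_combination A * h10
  · rw [lin, lin, show p.cubicCoeffConjDeriv (fun c => A * z c) s μ ν σ' =
        A * p.cubicCoeffConjDeriv z s μ ν σ' by
      simp only [cubicCoeffConjDeriv, e2, e3, pairSum, tripleSum, Complex.real_smul]; ring]
    linear_combination A * h11

/-- Moving the base point of the slow variables adds to each equation multiples of the others and of
the dispersion relation. -/
theorem ReducedEqs.gauge_shift (H : p.ReducedEqs z s t ρ₁ ρ₂ B a b μ ν σ σ' τ)
    (hS : p.linSum z = 0) (r q : ℂ) :
    p.ReducedEqs z (fun c => r + s c) (fun c => q + t c) ρ₁ ρ₂ B a b μ ν σ σ' τ := by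
  obtain ⟨h1, h2, h3, h4, h5, h6, h7, h8, h9, h10, h11⟩ := H
  have l1 : p.linSum (fun c => r + s c) = r * p.linSum (fun _ => (1 : ℂ)) + p.linSum s := by
    simp only [linSum, Complex.real_smul]; ring
  have l2 : p.linSum (fun c => z c ^ 2 * (r + s c)) =
      r * p.linSum (fun c => z c ^ 2) + p.linSum (fun c => z c ^ 2 * s c) := by
    simp only [linSum, Complex.real_smul]; ring
  have l3 : p.linSum (fun c => z c * (r + s c)) =
      r * p.linSum z + p.linSum (fun c => z c * s c) := by
    simp only [linSum, Complex.real_smul]; ring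
  have l3' : p.linSum (fun c => z c * (q + t c)) =
      q * p.linSum z + p.linSum (fun c => z c * t c) := by
    simp only [linSum, Complex.real_smul]; ring
  have l4 : p.linSum (fun c => z c * (r + s c) ^ 2) = r ^ 2 * p.linSum z
      + 2 * r * p.linSum (fun c => z c * s c) + p.linSum (fun c => z c * s c ^ 2) := by
    simp only [linSum, Complex.real_smul]; ring
  have l5 : p.linSum (fun c => z c * (r + s c) ^ 3) = r ^ 3 * p.linSum z
      + 3 * r ^ 2 * p.linSum (fun c => z c * s c) + 3 * r * p.linSum (fun c => z c * s c ^ 2)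
      + p.linSum (fun c => z c * s c ^ 3) := by
    simp only [linSum, Complex.real_smul]; ring
  have l6 : p.linSum (fun c => z c * ((r + s c) * (q + t c))) = r * q * p.linSum z
      + q * p.linSum (fun c => z c * s c) + r * p.linSum (fun c => z c * t c)
      + p.linSum (fun c => z c * (s c * t c)) := by
    simp only [linSum, Complex.real_smul]; ring
  refine ⟨h1, h2, ?_, ?_, ?_, ?_, ?_, ?_, ?_, ?_, ?_⟩
  · rw [l1, show p.pairSum (fun c d => z c * (z d)⁻¹ * (r + s c) + z d * (z c)⁻¹ * (r + s d)) =
      r * p.pairSum (fun c d => z c * (z d)⁻¹ + z d * (z c)⁻¹)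
      + p.pairSum (fun c d => z c * (z d)⁻¹ * s c + z d * (z c)⁻¹ * s d) by
        simp only [pairSum, Complex.real_smul]; ring]
    linear_combination h3 + r * h1
  · rw [l1, show p.pairSum (fun c d => z c * (z d)⁻¹ * (r + s d) + z d * (z c)⁻¹ * (r + s c)) =
      r * p.pairSum (fun c d => z c * (z d)⁻¹ + z d * (z c)⁻¹)
      + p.pairSum (fun c d => z c * (z d)⁻¹ * s d + z d * (z c)⁻¹ * s c) by
        simp only [pairSum, Complex.real_smul]; ring]
    linear_combination h4 + r * h1
  · rw [l2, show p.pairSum (fun c d => z c * z d * (r + s c + (r + s d))) =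
      2 * r * p.pairSum (fun c d => z c * z d) + p.pairSum (fun c d => z c * z d * (s c + s d)) by
        simp only [pairSum, Complex.real_smul]; ring]
    linear_combination h5 + 2 * r * h2
  · rw [l3, hS, h6]; ring
  · rw [l3', l4, hS, h6]
    linear_combination h7
  · rw [l3', hS]
    linear_combination h8
  · rw [l3', l5, l6, hS, h6]
    linear_combination h9 + r * h7
  · rw [l3', l6, hS, h6, show p.cubicCoeffDeriv z (fun c => r + s c) μ ν σ τ =
        p.cubicCoeffDeriv z s μ ν σ τ + 2 * r * p.cubicCoeff z μ ν by
      simp only [cubicCoeffDeriv, cubicCoeff, pairSum, tripleSum, Complex.real_smul]; ring]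
    linear_combination h10 + 2 * r * h8
  · rw [l3', l6, hS, h6, show p.cubicCoeffConjDeriv z (fun c => r + s c) μ ν σ' =
        p.cubicCoeffConjDeriv z s μ ν σ' + r * p.cubicCoeff z μ ν by
      simp only [cubicCoeffConjDeriv, cubicCoeff, pairSum, tripleSum, Complex.real_smul]; ring]
    linear_combination h11 + r * h8

theorem reducedEqs_gauge (hS : p.linSum z = 0) {A : ℂ} (hA : A ≠ 0) (r q : ℂ) :
    p.ReducedEqs (fun c => A * z c) (fun c => r + s c) (fun c => q + t c)
      ρ₁ ρ₂ B a b μ ν σ σ' τ ↔ p.ReducedEqs z s t ρ₁ ρ₂ B a b μ ν σ σ' τ := by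
  refine ⟨fun H => ?_, fun H => (H.gauge_shift hS r q).gauge_factor hA⟩
  have := (H.gauge_factor (inv_ne_zero hA))
  simp only [inv_mul_cancel_left₀ hA] at this
  simpa using this.gauge_shift hS (-r) (-q)

end gauge

/-- Carrier factors at the four lattice points, relative to their centre. -/
def centred (A D : ℂ) : Fin 4 → ℂ := ![A⁻¹, D, D⁻¹, A]

/-- Slow shifts to the four lattice points, relative to their centre. -/
def shifts (s t : ℂ) : Fin 4 → ℂ := ![-s, t, -t, s]

set_option maxHeartbeats 1000000 in
/-- A Möbius transformation shifts the quadratic harmonics and leaves the reduced equations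
unchanged. -/
theorem ReducedEqs.mobius {p : QCoeffs} {A D s t r q : ℂ} {ρ₁ ρ₂ B a b μ ν σ σ' τ : ℂ}
    (H : p.ReducedEqs (centred A D) (shifts s t) (shifts r q) ρ₁ ρ₂ B a b μ ν σ σ' τ)
    (hA : A ≠ 0) (hD : D ≠ 0) (hS : p.linSum (centred A D) = 0) (C : ℝ) :
    (p.mobius C 1).ReducedEqs (centred A D) (shifts s t) (shifts r q) ρ₁ ρ₂ B a b
      (μ + 2 * C) (ν + C) σ σ' τ := by
  obtain ⟨h1, h2, h3, h4, h5, h6, h7, h8, h9, h10, h11⟩ := H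
  have lin : ∀ y : Fin 4 → ℂ, (p.mobius C 1).linSum y = p.linSum y := fun y => by
    simp [linSum, QCoeffs.mobius]
  have e : (p.a₁ : ℂ) * (A + A⁻¹) + p.a₂ * (D + D⁻¹) = 0 := by
    simp only [centred, linSum, Complex.real_smul, Matrix.cons_val] at hS
    linear_combination hS
  have hv := h6
  -- `Z`, `Z₁`, `Z₂`, `Z₃` are the corner sums of `z`, `zs`, `z²`, `z²s`. The transformed equations
  -- differ from the original ones by multiples of slave equations, the dispersion relation `e` and
  -- the group velocity relation `hv`, with these sums as multipliers.
  have Zdef : ∃ Z, Z = A + A⁻¹ + D + D⁻¹ := ⟨_, rfl⟩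
  obtain ⟨Z, hZ⟩ := Zdef
  obtain ⟨Z₁, hZ₁⟩ : ∃ Z, Z = s * (A - A⁻¹) + t * (D - D⁻¹) := ⟨_, rfl⟩
  obtain ⟨Z₂, hZ₂⟩ : ∃ Z, Z = A ^ 2 + A⁻¹ ^ 2 + D ^ 2 + D⁻¹ ^ 2 := ⟨_, rfl⟩
  obtain ⟨Z₃, hZ₃⟩ : ∃ Z, Z = s * (A ^ 2 - A⁻¹ ^ 2) + t * (D ^ 2 - D⁻¹ ^ 2) := ⟨_, rfl⟩
  simp only [centred, shifts, linSum, Complex.real_smul, Matrix.cons_val] at hv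
  refine ⟨?_, ?_, ?_, ?_, ?_, by rw [lin, h6], by rw [lin, lin, h7], ?_, by rw [lin, lin, lin, h9],
    ?_, ?_⟩
  all_goals
    simp only [QCoeffs.mobius, centred, shifts, cubicCoeff,
      cubicCoeffDeriv, cubicCoeffConjDeriv, linSum, pairSum, tripleSum, Complex.real_smul,
      Matrix.cons_val, inv_inv] at h1 h2 h3 h4 h5 h8 h10 h11 ⊢
    push_cast at h1 h2 h3 h4 h5 h8 h10 h11 ⊢
  · clear h2 h3 h4 h5 h8 h10 h11
    linear_combination (norm := (subst_vars; field_simp; ring)) h1 + 2 * C * Z * e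
  · linear_combination (norm := (subst_vars; field_simp; ring)) h2 + C * Z * e
  · linear_combination (norm := (subst_vars; field_simp; ring)) h3 + C * (Z * hv + Z₁ * e)
  · linear_combination (norm := (subst_vars; field_simp; ring)) h4 - C * (Z * hv + Z₁ * e)
  · linear_combination (norm := (subst_vars; field_simp; ring)) h5 + C * (Z * hv + Z₁ * e)
  · linear_combination (norm := (subst_vars; field_simp; ring)) h8 + C * Z * h2 + C * Z * h1
      + e * (2 * C * μ + C * ν * (Z₂ - 2) + C ^ 2 * (1 + Z₂ / 2 + 3 * Z ^ 2 / 2))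
  · linear_combination (norm := (subst_vars; field_simp; ring)) h10 + C * Z * h5 + C * Z * h3
      + C * Z₁ * h1 + C * ((2 * σ + 2 * ν * Z₃ + τ * Z₂ - 2 * τ) * e - 4 * ν * hv)
      + C ^ 2 * ((Z₃ + 2 * Z * Z₁) * e + (Z ^ 2 - 2) * hv)
  · linear_combination (norm := (subst_vars; field_simp; ring)) h11 - C * Z₁ * h2 + C * Z * h4
      + C * (2 * σ' * e - (ν * Z₂ + 2 * μ + 2 * ν) * hv)
      + C ^ 2 * (- Z * Z₁ * e - (Z₂ / 2 + Z ^ 2 / 2 + 3) * hv)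

end QCoeffs

/-! ### Carriers about the centre of the square -/

namespace QCoeffs

open DiffPoly

/-- `e^{iφ}` -/
def phase (φ : ℝ) : ℂ := Complex.exp (φ * Complex.I)

theorem phase_ne_zero (φ : ℝ) : phase φ ≠ 0 := Complex.exp_ne_zero _

theorem conj_phase (φ : ℝ) : starRingEnd ℂ (phase φ) = (phase φ)⁻¹ := by
  rw [phase, ← Complex.exp_conj, ← Complex.exp_neg]
  simp

theorem phase_eq (φ : ℝ) : phase φ = Real.cos φ + Real.sin φ * Complex.I := by
  rw [phase, Complex.exp_mul_I, Complex.ofReal_cos, Complex.ofReal_sin]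

theorem inv_phase_eq (φ : ℝ) : (phase φ)⁻¹ = Real.cos φ - Real.sin φ * Complex.I := by
  rw [← conj_phase, phase_eq, map_add, map_mul, Complex.conj_ofReal, Complex.conj_ofReal,
    Complex.conj_I]
  ring

theorem carrier_factors (φ ψ : ℝ) :
    ![1, carrierK (φ + ψ), carrierΩ (ψ - φ), carrierK (φ + ψ) * carrierΩ (ψ - φ)] =
      fun c => phase φ * centred (phase φ) (phase ψ) c := by
  have hK : carrierK (φ + ψ) = phase φ * phase ψ := by
    rw [carrierK, phase, phase, ← Complex.exp_add]
    congr 1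
    push_cast
    ring
  have hΩ : carrierΩ (ψ - φ) = phase φ * (phase ψ)⁻¹ := by
    rw [carrierΩ, phase, phase, ← Complex.exp_neg, ← Complex.exp_add]
    congr 1
    push_cast
    ring
  have h1 := mul_inv_cancel₀ (phase_ne_zero φ)
  have h2 := mul_inv_cancel₀ (phase_ne_zero ψ)
  funext c
  fin_cases c
  · simp [centred, h1]
  · simp [centred, hK]
  · simp [centred, hΩ]
  · simp only [hK, hΩ, centred, Fin.reduceFinMk, Matrix.cons_val]
    linear_combination phase φ ^ 2 * h2

theorem linSymbol_eq (p : QCoeffs) (φ ψ : ℝ) (α : ℕ) :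
    p.linSymbol (φ + ψ) (ψ - φ) α =
      phase φ ^ α * p.linSum (fun c => centred (phase φ) (phase ψ) c ^ α) := by
  have h := carrier_factors φ ψ
  have h1 := congrFun h 1
  have h2 := congrFun h 2
  have h3 := congrFun h 3
  simp only [Matrix.cons_val] at h1 h2 h3
  rw [linSymbol, h3, h1, h2]
  simp only [linSum, centred, Complex.real_smul, Matrix.cons_val, mul_pow, mul_add, ← mul_assoc]
  have e : phase φ ^ α * (phase φ)⁻¹ ^ α = 1 := by
    rw [← mul_pow, mul_inv_cancel₀ (phase_ne_zero φ), one_pow]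
  linear_combination (-p.a₁ : ℂ) * e

theorem conj_centred_phase (φ ψ : ℝ) (c : Fin 4) :
    starRingEnd ℂ (centred (phase φ) (phase ψ) c) = (centred (phase φ) (phase ψ) c)⁻¹ := by
  fin_cases c <;> simp [centred, conj_phase]

theorem sum_ne_zero_of_abs_ne {p : QCoeffs} (hp : p.IsDispersive) : p.a₁ + p.a₂ ≠ 0 := by
  intro h
  apply hp.2.2
  rw [eq_neg_of_add_eq_zero_left h, abs_neg]

section carrier

variable {p : QCoeffs} {φ ψ : ℝ}

theorem IsCarrier.linSum_centred (hc : p.IsCarrier (φ + ψ) (ψ - φ)) :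
    p.linSum (centred (phase φ) (phase ψ)) = 0 := by
  have := hc.dispersion
  rw [linSymbol_eq] at this
  simpa [phase_ne_zero] using this

/-- The index `0` gives `2(a₁ + a₂)`, nonzero by `|a₁| ≠ |a₂|`; negative indices are complex
conjugates of positive ones, as the factors lie on the unit circle. -/
theorem IsCarrier.linSum_centred_zpow_ne_zero (hp : p.IsDispersive)
    (hc : p.IsCarrier (φ + ψ) (ψ - φ)) (α : ℤ) (h1 : α ≠ 1) (h2 : α ≠ -1) (h3 : α.natAbs ≤ 4) :
    p.linSum (fun c => centred (phase φ) (phase ψ) c ^ α) ≠ 0 := by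
  have key : p.linSum (fun c => centred (phase φ) (phase ψ) c ^ α.natAbs) ≠ 0 := by
    by_cases h0 : α.natAbs = 0
    · have := sum_ne_zero_of_abs_ne hp
      simp only [h0, pow_zero, linSum, Complex.real_smul]
      rw [show (p.a₁ : ℂ) * (1 + 1) + p.a₂ * (1 + 1) = ((2 * (p.a₁ + p.a₂) : ℝ) : ℂ) by
        push_cast; ring]
      exact Complex.ofReal_ne_zero.mpr (mul_ne_zero two_ne_zero this)
    · have := hc.nonresonant α.natAbs (by omega) h3
      rw [linSymbol_eq] at this
      exact right_ne_zero_of_mul this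
  obtain h | h := Int.natAbs_eq α
  · rw [h]
    exact_mod_cast key
  · intro h0
    apply key
    have := congrArg (starRingEnd ℂ) h0
    rw [h] at this
    generalize α.natAbs = n at this ⊢
    simpa [linSum, conj_centred_phase] using this

/-- The shifts `0, 1, -v, 1 - v` and `0, 0, 1, 1` have means `(1 - v)/2` and `1/2`. Subtracting
these and dividing the carrier factors by `e^{iφ}` are gauge transformations. -/
theorem IsCarrier.hasReduction_iff (hp : p.IsDispersive) (hc : p.IsCarrier (φ + ψ) (ψ - φ))
    {v ρ₁ B : ℝ} {ρ₂ a b : ℂ} : p.HasReduction (φ + ψ) (ψ - φ) v ρ₁ ρ₂ B a b ↔ ρ₁ ≠ 0 ∧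
      ∃ μ ν σ σ' τ : ℂ, p.ReducedEqs (centred (phase φ) (phase ψ))
        (shifts ((1 - v) / 2) ((1 + v) / 2)) (shifts (1 / 2) (-1 / 2)) ρ₁ ρ₂ B a b μ ν σ σ' τ := by
  have hS := hc.linSum_centred
  have hA := phase_ne_zero φ
  have hs : (fun c => ((![0, 1, -v, 1 - v] : Fin 4 → ℝ) c : ℂ)) =
      fun c => (1 - v) / 2 + shifts ((1 - v) / 2) ((1 + v) / 2) c := by
    funext c
    fin_cases c <;> simp [shifts] <;> ring
  have ht : (fun c => ((![0, 0, 1, 1] : Fin 4 → ℝ) c : ℂ)) =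
      fun c => 1 / 2 + shifts (1 / 2) (-1 / 2) c := by
    funext c
    fin_cases c <;> norm_num [shifts]
  have hS' : p.linSum (fun c => phase φ * centred (phase φ) (phase ψ) c) = 0 := by
    rw [← mul_zero (phase φ), ← hS]
    simp only [linSum, Complex.real_smul]
    ring
  have hL : ∀ α : ℤ, α ≠ 1 → α ≠ -1 → α.natAbs ≤ 4 →
      p.linSum (fun c => (phase φ * centred (phase φ) (phase ψ) c) ^ α) ≠ 0 := by
    intro α h1 h2 h3
    have := hc.linSum_centred_zpow_ne_zero hp α h1 h2 h3
    rw [show p.linSum (fun c => (phase φ * centred (phase φ) (phase ψ) c) ^ α) =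
      phase φ ^ α * p.linSum (fun c => centred (phase φ) (phase ψ) c ^ α) by
        simp only [linSum, mul_zpow, Complex.real_smul]; ring]
    exact mul_ne_zero (zpow_ne_zero _ hA) this
  have hL₀ : p.linSum (fun _ => (1 : ℂ)) ≠ 0 := by
    have := hL 0 (by norm_num) (by norm_num) (by norm_num)
    simpa only [zpow_zero] using this
  have hL₂ : p.linSum (fun c => (phase φ * centred (phase φ) (phase ψ) c) ^ 2) ≠ 0 := by
    have := hL 2 (by norm_num) (by norm_num) (by norm_num)
    exact_mod_cast this
  have hz : ∀ c, starRingEnd ℂ (phase φ * centred (phase φ) (phase ψ) c) =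
      (phase φ * centred (phase φ) (phase ψ) c)⁻¹ := fun c => by
    rw [map_mul, conj_phase, conj_centred_phase, mul_inv]
  simp only [← reducedEqs_gauge hS hA ((1 - v) / 2) (1 / 2), ← hs, ← ht]
  refine and_congr_right fun hρ => ⟨?_, ?_⟩
  · rintro ⟨F₂, F₃, h, h1, h2, h3, h4, h5, hW⟩
    refine p.reducedEqs_of_expansion hρ h1 h2 h3 h4 h5 hS' hL₀ hL₂ fun j hj α => ?_
    have := (coeff_eq_zero_iff j _).1 (hW j hj) α
    rwa [expansion_eq, carrier_factors] at this
  · rintro ⟨μ, ν, σ, σ', τ, H⟩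
    obtain ⟨F₂, F₃, h, h1, h2, h3, h4, h5, hW⟩ := p.exists_expansion_of_reducedEqs hρ hz hS' hL H
    refine ⟨F₂, F₃, h, h1, h2, h3, h4, h5, fun j hj => (coeff_eq_zero_iff j _).2 fun α => ?_⟩
    rw [expansion_eq, carrier_factors]
    exact hW j hj α

end carrier

theorem exists_half_angles (κ ω : ℝ) : ∃ φ ψ, κ = φ + ψ ∧ ω = ψ - φ :=
  ⟨(κ - ω) / 2, (κ + ω) / 2, by ring, by ring⟩

theorem IsDispersive.mobius {p : QCoeffs} (hp : p.IsDispersive) (C : ℝ) {D : ℝ} (hD : D ≠ 0) :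
    (p.mobius C D).IsDispersive := by
  obtain ⟨h1, h2, h3⟩ := hp
  refine ⟨mul_ne_zero (pow_ne_zero _ hD) h1, mul_ne_zero (pow_ne_zero _ hD) h2, ?_⟩
  simp only [QCoeffs.mobius, abs_mul]
  exact fun h => h3 (mul_left_cancel₀ (abs_ne_zero.mpr (pow_ne_zero 3 hD)) h)

theorem isCarrier_mobius {p : QCoeffs} (C κ ω : ℝ) :
    (p.mobius C 1).IsCarrier κ ω ↔ p.IsCarrier κ ω := by
  have e : (p.mobius C 1).linSymbol κ ω = p.linSymbol κ ω := by
    funext α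
    simp [linSymbol, QCoeffs.mobius]
  exact ⟨fun ⟨h1, h2, h3⟩ => ⟨e ▸ h1, h2, e ▸ h3⟩, fun ⟨h1, h2, h3⟩ => ⟨e ▸ h1, h2, e ▸ h3⟩⟩

theorem IsA2Integrable.mobius {p : QCoeffs} (hp : p.IsDispersive) (h : p.IsA2Integrable) (C : ℝ) :
    (p.mobius C 1).IsA2Integrable := by
  intro κ ω hc
  obtain ⟨φ, ψ, rfl, rfl⟩ := exists_half_angles κ ω
  have hc' := (isCarrier_mobius C _ _).1 hc
  obtain ⟨v, ρ₁, ρ₂, B, a, b, H, hI⟩ := h _ _ hc'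
  refine ⟨v, ρ₁, ρ₂, B, a, b, (hc.hasReduction_iff (hp.mobius C one_ne_zero)).2 ?_, hI⟩
  obtain ⟨hρ, μ, ν, σ, σ', τ, H⟩ := (hc'.hasReduction_iff hp).1 H
  exact ⟨hρ, _, _, _, _, _,
    H.mobius (phase_ne_zero φ) (phase_ne_zero ψ) hc'.linSum_centred C⟩

/-- The inverse substitution upgrades the one-sided preservation of integrability to an equivalence.
-/
theorem mobius_mobius (p : QCoeffs) (C : ℝ) : (p.mobius C 1).mobius (-C) 1 = p := by
  ext <;> simp only [QCoeffs.mobius] <;> ring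

theorem isA2Integrable_mobius {p : QCoeffs} (hp : p.IsDispersive) (C : ℝ) :
    (p.mobius C 1).IsA2Integrable ↔ p.IsA2Integrable :=
  ⟨fun h => p.mobius_mobius C ▸ h.mobius (hp.mobius C one_ne_zero) (-C), fun h => h.mobius hp C⟩

/-- The transformation changes `ξ₁ - ξ₂` and `ξ₃ - ξ₄` only by a factor `D` and multiples of `α₂`
and `β₂`. -/
theorem case1_mobius (p : QCoeffs) (C : ℝ) {D : ℝ} (hD : D ≠ 0) :
    (p.mobius C D).Case1 ↔ p.Case1 := by
  simp only [Case1, QCoeffs.mobius, mul_eq_zero, pow_eq_zero_iff two_ne_zero, hD, false_or]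
  refine and_congr_right fun h1 => and_congr_right fun h2 => ?_
  rw [h1, h2]
  simp [hD]

/-- The defects of the equations are relative invariants: for example `a₁(ξ₁ - ξ₂) + α₂γ₁` is
multiplied by `D⁴`, since the shift of `γ₁` by `2Ca₁` compensates that of `ξ₁ - ξ₂`. -/
theorem case4_mobius {p : QCoeffs} (hp : p.a₁ ≠ 0) (C : ℝ) {D : ℝ} (hD : D ≠ 0) :
    (p.mobius C D).Case4 ↔ p.Case4 := by
  have e1 : ∀ x : ℝ, D ^ 2 * (x + C * (p.a₁ + p.a₂)) = (D ^ 3 * p.a₁ + D ^ 3 * p.a₂) *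
      (D ^ 2 * (p.γ₁ + 2 * C * p.a₁)) / (2 * (D ^ 3 * p.a₁)) ↔
      x = (p.a₁ + p.a₂) * p.γ₁ / (2 * p.a₁) := fun x => by
    field_simp
    constructor <;> intro h <;> linear_combination h
  simp only [Case4, QCoeffs.mobius, e1]
  refine and_congr_right fun h1 => and_congr_right fun h2 => and_congr ?_ (and_congr ?_
    (and_congr ?_ ?_))
  · field_simp
    constructor <;> intro h <;> linear_combination h
  · rw [← mul_right_inj' (pow_ne_zero 4 hD) (b := p.a₁ * (p.ξ₁ - p.ξ₂))]
    constructor <;> intro h <;> linear_combination h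
  · rw [← mul_right_inj' (pow_ne_zero 4 hD) (b := p.a₁ * (p.ξ₃ - p.ξ₄))]
    constructor <;> intro h <;> linear_combination h
  · simp [hD]

end QCoeffs

/-! ### Sufficiency by point reflection -/

namespace QCoeffs

open DiffPoly

section reversal

/-- The point reflection of the elementary square multiplies the quadratic part of the equation by
`ε` and preserves the cubic part. -/
structure IsReversible (p : QCoeffs) (ε : ℂ) : Prop where
  mul_self : ε * ε = 1
  pair : ∀ B : Fin 4 → Fin 4 → ℂ, (∀ c d, B c d = B d c) →
    p.pairSum (fun c d => B c.rev d.rev) = ε * p.pairSum B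
  triple : ∀ B : Fin 4 → Fin 4 → Fin 4 → ℂ, (∀ c d e, B c d e = B e d c) →
    p.tripleSum (fun c d e => B c.rev d.rev e.rev) = p.tripleSum B

/-- Reversing the corner order flips the signs of `α₂`, `β₂` and exchanges `ξ₁` with `ξ₂`, `ξ₃` with
`ξ₄`. -/
theorem isReversible_one {p : QCoeffs} (h : p.Case1) : p.IsReversible 1 := by
  obtain ⟨h1, h2, h3, h4⟩ := h
  refine ⟨one_mul 1, fun B hB => ?_, fun B hB => ?_⟩
  · simp only [pairSum, h1, h2, Fin.rev, Complex.real_smul]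
    have e1 := hB 3 2
    have e2 := hB 1 0
    have e3 := hB 3 1
    have e4 := hB 2 0
    have e5 := hB 3 0
    have e6 := hB 2 1
    simp [e1, e2, e3, e4, e5, e6]
    ring
  · simp only [tripleSum, h3, h4, Fin.rev, Complex.real_smul]
    have e1 := hB 3 2 1
    have e2 := hB 3 2 0
    have e3 := hB 2 1 0
    have e4 := hB 3 1 0
    simp [e1, e2, e3, e4]
    ring

/-- With `γ₁ = 0`, Case 4 leaves only `α₂`, `β₂` in the quadratic part, and these are odd under the
reflection. -/
theorem isReversible_neg_one {p : QCoeffs} (h : p.Case4) (hγ : p.γ₁ = 0) :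
    p.a₁ ≠ 0 → p.IsReversible (-1) := by
  intro ha
  obtain ⟨h1, h2, h3, h4, h5, -⟩ := h
  simp only [hγ, mul_zero, zero_div, neg_zero, mul_eq_zero, ha, false_or, sub_eq_zero] at h1 h2 h3 h4 h5
  refine ⟨by norm_num, fun B hB => ?_, fun B hB => ?_⟩
  · simp only [pairSum, h1, h2, h3, hγ, Fin.rev, Complex.real_smul]
    have e1 := hB 3 2
    have e2 := hB 1 0
    have e3 := hB 3 1
    have e4 := hB 2 0
    simp [e1, e2, e3, e4]
    ring
  · simp only [tripleSum, h4, h5, Fin.rev, Complex.real_smul]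
    have e1 := hB 3 2 1
    have e2 := hB 3 2 0
    have e3 := hB 2 1 0
    have e4 := hB 3 1 0
    simp [e1, e2, e3, e4]
    ring

local notation "star'" => starRingEnd ℂ

variable {p : QCoeffs} {ε : ℂ}

theorem conj_linSum {x : Fin 4 → ℂ} (η : ℂ) (hx : ∀ c, star' (x c) = η * x c.rev) :
    star' (p.linSum x) = η * p.linSum x := by
  simp [linSum, hx, Fin.rev]
  ring

theorem IsReversible.conj_pairSum (hp : p.IsReversible ε) {B : Fin 4 → Fin 4 → ℂ} (η : ℂ)
    (hB : ∀ c d, B c d = B d c) (hB' : ∀ c d, star' (B c d) = η * B c.rev d.rev) :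
    star' (p.pairSum B) = ε * η * p.pairSum B := by
  have : star' (p.pairSum B) = p.pairSum (fun c d => star' (B c d)) := by
    simp [pairSum]
  simp only [this, hB']
  rw [mul_comm ε, mul_assoc, ← hp.pair B hB]
  simp only [pairSum, Complex.real_smul]
  ring

theorem IsReversible.conj_tripleSum (hp : p.IsReversible ε) {B : Fin 4 → Fin 4 → Fin 4 → ℂ} (η : ℂ)
    (hB : ∀ c d e, B c d e = B e d c) (hB' : ∀ c d e, star' (B c d e) = η * B c.rev d.rev e.rev) :
    star' (p.tripleSum B) = η * p.tripleSum B := by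
  have : star' (p.tripleSum B) = p.tripleSum (fun c d e => star' (B c d e)) := by
    simp [tripleSum]
  simp only [this, hB']
  rw [← hp.triple B hB]
  simp only [tripleSum, Complex.real_smul]
  ring

theorem eq_mul_of_conj {L Q x η : ℂ} (hL : L ≠ 0) (hL' : star' L = L) (hQ : star' Q = η * Q)
    (h : L * x + Q = 0) : star' x = η * x := by
  have h' := congrArg star' h
  simp only [map_add, map_mul, map_zero, hL', hQ] at h'
  apply mul_left_cancel₀ hL
  linear_combination h' - η * h

/-- Conjugation acts as reflection on `z` and as minus reflection on the shifts. So `μ`, `ν` acquire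
the sign `ε`, while `σ`, `σ'`, `τ` acquire `-ε`; in the cubic coefficients the quadratic part enters
twice and `ε² = 1` remains. The cubic coefficient is thus real and its two derivative versions
imaginary; the coefficient of the slow time derivative is imaginary as well. -/
theorem IsReversible.real_of_reducedEqs (hp : p.IsReversible ε) {z s t : Fin 4 → ℂ} {ρ₁ B : ℝ}
    {ρ₂ a b μ ν σ σ' τ : ℂ} (H : p.ReducedEqs z s t ρ₁ ρ₂ B a b μ ν σ σ' τ)
    (hz : ∀ c, star' (z c) = z c.rev) (hs : ∀ c, star' (s c) = -s c.rev)
    (ht : ∀ c, star' (t c) = -t c.rev)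
    (hL₀ : p.linSum (fun _ => (1 : ℂ)) ≠ 0) (hL₂ : p.linSum (fun c => z c ^ 2) ≠ 0)
    (hT : p.linSum (fun c => z c * t c) ≠ 0) : ρ₂.im = 0 ∧ a.im = 0 ∧ b.im = 0 := by
  obtain ⟨h1, h2, h3, h4, h5, -, -, h8, -, h10, h11⟩ := H
  have hε := hp.mul_self
  have two : star' 2 = 2 := map_ofNat _ 2
  have L₀ : star' (p.linSum fun _ => (1 : ℂ)) = p.linSum fun _ => (1 : ℂ) := by
    rw [conj_linSum 1 fun c => by simp, one_mul]
  have L₂ : star' (p.linSum fun c => z c ^ 2) = p.linSum fun c => z c ^ 2 := by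
    rw [conj_linSum 1 fun c => by simp [hz], one_mul]
  have Ls : star' (p.linSum s) = -1 * p.linSum s := conj_linSum _ fun c => by simp [hs]
  have Ls₂ : star' (p.linSum fun c => z c ^ 2 * s c) = -1 * p.linSum fun c => z c ^ 2 * s c :=
    conj_linSum _ fun c => by simp [hz, hs]
  have T : star' (p.linSum fun c => z c * t c) = -1 * p.linSum fun c => z c * t c :=
    conj_linSum _ fun c => by simp [hz, ht]
  have G : star' (p.linSum fun c => z c * (s c * t c)) = 1 * p.linSum fun c => z c * (s c * t c) :=
    conj_linSum _ fun c => by simp [hz, hs, ht]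
  have hμ : star' μ = ε * 1 * μ := eq_mul_of_conj hL₀ L₀
    (hp.conj_pairSum 1 (fun c d => by ring) fun c d => by simp [hz]) h1
  have hν : star' ν = ε * 1 * ν := eq_mul_of_conj hL₂ L₂
    (hp.conj_pairSum 1 (fun c d => by ring) fun c d => by simp [hz]) h2
  have hσ : star' σ = ε * (-1) * σ := by
    refine eq_mul_of_conj hL₀ L₀ ?_ h3
    rw [map_add, map_mul, hμ, Ls, hp.conj_pairSum (-1) (fun c d => by ring) fun c d => by
      simp [hz, hs]; ring]
    ring
  have hσ' : star' σ' = ε * (-1) * σ' := by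
    refine eq_mul_of_conj hL₀ L₀ ?_ h4
    rw [map_add, map_mul, hμ, Ls, hp.conj_pairSum (-1) (fun c d => by ring) fun c d => by
      simp [hz, hs]; ring]
    ring
  have hτ : star' τ = ε * (-1) * τ := by
    refine eq_mul_of_conj hL₂ L₂ ?_ h5
    rw [map_add, map_mul, map_mul, two, hν, Ls₂, hp.conj_pairSum (-1) (fun c d => by ring) fun c d => by
      simp [hz, hs]; ring]
    ring
  have hN : star' (p.cubicCoeff z μ ν) = p.cubicCoeff z μ ν := by
    rw [cubicCoeff, map_add, hp.conj_pairSum ε (fun c d => by ring) fun c d => by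
      simp [hz, hμ, hν]; ring, hp.conj_tripleSum 1 (fun c d e => by ring) fun c d e => by
      simp [hz], hε, one_mul, one_mul]
  have hP : star' (p.cubicCoeffDeriv z s μ ν σ τ) = -p.cubicCoeffDeriv z s μ ν σ τ := by
    rw [cubicCoeffDeriv, map_add, hp.conj_pairSum (-ε) (fun c d => by ring) fun c d => by
      simp [hz, hs, hμ, hν, hσ, hτ, two]; ring, hp.conj_tripleSum (-1) (fun c d e => by ring)
      fun c d e => by simp [hz, hs]; ring, mul_neg, hε]
    ring
  have hR : star' (p.cubicCoeffConjDeriv z s μ ν σ') = -p.cubicCoeffConjDeriv z s μ ν σ' := by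
    rw [cubicCoeffConjDeriv, map_add, hp.conj_pairSum (-ε) (fun c d => by ring) fun c d => by
      simp [hz, hs, hμ, hν, hσ']; ring, hp.conj_tripleSum (-1) (fun c d e => by ring)
      fun c d e => by simp [hz, hs]; ring, mul_neg, hε]
    ring
  have h8' := congrArg star' h8
  have h10' := congrArg star' h10
  have h11' := congrArg star' h11
  simp only [map_add, map_mul, map_neg, map_div₀, map_zero, hN, hP, hR, T, G, Complex.conj_I,
    Complex.conj_ofReal, map_ofNat] at h8' h10' h11'
  have hρ₂ : star' ρ₂ = ρ₂ := by
    apply mul_left_cancel₀ (mul_ne_zero hT Complex.I_ne_zero)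
    linear_combination h8 - h8'
  rw [hρ₂] at h10' h11'
  refine ⟨Complex.conj_eq_iff_im.1 hρ₂, Complex.conj_eq_iff_im.1 ?_, Complex.conj_eq_iff_im.1 ?_⟩
  · apply mul_left_cancel₀ hT
    linear_combination -h10 - h10'
  · apply mul_left_cancel₀ hT
    linear_combination -h11 - h11'

end reversal

theorem exists_linear_root {L : ℂ} (hL : L ≠ 0) (Q : ℂ) : ∃ x, L * x + Q = 0 :=
  ⟨-Q / L, by field_simp; ring⟩

theorem linSum_centred_mul_shifts (p : QCoeffs) (φ ψ : ℝ) (s t : ℂ) :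
    p.linSum (fun c => centred (phase φ) (phase ψ) c * shifts s t c) =
      2 * Complex.I * (p.a₁ * Real.sin φ * s + p.a₂ * Real.sin ψ * t) := by
  simp only [linSum, centred, shifts, Complex.real_smul, Matrix.cons_val, inv_phase_eq]
  simp only [phase_eq]
  ring

theorem linSum_centred_mul_sq (p : QCoeffs) (φ ψ : ℝ) (s t r q : ℂ) :
    p.linSum (fun c => centred (phase φ) (phase ψ) c * (shifts s t c * shifts r q c)) =
      2 * (p.a₁ * Real.cos φ * (s * r) + p.a₂ * Real.cos ψ * (t * q)) := by
  simp only [linSum, centred, shifts, Complex.real_smul, Matrix.cons_val, inv_phase_eq]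
  simp only [phase_eq]
  ring

theorem linSum_centred_mul_cube (p : QCoeffs) (φ ψ : ℝ) (s t : ℂ) :
    p.linSum (fun c => centred (phase φ) (phase ψ) c * shifts s t c ^ 3) =
      2 * Complex.I * (p.a₁ * Real.sin φ * s ^ 3 + p.a₂ * Real.sin ψ * t ^ 3) := by
  simp only [linSum, centred, shifts, Complex.real_smul, Matrix.cons_val, inv_phase_eq]
  simp only [phase_eq]
  ring

theorem linSum_centred_phase (p : QCoeffs) (φ ψ : ℝ) :
    p.linSum (centred (phase φ) (phase ψ)) = 2 * (p.a₁ * Real.cos φ + p.a₂ * Real.cos ψ) := by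
  simp only [linSum, centred, Complex.real_smul, Matrix.cons_val, inv_phase_eq]
  simp only [phase_eq]
  ring

section carrier

variable {p : QCoeffs} {φ ψ : ℝ}

theorem IsCarrier.cos_eq (hc : p.IsCarrier (φ + ψ) (ψ - φ)) :
    p.a₁ * Real.cos φ + p.a₂ * Real.cos ψ = 0 := by
  have := hc.linSum_centred
  rw [linSum_centred_phase, mul_eq_zero] at this
  exact_mod_cast this.resolve_left two_ne_zero

theorem IsCarrier.cos_ne_zero (hp : p.IsDispersive) (hc : p.IsCarrier (φ + ψ) (ψ - φ)) :
    Real.cos φ ≠ 0 := by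
  intro h
  have h' := hc.cos_eq
  rw [h, mul_zero, zero_add, mul_eq_zero, or_iff_right hp.2.1] at h'
  apply hc.sin_ne_zero
  rw [Real.sin_add, h, h']
  ring

/-- The product of the two expressions is `a₁² - a₂²` on the dispersion curve. One is the divisor of
the reduced equations, the other is nonzero exactly when the centred velocity `v` is. -/
theorem sin_ne_zero_of_cos_eq (hp : p.IsDispersive)
    (h : p.a₁ * Real.cos φ + p.a₂ * Real.cos ψ = 0) :
    p.a₁ * Real.sin φ - p.a₂ * Real.sin ψ ≠ 0 ∧ p.a₁ * Real.sin φ + p.a₂ * Real.sin ψ ≠ 0 := by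
  rw [← mul_ne_zero_iff]
  have h1 := Real.sin_sq_add_cos_sq φ
  have h2 := Real.sin_sq_add_cos_sq ψ
  have e : (p.a₁ * Real.sin φ - p.a₂ * Real.sin ψ) * (p.a₁ * Real.sin φ + p.a₂ * Real.sin ψ)
      = p.a₁ ^ 2 - p.a₂ ^ 2 := by
    linear_combination p.a₁ ^ 2 * h1 - p.a₂ ^ 2 * h2
      - (p.a₁ * Real.cos φ - p.a₂ * Real.cos ψ) * h
  rw [e, sub_ne_zero]
  exact fun h => hp.2.2 (sq_eq_sq_iff_abs_eq_abs _ _ |>.1 h)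

theorem IsCarrier.linSum_sq_ne_zero (hp : p.IsDispersive) (hc : p.IsCarrier (φ + ψ) (ψ - φ)) :
    p.linSum (fun c => centred (phase φ) (phase ψ) c ^ 2) ≠ 0 := by
  have := hc.linSum_centred_zpow_ne_zero hp 2 (by norm_num) (by norm_num) (by norm_num)
  exact_mod_cast this

theorem IsCarrier.linSum_one_ne_zero (hp : p.IsDispersive) (hc : p.IsCarrier (φ + ψ) (ψ - φ)) :
    p.linSum (fun _ => (1 : ℂ)) ≠ 0 := by
  have := hc.linSum_centred_zpow_ne_zero hp 0 (by norm_num) (by norm_num) (by norm_num)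
  simpa only [zpow_zero] using this

/-- The reduced equations at a carrier exist, with real linear part. -/
theorem IsCarrier.exists_reducedEqs (hp : p.IsDispersive) (hc : p.IsCarrier (φ + ψ) (ψ - φ)) :
    ∃ (v ρ₁ B : ℝ) (ρ₂ a b μ ν σ σ' τ : ℂ), ρ₁ ≠ 0 ∧
      p.ReducedEqs (centred (phase φ) (phase ψ)) (shifts ((1 - v) / 2) ((1 + v) / 2))
        (shifts (1 / 2) (-1 / 2)) ρ₁ ρ₂ B a b μ ν σ σ' τ := by
  have hcos := hc.cos_eq
  obtain ⟨hm, hpl⟩ := sin_ne_zero_of_cos_eq hp hcos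
  have hcφ := hc.cos_ne_zero hp
  have hL₀ := hc.linSum_one_ne_zero hp
  have hL₂ := hc.linSum_sq_ne_zero hp
  -- The system is triangular: `v`, `ρ₁`, `B` come from division by `W`, then the slave
  -- coefficients, and finally `ρ₂`, `a`, `b` from division by `iW` up to units.
  obtain ⟨W, hW⟩ : ∃ W, W = p.a₁ * Real.sin φ - p.a₂ * Real.sin ψ := ⟨_, rfl⟩
  rw [← hW] at hm
  obtain ⟨v, hv⟩ : ∃ v, v * W = p.a₁ * Real.sin φ + p.a₂ * Real.sin ψ :=
    ⟨_, div_mul_cancel₀ _ hm⟩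
  obtain ⟨ρ₁, hρ₁⟩ : ∃ ρ₁, ρ₁ * W = p.a₁ * Real.cos φ * v := ⟨_, div_mul_cancel₀ _ hm⟩
  obtain ⟨B, hB⟩ : ∃ B, B * W = ρ₁ * (p.a₁ * Real.cos φ)
      - 1 / 3 * (p.a₁ * Real.sin φ * ((1 - v) / 2) ^ 3 + p.a₂ * Real.sin ψ * ((1 + v) / 2) ^ 3) :=
    ⟨_, div_mul_cancel₀ _ hm⟩
  have hv0 : v ≠ 0 := by
    rintro rfl
    exact hpl (by rw [← hv, zero_mul])
  have hρ0 : ρ₁ ≠ 0 := by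
    rintro rfl
    rw [zero_mul] at hρ₁
    exact mul_ne_zero (mul_ne_zero hp.1 hcφ) hv0 hρ₁.symm
  have hT : p.linSum (fun c => centred (phase φ) (phase ψ) c * shifts (1 / 2) (-1 / 2) c) =
      Complex.I * W := by
    rw [linSum_centred_mul_shifts, hW]
    push_cast
    ring
  have hT0 : Complex.I * W ≠ 0 := mul_ne_zero Complex.I_ne_zero (Complex.ofReal_ne_zero.mpr hm)
  set z := centred (phase φ) (phase ψ) with hz
  set s := shifts ((1 - v) / 2) ((1 + v) / 2) with hs
  obtain ⟨μ, hμ⟩ := exists_linear_root hL₀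
    (p.pairSum (fun c d => z c * (z d)⁻¹ + z d * (z c)⁻¹))
  obtain ⟨ν, hν⟩ := exists_linear_root hL₂ (p.pairSum (fun c d => z c * z d))
  obtain ⟨σ, hσ⟩ := exists_linear_root hL₀ (μ * p.linSum s
    + p.pairSum fun c d => z c * (z d)⁻¹ * s c + z d * (z c)⁻¹ * s d)
  obtain ⟨σ', hσ'⟩ := exists_linear_root hL₀ (μ * p.linSum s
    + p.pairSum fun c d => z c * (z d)⁻¹ * s d + z d * (z c)⁻¹ * s c)
  obtain ⟨τ, hτ⟩ := exists_linear_root hL₂ (2 * ν * p.linSum (fun c => z c ^ 2 * s c)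
    + p.pairSum fun c d => z c * z d * (s c + s d))
  obtain ⟨ρ₂, hρ₂⟩ := exists_linear_root (mul_ne_zero hT0 (neg_ne_zero.2 Complex.I_ne_zero))
    (p.cubicCoeff z μ ν)
  obtain ⟨a, ha⟩ := exists_linear_root hT0 (Complex.I * W * (3 * B * ρ₂ / ρ₁)
    + 2 * p.linSum (fun c => z c * (s c * shifts (1 / 2) (-1 / 2) c)) * (-Complex.I * ρ₂)
    + p.cubicCoeffDeriv z s μ ν σ τ)
  obtain ⟨b, hb⟩ := exists_linear_root hT0
    (p.linSum (fun c => z c * (s c * shifts (1 / 2) (-1 / 2) c)) * (-Complex.I * ρ₂)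
    + p.cubicCoeffConjDeriv z s μ ν σ')
  have hcos' : (p.a₁ * Real.cos φ + p.a₂ * Real.cos ψ : ℂ) = 0 := by exact_mod_cast hcos
  have hW' : (W : ℂ) = p.a₁ * Real.sin φ - p.a₂ * Real.sin ψ := by exact_mod_cast hW
  have hv' : (v * W : ℂ) = p.a₁ * Real.sin φ + p.a₂ * Real.sin ψ := by exact_mod_cast hv
  have hρ₁' : (ρ₁ * W : ℂ) = p.a₁ * Real.cos φ * v := by exact_mod_cast hρ₁
  have hB' : (B * W : ℂ) = ρ₁ * (p.a₁ * Real.cos φ) - 1 / 3 * (p.a₁ * Real.sin φ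
      * ((1 - v) / 2) ^ 3 + p.a₂ * Real.sin ψ * ((1 + v) / 2) ^ 3) := by
    have := congrArg Complex.ofReal hB
    push_cast at this ⊢
    exact this
  refine ⟨v, ρ₁, B, ρ₂, a, b, μ, ν, σ, σ', τ, hρ0, hμ, hν, hσ, hσ', hτ, ?_, ?_, ?_, ?_, ?_, ?_⟩
  · rw [hz, linSum_centred_mul_shifts]
    linear_combination Complex.I * (v * hW' - hv')
  · simp only [sq]
    rw [hT, hz, linSum_centred_mul_sq]
    linear_combination hρ₁' + ((1 + v) / 2) ^ 2 * hcos'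
      + (-W * ρ₁) * Complex.I_sq
  · rw [hT]
    linear_combination hρ₂
  · rw [hT, hz, linSum_centred_mul_sq, linSum_centred_mul_cube]
    linear_combination Complex.I * hB' + Complex.I * ρ₁ * ((1 + v) / 2) * hcos'
  · rw [hT]
    linear_combination ha
  · rw [hT]
    linear_combination hb

theorem isA2Integrable_of_isReversible (hp : p.IsDispersive) {ε : ℂ} (h : p.IsReversible ε) :
    p.IsA2Integrable := by
  intro κ ω hc
  obtain ⟨φ, ψ, rfl, rfl⟩ := exists_half_angles κ ω
  obtain ⟨v, ρ₁, B, ρ₂, a, b, μ, ν, σ, σ', τ, hρ, H⟩ := hc.exists_reducedEqs hp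
  have hm := (sin_ne_zero_of_cos_eq hp hc.cos_eq).1
  have two : (starRingEnd ℂ) 2 = 2 := map_ofNat _ 2
  refine ⟨v, ρ₁, ρ₂, B, a, b, (hc.hasReduction_iff hp).2 ⟨hρ, _, _, _, _, _, H⟩,
    h.real_of_reducedEqs H (fun c => ?_) (fun c => ?_) (fun c => ?_)
    (hc.linSum_one_ne_zero hp) (hc.linSum_sq_ne_zero hp) ?_⟩
  · fin_cases c <;> simp [centred, conj_phase, Fin.rev]
  · fin_cases c <;> simp [shifts, Fin.rev, two]
  · fin_cases c <;> simp [shifts, Fin.rev, two]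
  · rw [linSum_centred_mul_shifts]
    refine mul_ne_zero (by simp) ?_
    intro h
    apply hm
    have : ((p.a₁ * Real.sin φ - p.a₂ * Real.sin ψ : ℝ) : ℂ) = 0 := by
      push_cast
      push_cast at h
      linear_combination 2 * h
    exact_mod_cast this

end carrier

end QCoeffs

/-! ### Necessity: elimination of the slave coefficients -/

namespace QCoeffs

/-- The imaginary part of the coefficient of `|u|²u`, up to a nonzero real factor, at a carrier
with `c = cos φ`, `d = cos ψ`, `X = sin φ`, `Y = sin ψ`. -/
def cubicIm (p : QCoeffs) (c d X Y : ℝ) : ℝ :=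
  let S := p.α₁ + p.β₁
  let H := p.α₁ - p.β₁
  let U := p.α₂ - p.β₂
  let V := p.α₂ + p.β₂
  (2 * c * d + 1) * (4 * S * c * d - 4 * H * X * Y + 2 * p.γ₂ * (d ^ 2 - Y ^ 2))
      * (2 * (V * X - U * Y))
    - ((2 * S * c * d + 2 * H * X * Y + p.γ₂)
        * (2 * V * X * (2 * c * d - (d ^ 2 - Y ^ 2)) - 2 * U * Y * (2 * c * d - (c ^ 2 - X ^ 2)))
      + 2 * (V * X * d - U * Y * c)
        * (2 * S * ((c ^ 2 - X ^ 2) * d + (d ^ 2 - Y ^ 2) * c) - 4 * H * X * Y * (c + d)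
          + 2 * p.γ₂ * d * (d ^ 2 - 3 * Y ^ 2)))
    - 2 * (p.a₁ + p.a₂) * (2 * c * d + 1)
      * ((p.ξ₁ - p.ξ₂ - p.ξ₃ + p.ξ₄) * X * (1 - 2 * (d ^ 2 - Y ^ 2))
        + (p.ξ₁ - p.ξ₂ + p.ξ₃ - p.ξ₄) * Y * (2 * (c ^ 2 - X ^ 2) - 1))

/-- The real part of the coefficient of `ū_ξ u²`, up to a nonzero real factor, at a carrier
with `c = cos φ`, `d = cos ψ`, `X = sin φ`, `Y = sin ψ`. -/
def conjDerivRe (p : QCoeffs) (c d X Y s t : ℝ) : ℝ :=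
  let S := p.α₁ + p.β₁
  let H := p.α₁ - p.β₁
  let U := p.α₂ - p.β₂
  let V := p.α₂ + p.β₂
  (2 * c * d + 1) * ((4 * S * c * d - 4 * H * X * Y + 2 * p.γ₂ * (d ^ 2 - Y ^ 2))
        * (2 * (V * s * d - U * t * c))
      + (2 * s * (V * c * d - U * X * Y) + 2 * t * (V * X * Y - U * c * d))
        * (2 * S * (c + d) + 2 * p.γ₂ * d)
      - (X * d * (-2 * S * s - 2 * H * t) + c * Y * (-2 * H * s - 2 * S * t)
          - 4 * p.γ₂ * t * Y * d) * (2 * (V * X - U * Y)))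
    - ((2 * S * c * d + 2 * H * X * Y + p.γ₂)
        * (2 * s * (V * c * (d ^ 2 - Y ^ 2) - 2 * U * d * X * Y)
          + 2 * t * (-U * d * (c ^ 2 - X ^ 2) + 2 * V * c * X * Y))
      - 2 * (V * X * d - U * Y * c)
        * (-2 * t * (2 * H * X * c * d + S * (c ^ 2 - X ^ 2) * Y)
          - 2 * s * (2 * H * Y * c * d + S * (d ^ 2 - Y ^ 2) * X)
          - 2 * p.γ₂ * t * Y * (3 * d ^ 2 - Y ^ 2)))
    - 2 * (p.a₁ + p.a₂) * (2 * c * d + 1)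
      * (-(p.ξ₁ - p.ξ₂ - p.ξ₃ + p.ξ₄) * (4 * t * d * X * Y + s * c)
        + (p.ξ₁ - p.ξ₂ + p.ξ₃ - p.ξ₄) * (4 * s * c * X * Y + t * d))

section sums

variable (p : QCoeffs) {A D : ℂ} {c d X Y : ℝ} (s t : ℝ)

theorem inv_centred (A D : ℂ) (i : Fin 4) : (centred A D i)⁻¹ = centred A⁻¹ D⁻¹ i := by
  fin_cases i <;> simp [centred]

theorem pairSum_ratio (hγ : p.γ₁ = 0) (hA : A = c + X * Complex.I) (hA' : A⁻¹ = c - X * Complex.I)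
    (hD : D = d + Y * Complex.I) (hD' : D⁻¹ = d - Y * Complex.I) :
    p.pairSum (fun i j => centred A D i * (centred A D j)⁻¹ + centred A D j * (centred A D i)⁻¹) =
      ((4 * (p.α₁ + p.β₁) * c * d - 4 * (p.α₁ - p.β₁) * X * Y + 2 * p.γ₂ * (d ^ 2 - Y ^ 2) : ℝ) : ℂ) := by
  simp only [pairSum, inv_centred, hγ]
  simp only [centred, Complex.real_smul, Matrix.cons_val, inv_inv]
  simp only [hA', hD']
  simp only [hA, hD]
  apply Complex.ext <;> simp [sq]
  · ring
  · ring

theorem pairSum_centred_add (hγ : p.γ₁ = 0) (hA : A = c + X * Complex.I) (hA' : A⁻¹ = c - X * Complex.I)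
    (hD : D = d + Y * Complex.I) (hD' : D⁻¹ = d - Y * Complex.I) :
    p.pairSum (fun i j => centred A D i + centred A D j) =
      ((2 * (p.α₁ + p.β₁) * (c + d) + 2 * p.γ₂ * d : ℝ) : ℂ)
      + ((2 * ((p.α₂ + p.β₂) * X - (p.α₂ - p.β₂) * Y) : ℝ) : ℂ) * Complex.I := by
  simp only [pairSum, hγ]
  simp only [centred, Complex.real_smul, Matrix.cons_val]
  simp only [hA', hD']
  simp only [hA, hD]
  apply Complex.ext <;> simp
  · ring
  · ring

theorem pairSum_centred_mul (hγ : p.γ₁ = 0) (hA : A = c + X * Complex.I) (hA' : A⁻¹ = c - X * Complex.I)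
    (hD : D = d + Y * Complex.I) (hD' : D⁻¹ = d - Y * Complex.I)
    (hY : Y ^ 2 + d ^ 2 = 1) :
    p.pairSum (fun i j => centred A D i * centred A D j) =
      ((2 * (p.α₁ + p.β₁) * c * d + 2 * (p.α₁ - p.β₁) * X * Y + p.γ₂ : ℝ) : ℂ)
      + ((2 * ((p.α₂ + p.β₂) * X * d - (p.α₂ - p.β₂) * Y * c) : ℝ) : ℂ) * Complex.I := by
  simp only [pairSum, hγ]
  simp only [centred, Complex.real_smul, Matrix.cons_val]
  simp only [hA', hD']
  simp only [hA, hD]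
  apply Complex.ext <;> simp
  · linear_combination p.γ₂ * hY
  · ring

theorem pairSum_sq_ratio (hγ : p.γ₁ = 0) (hA : A = c + X * Complex.I) (hA' : A⁻¹ = c - X * Complex.I)
    (hD : D = d + Y * Complex.I) (hD' : D⁻¹ = d - Y * Complex.I) :
    p.pairSum (fun i j => centred A D i ^ 2 * (centred A D j)⁻¹ + centred A D j ^ 2 * (centred A D i)⁻¹) =
      ((2 * (p.α₁ + p.β₁) * ((c ^ 2 - X ^ 2) * d + (d ^ 2 - Y ^ 2) * c)
        - 4 * (p.α₁ - p.β₁) * X * Y * (c + d) + 2 * p.γ₂ * d * (d ^ 2 - 3 * Y ^ 2) : ℝ) : ℂ)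
      + ((2 * (p.α₂ + p.β₂) * X * (2 * c * d - (d ^ 2 - Y ^ 2))
        - 2 * (p.α₂ - p.β₂) * Y * (2 * c * d - (c ^ 2 - X ^ 2)) : ℝ) : ℂ) * Complex.I := by
  simp only [pairSum, inv_centred, hγ]
  simp only [centred, Complex.real_smul, Matrix.cons_val, inv_inv]
  simp only [hA', hD']
  simp only [hA, hD]
  apply Complex.ext <;> simp [sq]
  · ring
  · ring

theorem im_tripleSum (hA : A = c + X * Complex.I) (hA' : A⁻¹ = c - X * Complex.I)
    (hD : D = d + Y * Complex.I) (hD' : D⁻¹ = d - Y * Complex.I)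
    (hX : X ^ 2 + c ^ 2 = 1) (hY : Y ^ 2 + d ^ 2 = 1) :
    (p.tripleSum fun i j k => centred A D i * centred A D j * (centred A D k)⁻¹
      + centred A D i * centred A D k * (centred A D j)⁻¹ + centred A D j * centred A D k * (centred A D i)⁻¹).im =
      (p.ξ₁ - p.ξ₂ - p.ξ₃ + p.ξ₄) * X * (1 - 2 * (d ^ 2 - Y ^ 2))
        + (p.ξ₁ - p.ξ₂ + p.ξ₃ - p.ξ₄) * Y * (2 * (c ^ 2 - X ^ 2) - 1) := by
  simp only [tripleSum, inv_centred]
  simp only [centred, Complex.real_smul, Matrix.cons_val, inv_inv]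
  simp only [hA', hD']
  simp only [hA, hD]
  simp [sq]
  linear_combination (p.ξ₁ - p.ξ₂ - p.ξ₃ + p.ξ₄) * X * hY - (p.ξ₁ - p.ξ₂ + p.ξ₃ - p.ξ₄) * Y * hX

theorem re_tripleSum_shifts (hA : A = c + X * Complex.I) (hA' : A⁻¹ = c - X * Complex.I)
    (hD : D = d + Y * Complex.I) (hD' : D⁻¹ = d - Y * Complex.I)
    (hX : X ^ 2 + c ^ 2 = 1) (hY : Y ^ 2 + d ^ 2 = 1) :
    (p.tripleSum fun i j k => centred A D i * centred A D j * (centred A D k)⁻¹ * shifts s t k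
      + centred A D i * centred A D k * (centred A D j)⁻¹ * shifts s t j + centred A D j * centred A D k * (centred A D i)⁻¹ * shifts s t i).re =
      -(p.ξ₁ - p.ξ₂ - p.ξ₃ + p.ξ₄) * (4 * t * d * X * Y + s * c) + (p.ξ₁ - p.ξ₂ + p.ξ₃ - p.ξ₄) * (4 * s * c * X * Y + t * d) := by
  simp only [tripleSum, inv_centred]
  simp only [centred, shifts, Complex.real_smul, Matrix.cons_val, inv_inv]
  simp only [hA', hD']
  simp only [hA, hD]
  simp
  linear_combination -(p.ξ₁ - p.ξ₂ - p.ξ₃ + p.ξ₄) * s * c * hY + (p.ξ₁ - p.ξ₂ + p.ξ₃ - p.ξ₄) * t * d * hX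

theorem pairSum_ratio_mul_shifts (hγ : p.γ₁ = 0) (hA : A = c + X * Complex.I) (hA' : A⁻¹ = c - X * Complex.I)
    (hD : D = d + Y * Complex.I) (hD' : D⁻¹ = d - Y * Complex.I) :
    p.pairSum (fun i j => centred A D i * (centred A D j)⁻¹ * shifts s t j + centred A D j * (centred A D i)⁻¹ * shifts s t i) =
      ((2 * s * ((p.α₂ + p.β₂) * c * d - (p.α₂ - p.β₂) * X * Y)
        + 2 * t * ((p.α₂ + p.β₂) * X * Y - (p.α₂ - p.β₂) * c * d) : ℝ) : ℂ)
      + ((X * d * (-2 * (p.α₁ + p.β₁) * s - 2 * (p.α₁ - p.β₁) * t)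
        + c * Y * (-2 * (p.α₁ - p.β₁) * s - 2 * (p.α₁ + p.β₁) * t) - 4 * p.γ₂ * t * Y * d : ℝ) : ℂ) * Complex.I := by
  simp only [pairSum, inv_centred, hγ]
  simp only [centred, shifts, Complex.real_smul, Matrix.cons_val, inv_inv]
  simp only [hA', hD']
  simp only [hA, hD]
  apply Complex.ext <;> simp
  · ring
  · ring

theorem pairSum_mul_shifts (hγ : p.γ₁ = 0) (hA : A = c + X * Complex.I) (hA' : A⁻¹ = c - X * Complex.I)
    (hD : D = d + Y * Complex.I) (hD' : D⁻¹ = d - Y * Complex.I) :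
    p.pairSum (fun i j => centred A D i * shifts s t j + centred A D j * shifts s t i) =
      ((2 * ((p.α₂ + p.β₂) * s * d - (p.α₂ - p.β₂) * t * c) : ℝ) : ℂ)
      + ((-2 * (p.α₁ - p.β₁) * (t * X + s * Y) - 2 * p.γ₂ * t * Y : ℝ) : ℂ) * Complex.I := by
  simp only [pairSum, hγ]
  simp only [centred, shifts, Complex.real_smul, Matrix.cons_val]
  simp only [hA', hD']
  simp only [hA, hD]
  apply Complex.ext <;> simp
  · ring
  · ring

theorem pairSum_sq_ratio_mul_shifts (hγ : p.γ₁ = 0) (hA : A = c + X * Complex.I) (hA' : A⁻¹ = c - X * Complex.I)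
    (hD : D = d + Y * Complex.I) (hD' : D⁻¹ = d - Y * Complex.I) :
    p.pairSum (fun i j => centred A D i ^ 2 * (centred A D j)⁻¹ * shifts s t j
      + centred A D j ^ 2 * (centred A D i)⁻¹ * shifts s t i) =
      ((2 * s * ((p.α₂ + p.β₂) * c * (d ^ 2 - Y ^ 2) - 2 * (p.α₂ - p.β₂) * d * X * Y)
        + 2 * t * (-(p.α₂ - p.β₂) * d * (c ^ 2 - X ^ 2) + 2 * (p.α₂ + p.β₂) * c * X * Y) : ℝ) : ℂ)
      + ((-2 * t * (2 * (p.α₁ - p.β₁) * X * c * d + (p.α₁ + p.β₁) * (c ^ 2 - X ^ 2) * Y)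
        - 2 * s * (2 * (p.α₁ - p.β₁) * Y * c * d + (p.α₁ + p.β₁) * (d ^ 2 - Y ^ 2) * X)
        - 2 * p.γ₂ * t * Y * (3 * d ^ 2 - Y ^ 2) : ℝ) : ℂ) * Complex.I := by
  simp only [pairSum, inv_centred, hγ]
  simp only [centred, shifts, Complex.real_smul, Matrix.cons_val, inv_inv]
  simp only [hA', hD']
  simp only [hA, hD]
  apply Complex.ext <;> simp [sq]
  · ring
  · ring

end sums

theorem linSum_one (p : QCoeffs) :
    p.linSum (fun _ => (1 : ℂ)) = ((2 * (p.a₁ + p.a₂) : ℝ) : ℂ) := by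
  simp only [linSum, Complex.real_smul]
  push_cast
  ring

section elimination

variable {l n W r q e₁ e₂ g₁ g₂ m₁ m₂ : ℝ} {μ ν σ w : ℂ}

/-- Multiplying by `l n` clears the denominators of `μ` and `ν`. For real `r` the term `(iW)(-ir)`
is real, so the imaginary part is free of the unknown `r`. -/
theorem im_eq_zero_of_cubic (h1 : (l : ℂ) * μ + q = 0)
    (h2 : ((-(l * n) : ℝ) : ℂ) * ν + (g₁ + g₂ * Complex.I) = 0)
    (h3 : Complex.I * W * (-Complex.I * r) + (μ * (e₁ + e₂ * Complex.I)
      + ν * (m₁ + m₂ * Complex.I) + w) = 0) :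
    n * q * e₂ - (g₁ * m₂ + g₂ * m₁) - l * n * w.im = 0 := by
  have key : ((-(l * n * W * r) : ℝ) : ℂ) + ((n * q : ℝ) : ℂ) * (e₁ + e₂ * Complex.I)
      - (g₁ + g₂ * Complex.I) * (m₁ + m₂ * Complex.I) - ((l * n : ℝ) : ℂ) * w = 0 := by
    push_cast at h2 ⊢
    linear_combination (-l * n) * h3 + n * (e₁ + e₂ * Complex.I) * h1
      - (m₁ + m₂ * Complex.I) * h2 - l * n * W * r * Complex.I_sq
  have := congrArg Complex.im key
  simp only [Complex.sub_im, Complex.add_im, Complex.mul_im, Complex.mul_re, Complex.add_re,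
    Complex.ofReal_re, Complex.ofReal_im, Complex.I_re, Complex.I_im, Complex.zero_im] at this
  linear_combination this

/-- Here the terms with the real unknowns `b` and `r` are purely imaginary, so the real part is a
condition on the coefficients alone. The factor `0` beside `μ` is the sum of the centred shifts. -/
theorem re_eq_zero_of_cubic {b G f₁ f₂ s₁ s₂ : ℝ} (h1 : (l : ℂ) * μ + q = 0)
    (h2 : ((-(l * n) : ℝ) : ℂ) * ν + (g₁ + g₂ * Complex.I) = 0)
    (h3 : (l : ℂ) * σ + (μ * 0 + (s₁ + s₂ * Complex.I)) = 0)
    (h4 : Complex.I * W * b + G * (-Complex.I * r) + (μ * (f₁ + f₂ * Complex.I)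
      + σ * (e₁ + e₂ * Complex.I) + ν * (m₁ + m₂ * Complex.I) + w) = 0) :
    n * (q * f₁ + (s₁ * e₁ - s₂ * e₂)) - (g₁ * m₁ - g₂ * m₂) - l * n * w.re = 0 := by
  have key : ((-(l * n * (W * b - G * r)) : ℝ) : ℂ) * Complex.I
      + ((n * q : ℝ) : ℂ) * (f₁ + f₂ * Complex.I)
      + (n : ℂ) * ((s₁ + s₂ * Complex.I) * (e₁ + e₂ * Complex.I))
      - (g₁ + g₂ * Complex.I) * (m₁ + m₂ * Complex.I) - ((l * n : ℝ) : ℂ) * w = 0 := by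
    push_cast at h2 ⊢
    linear_combination (-l * n) * h4 + n * (f₁ + f₂ * Complex.I) * h1
      + n * (e₁ + e₂ * Complex.I) * h3 - (m₁ + m₂ * Complex.I) * h2
  have := congrArg Complex.re key
  simp only [Complex.sub_re, Complex.add_im, Complex.mul_im, Complex.mul_re, Complex.add_re,
    Complex.ofReal_re, Complex.ofReal_im, Complex.I_re, Complex.I_im, Complex.zero_re] at this
  linear_combination this

end elimination

section carrier

variable {p : QCoeffs} {φ ψ : ℝ}

/-- On the dispersion curve `a₁c² + a₂d² = -(a₁ + a₂)cd`, with `c`, `d` the two cosines; this makes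
the second symbol a multiple of the zeroth. -/
theorem IsCarrier.linSum_sq_eq (hc : p.IsCarrier (φ + ψ) (ψ - φ)) :
    p.linSum (fun c => centred (phase φ) (phase ψ) c ^ 2) =
      ((-(2 * (p.a₁ + p.a₂) * (2 * Real.cos φ * Real.cos ψ + 1)) : ℝ) : ℂ) := by
  have h : p.linSum (fun c => centred (phase φ) (phase ψ) c ^ 2) =
      ((2 * (p.a₁ * (Real.cos φ ^ 2 - Real.sin φ ^ 2)
        + p.a₂ * (Real.cos ψ ^ 2 - Real.sin ψ ^ 2)) : ℝ) : ℂ) := by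
    simp only [linSum, centred, Complex.real_smul, Matrix.cons_val, inv_phase_eq]
    simp only [phase_eq]
    push_cast
    linear_combination (2 * p.a₁ * (Complex.sin φ) ^ 2 + 2 * p.a₂ * (Complex.sin ψ) ^ 2)
      * Complex.I_sq
  rw [h, Complex.ofReal_inj]
  linear_combination (4 * Real.cos φ + 4 * Real.cos ψ) * hc.cos_eq
    - 2 * p.a₁ * Real.sin_sq_add_cos_sq φ - 2 * p.a₂ * Real.sin_sq_add_cos_sq ψ

theorem linSum_centred_mul_half_shifts (p : QCoeffs) (φ ψ : ℝ) :
    p.linSum (fun c => centred (phase φ) (phase ψ) c * shifts (1 / 2) (-1 / 2) c) =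
      Complex.I * ((p.a₁ * Real.sin φ - p.a₂ * Real.sin ψ : ℝ) : ℂ) := by
  rw [linSum_centred_mul_shifts]
  push_cast
  ring

theorem IsCarrier.cubicIm_eq_zero (hγ : p.γ₁ = 0) (hc : p.IsCarrier (φ + ψ) (ψ - φ))
    {s : Fin 4 → ℂ} {ρ₁ ρ₂ B a b μ ν σ σ' τ : ℂ}
    (H : p.ReducedEqs (centred (phase φ) (phase ψ)) s (shifts (1 / 2) (-1 / 2)) ρ₁ ρ₂ B a b
      μ ν σ σ' τ) (hρ₂ : ρ₂.im = 0) :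
    p.cubicIm (Real.cos φ) (Real.cos ψ) (Real.sin φ) (Real.sin ψ) = 0 := by
  have hX := Real.sin_sq_add_cos_sq φ
  have hY := Real.sin_sq_add_cos_sq ψ
  have h1 := H.eq_μ
  have h2 := H.eq_ν
  have h3 := H.cubic
  obtain ⟨r, rfl⟩ : ∃ r : ℝ, ρ₂ = r := ⟨ρ₂.re, Complex.ext rfl hρ₂⟩
  have hL₀ := p.linSum_one
  set z := centred (phase φ) (phase ψ) with hz
  have hN : p.cubicCoeff z μ ν = μ * p.pairSum (fun i j => z i + z j)
      + ν * p.pairSum (fun i j => z i ^ 2 * (z j)⁻¹ + z j ^ 2 * (z i)⁻¹)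
      + p.tripleSum fun i j k =>
        z i * z j * (z k)⁻¹ + z i * z k * (z j)⁻¹ + z j * z k * (z i)⁻¹ := by
    simp only [cubicCoeff, pairSum, Complex.real_smul]
    ring
  have i1 := p.pairSum_ratio hγ (phase_eq φ) (inv_phase_eq φ) (phase_eq ψ) (inv_phase_eq ψ)
  have i2 := p.pairSum_centred_add hγ (phase_eq φ) (inv_phase_eq φ) (phase_eq ψ) (inv_phase_eq ψ)
  have i3 := p.pairSum_centred_mul hγ (phase_eq φ) (inv_phase_eq φ) (phase_eq ψ) (inv_phase_eq ψ)
    hY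
  have i4 := p.pairSum_sq_ratio hγ (phase_eq φ) (inv_phase_eq φ) (phase_eq ψ) (inv_phase_eq ψ)
  have i5 := p.im_tripleSum (phase_eq φ) (inv_phase_eq φ) (phase_eq ψ) (inv_phase_eq ψ) hX hY
  rw [← hz] at i1 i2 i3 i4 i5
  rw [hL₀, i1] at h1
  rw [hc.linSum_sq_eq, i3] at h2
  rw [linSum_centred_mul_half_shifts, hN, i2, i4] at h3
  have key := im_eq_zero_of_cubic h1 h2 h3
  rw [i5] at key
  unfold cubicIm
  linear_combination key

theorem IsCarrier.conjDerivRe_eq_zero (hγ : p.γ₁ = 0) (hc : p.IsCarrier (φ + ψ) (ψ - φ))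
    {s t : ℝ} {ρ₁ ρ₂ B a b μ ν σ σ' τ : ℂ}
    (H : p.ReducedEqs (centred (phase φ) (phase ψ)) (shifts s t) (shifts (1 / 2) (-1 / 2))
      ρ₁ ρ₂ B a b μ ν σ σ' τ) (hρ₂ : ρ₂.im = 0) (hb : b.im = 0) :
    p.conjDerivRe (Real.cos φ) (Real.cos ψ) (Real.sin φ) (Real.sin ψ) s t = 0 := by
  have hX := Real.sin_sq_add_cos_sq φ
  have hY := Real.sin_sq_add_cos_sq ψ
  have h1 := H.eq_μ
  have h2 := H.eq_ν
  have h3 := H.eq_σ'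
  have h4 := H.conjDeriv
  obtain ⟨r, rfl⟩ : ∃ r : ℝ, ρ₂ = r := ⟨ρ₂.re, Complex.ext rfl hρ₂⟩
  obtain ⟨b, rfl⟩ : ∃ r : ℝ, b = r := ⟨b.re, Complex.ext rfl hb⟩
  have hL₀ := p.linSum_one
  have hs : p.linSum (shifts s t) = 0 := by simp [linSum, shifts]
  have hG : p.linSum (fun c => centred (phase φ) (phase ψ) c
      * (shifts s t c * shifts (1 / 2) (-1 / 2) c)) =
      ((p.a₁ * Real.cos φ * s - p.a₂ * Real.cos ψ * t : ℝ) : ℂ) := by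
    rw [linSum_centred_mul_sq]
    push_cast
    ring
  set z := centred (phase φ) (phase ψ) with hz
  have hR : p.cubicCoeffConjDeriv z (shifts s t) μ ν σ' =
      μ * p.pairSum (fun i j => z i * shifts s t j + z j * shifts s t i)
      + σ' * p.pairSum (fun i j => z i + z j)
      + ν * p.pairSum (fun i j => z i ^ 2 * (z j)⁻¹ * shifts s t j
          + z j ^ 2 * (z i)⁻¹ * shifts s t i)
      + p.tripleSum fun i j k => z i * z j * (z k)⁻¹ * shifts s t k
        + z i * z k * (z j)⁻¹ * shifts s t j + z j * z k * (z i)⁻¹ * shifts s t i := by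
    simp only [cubicCoeffConjDeriv, pairSum, Complex.real_smul]
    ring
  have i1 := p.pairSum_ratio hγ (phase_eq φ) (inv_phase_eq φ) (phase_eq ψ) (inv_phase_eq ψ)
  have i2 := p.pairSum_centred_add hγ (phase_eq φ) (inv_phase_eq φ) (phase_eq ψ) (inv_phase_eq ψ)
  have i3 := p.pairSum_centred_mul hγ (phase_eq φ) (inv_phase_eq φ) (phase_eq ψ) (inv_phase_eq ψ)
    hY
  have i4 := p.pairSum_sq_ratio_mul_shifts s t hγ (phase_eq φ) (inv_phase_eq φ) (phase_eq ψ)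
    (inv_phase_eq ψ)
  have i5 := p.re_tripleSum_shifts s t (phase_eq φ) (inv_phase_eq φ) (phase_eq ψ)
    (inv_phase_eq ψ) hX hY
  have i6 := p.pairSum_ratio_mul_shifts s t hγ (phase_eq φ) (inv_phase_eq φ) (phase_eq ψ)
    (inv_phase_eq ψ)
  have i7 := p.pairSum_mul_shifts s t hγ (phase_eq φ) (inv_phase_eq φ) (phase_eq ψ)
    (inv_phase_eq ψ)
  rw [← hz] at i1 i2 i3 i4 i5 i6 i7
  rw [hL₀, i1] at h1
  rw [hc.linSum_sq_eq, i3] at h2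
  rw [hL₀, hs, i6] at h3
  rw [linSum_centred_mul_half_shifts, hG, hR, i2, i4, i7] at h4
  have key := re_eq_zero_of_cubic h1 h2 h3 h4
  rw [i5] at key
  unfold conjDerivRe
  linear_combination key

end carrier

end QCoeffs

/-! ### The conditions along the dispersion curve -/

namespace QCoeffs

/-- The pair `c = a₂x`, `d = -a₁x` solves the dispersion relation. Reducing squares of the sines
leaves an expression linear in `X` and `Y` with even polynomials in `x` as coefficients. -/
theorem cubicIm_eq (p : QCoeffs) {S H U V F K : ℝ} (hS : p.α₁ + p.β₁ = S) (hH : p.α₁ - p.β₁ = H)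
    (hU : p.α₂ - p.β₂ = U) (hV : p.α₂ + p.β₂ = V) (hF : p.ξ₁ - p.ξ₂ - p.ξ₃ + p.ξ₄ = F)
    (hK : p.ξ₁ - p.ξ₂ + p.ξ₃ - p.ξ₄ = K) {x X Y : ℝ} (hX : X ^ 2 + (p.a₂ * x) ^ 2 = 1)
    (hY : Y ^ 2 + (p.a₁ * x) ^ 2 = 1) :
    p.cubicIm (p.a₂ * x) (-(p.a₁ * x)) X Y =
      X * ((-6 * p.a₁ * F - 6 * p.a₂ * F + 12 * H * U - 6 * V * p.γ₂) + (8 * p.a₁ ^ 3 * F + 20 *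
      p.a₁ ^ 2 * p.a₂ * F + 4 * p.a₁ ^ 2 * S * V - 12 * p.a₁ ^ 2 * H * U + 24 * p.a₁ ^ 2 * V *
      p.γ₂ + 12 * p.a₁ * p.a₂ ^ 2 * F - 8 * p.a₁ * p.a₂ * S * V - 16 * p.a₁ * p.a₂ * H * U + 12
      * p.a₁ * p.a₂ * V * p.γ₂ - 16 * p.a₂ ^ 2 * H * U) * x ^ 2 + (-16 * p.a₁ ^ 4 * p.a₂ * F -
      16 * p.a₁ ^ 4 * V * p.γ₂ - 16 * p.a₁ ^ 3 * p.a₂ ^ 2 * F + 16 * p.a₁ ^ 3 * p.a₂ * H * U -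
      16 * p.a₁ ^ 3 * p.a₂ * V * p.γ₂ + 16 * p.a₁ ^ 2 * p.a₂ ^ 2 * H * U) * x ^ 4) + Y * ((6 *
      p.a₁ * K + 6 * p.a₂ * K - 12 * H * V + 6 * U * p.γ₂) + (-12 * p.a₁ ^ 2 * p.a₂ * K + 16 *
      p.a₁ ^ 2 * H * V - 8 * p.a₁ ^ 2 * U * p.γ₂ - 20 * p.a₁ * p.a₂ ^ 2 * K + 8 * p.a₁ * p.a₂ *
      S * U + 16 * p.a₁ * p.a₂ * H * V - 8 * p.a₂ ^ 3 * K - 4 * p.a₂ ^ 2 * S * U + 12 * p.a₂ ^ 2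
      * H * V - 4 * p.a₂ ^ 2 * U * p.γ₂) * x ^ 2 + (16 * p.a₁ ^ 2 * p.a₂ ^ 3 * K - 16 * p.a₁ ^ 2
      * p.a₂ ^ 2 * H * V + 16 * p.a₁ * p.a₂ ^ 4 * K - 16 * p.a₁ * p.a₂ ^ 3 * H * V) * x ^ 4) := by
  simp only [cubicIm, hS, hH, hU, hV, hF, hK]
  linear_combination
    (-8 * p.a₁ ^ 2 * p.a₂ * x ^ 2 * Y * K + 4 * p.a₁ ^ 2 * x ^ 2 * X * S * V + 12 * p.a₁ ^ 2 * x
    ^ 2 * Y * H * V - 8 * p.a₁ * p.a₂ ^ 2 * x ^ 2 * Y * K + 16 * p.a₁ * p.a₂ * x ^ 2 * Y * H * V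
    + 4 * p.a₁ * Y * K + 4 * p.a₂ * Y * K + 4 * X * Y ^ 2 * H * U - 4 * Y ^ 3 * H * V - 8 * Y *
    H * V + 2 * Y * U * p.γ₂) * hX + (8 * p.a₁ ^ 2 * p.a₂ * x ^ 2 * X * F + 12 * p.a₁ ^ 2 * x ^
    2 * X * V * p.γ₂ + 8 * p.a₁ * p.a₂ ^ 2 * x ^ 2 * X * F - 16 * p.a₁ * p.a₂ * x ^ 2 * X * H *
    U + 8 * p.a₁ * p.a₂ * x ^ 2 * X * V * p.γ₂ + 4 * p.a₁ * p.a₂ * x ^ 2 * Y * U * p.γ₂ - 4 *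
    p.a₁ * X * F - 16 * p.a₂ ^ 2 * x ^ 2 * X * H * U - 4 * p.a₂ ^ 2 * x ^ 2 * Y * S * U + 4 *
    p.a₂ ^ 2 * x ^ 2 * Y * H * V - 4 * p.a₂ * X * F + 12 * X * H * U - 6 * X * V * p.γ₂ - 4 * Y
    * H * V + 4 * Y * U * p.γ₂) * hY

/-- The slow shifts `(a₂Y, -a₁X)` are proportional to those fixed by the group velocity equation
`a₁Xs + a₂Yt = 0`. -/
theorem conjDerivRe_eq (p : QCoeffs) {S H U V F K : ℝ} (hS : p.α₁ + p.β₁ = S) (hH : p.α₁ - p.β₁ = H)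
    (hU : p.α₂ - p.β₂ = U) (hV : p.α₂ + p.β₂ = V) (hF : p.ξ₁ - p.ξ₂ - p.ξ₃ + p.ξ₄ = F)
    (hK : p.ξ₁ - p.ξ₂ + p.ξ₃ - p.ξ₄ = K) {x X Y : ℝ} (hX : X ^ 2 + (p.a₂ * x) ^ 2 = 1)
    (hY : Y ^ 2 + (p.a₁ * x) ^ 2 = 1) :
    p.conjDerivRe (p.a₂ * x) (-(p.a₁ * x)) X Y (p.a₂ * Y) (-(p.a₁ * X)) =
      x * (X * ((-2 * p.a₁ ^ 3 * K - 2 * p.a₁ ^ 2 * p.a₂ * K + 4 * p.a₁ ^ 2 * H * V - 10 * p.a₁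
      ^ 2 * U * p.γ₂ - 8 * p.a₁ * p.a₂ ^ 2 * K + 16 * p.a₁ * p.a₂ * S * U + 16 * p.a₁ * p.a₂ * H
      * V - 8 * p.a₂ ^ 3 * K - 8 * p.a₂ ^ 2 * S * U + 8 * p.a₂ ^ 2 * H * V) + (4 * p.a₁ ^ 4 *
      p.a₂ * K + 8 * p.a₁ ^ 4 * U * p.γ₂ + 12 * p.a₁ ^ 3 * p.a₂ ^ 2 * K - 8 * p.a₁ ^ 3 * p.a₂ *
      S * U - 16 * p.a₁ ^ 3 * p.a₂ * H * V + 8 * p.a₁ ^ 3 * p.a₂ * U * p.γ₂ + 24 * p.a₁ ^ 2 *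
      p.a₂ ^ 3 * K - 12 * p.a₁ ^ 2 * p.a₂ ^ 2 * S * U - 44 * p.a₁ ^ 2 * p.a₂ ^ 2 * H * V + 4 *
      p.a₁ ^ 2 * p.a₂ ^ 2 * U * p.γ₂ + 16 * p.a₁ * p.a₂ ^ 4 * K - 16 * p.a₁ * p.a₂ ^ 3 * H * V)
      * x ^ 2 + (-16 * p.a₁ ^ 4 * p.a₂ ^ 3 * K + 32 * p.a₁ ^ 4 * p.a₂ ^ 2 * H * V - 16 * p.a₁ ^
      4 * p.a₂ ^ 2 * U * p.γ₂ - 16 * p.a₁ ^ 3 * p.a₂ ^ 4 * K + 16 * p.a₁ ^ 3 * p.a₂ ^ 3 * S * U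
      + 16 * p.a₁ ^ 3 * p.a₂ ^ 3 * H * V) * x ^ 4) + Y * ((8 * p.a₁ ^ 3 * F + 8 * p.a₁ ^ 2 *
      p.a₂ * F + 8 * p.a₁ ^ 2 * S * V - 8 * p.a₁ ^ 2 * H * U + 16 * p.a₁ ^ 2 * V * p.γ₂ + 2 *
      p.a₁ * p.a₂ ^ 2 * F - 16 * p.a₁ * p.a₂ * S * V - 16 * p.a₁ * p.a₂ * H * U + 8 * p.a₁ *
      p.a₂ * V * p.γ₂ + 2 * p.a₂ ^ 3 * F - 4 * p.a₂ ^ 2 * H * U + 2 * p.a₂ ^ 2 * V * p.γ₂) +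
      (-16 * p.a₁ ^ 4 * p.a₂ * F - 16 * p.a₁ ^ 4 * V * p.γ₂ - 24 * p.a₁ ^ 3 * p.a₂ ^ 2 * F + 16
      * p.a₁ ^ 3 * p.a₂ * H * U - 32 * p.a₁ ^ 3 * p.a₂ * V * p.γ₂ - 12 * p.a₁ ^ 2 * p.a₂ ^ 3 * F
      + 12 * p.a₁ ^ 2 * p.a₂ ^ 2 * S * V + 44 * p.a₁ ^ 2 * p.a₂ ^ 2 * H * U - 24 * p.a₁ ^ 2 *
      p.a₂ ^ 2 * V * p.γ₂ - 4 * p.a₁ * p.a₂ ^ 4 * F + 8 * p.a₁ * p.a₂ ^ 3 * S * V + 16 * p.a₁ *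
      p.a₂ ^ 3 * H * U - 4 * p.a₁ * p.a₂ ^ 3 * V * p.γ₂) * x ^ 2 + (16 * p.a₁ ^ 4 * p.a₂ ^ 3 * F
      + 32 * p.a₁ ^ 4 * p.a₂ ^ 2 * V * p.γ₂ + 16 * p.a₁ ^ 3 * p.a₂ ^ 4 * F - 16 * p.a₁ ^ 3 *
      p.a₂ ^ 3 * S * V - 16 * p.a₁ ^ 3 * p.a₂ ^ 3 * H * U + 16 * p.a₁ ^ 3 * p.a₂ ^ 3 * V * p.γ₂
      - 32 * p.a₁ ^ 2 * p.a₂ ^ 4 * H * U) * x ^ 4)) := by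
  simp only [conjDerivRe, hS, hH, hU, hV, hF, hK]
  linear_combination
    (-16 * p.a₁ ^ 4 * p.a₂ * x ^ 3 * Y * F - 12 * p.a₁ ^ 4 * x ^ 3 * Y * V * p.γ₂ - 16 * p.a₁ ^
    3 * p.a₂ ^ 2 * x ^ 3 * Y * F + 4 * p.a₁ ^ 3 * p.a₂ * x ^ 3 * X * S * U - 4 * p.a₁ ^ 3 * p.a₂
    * x ^ 3 * Y * S * V + 8 * p.a₁ ^ 3 * p.a₂ * x ^ 3 * Y * H * U - 24 * p.a₁ ^ 3 * p.a₂ * x ^ 3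
    * Y * V * p.γ₂ + 8 * p.a₁ ^ 3 * x * Y * F + 8 * p.a₁ ^ 2 * p.a₂ ^ 2 * x ^ 3 * Y * S * V + 32
    * p.a₁ ^ 2 * p.a₂ ^ 2 * x ^ 3 * Y * H * U + 8 * p.a₁ ^ 2 * p.a₂ * x * Y * F + 4 * p.a₁ ^ 2 *
    x * X ^ 2 * Y * S * V - 4 * p.a₁ ^ 2 * x * X ^ 2 * Y * H * U + 4 * p.a₁ ^ 2 * x * X * H * V
    - 2 * p.a₁ ^ 2 * x * X * U * p.γ₂ + 4 * p.a₁ ^ 2 * x * Y ^ 3 * V * p.γ₂ + 8 * p.a₁ ^ 2 * x *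
    Y * S * V - 8 * p.a₁ ^ 2 * x * Y * H * U + 12 * p.a₁ ^ 2 * x * Y * V * p.γ₂ + 4 * p.a₁ *
    p.a₂ * x * X * Y ^ 2 * S * U + 8 * p.a₁ * p.a₂ * x * X * Y ^ 2 * H * V - 4 * p.a₁ * p.a₂ * x
    * Y ^ 3 * S * V - 8 * p.a₁ * p.a₂ * x * Y ^ 3 * H * U - 12 * p.a₁ * p.a₂ * x * Y * S * V - 8
    * p.a₁ * p.a₂ * x * Y * H * U + 4 * p.a₁ * p.a₂ * x * Y * V * p.γ₂) * hX + (16 * p.a₁ ^ 2 *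
    p.a₂ ^ 3 * x ^ 3 * X * K - 8 * p.a₁ ^ 2 * p.a₂ ^ 2 * x ^ 3 * X * S * U - 32 * p.a₁ ^ 2 *
    p.a₂ ^ 2 * x ^ 3 * X * H * V - 12 * p.a₁ ^ 2 * p.a₂ ^ 2 * x ^ 3 * Y * V * p.γ₂ - 8 * p.a₁ ^
    2 * x * X * U * p.γ₂ + 4 * p.a₁ ^ 2 * x * Y * V * p.γ₂ + 16 * p.a₁ * p.a₂ ^ 4 * x ^ 3 * X *
    K - 16 * p.a₁ * p.a₂ ^ 3 * x ^ 3 * X * H * V + 8 * p.a₁ * p.a₂ ^ 3 * x ^ 3 * Y * H * U - 8 *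
    p.a₁ * p.a₂ ^ 2 * x * X * K + 4 * p.a₁ * p.a₂ * x * X * Y ^ 2 * U * p.γ₂ + 16 * p.a₁ * p.a₂
    * x * X * S * U + 16 * p.a₁ * p.a₂ * x * X * H * V - 4 * p.a₁ * p.a₂ * x * Y * S * V - 8 *
    p.a₁ * p.a₂ * x * Y * H * U + 4 * p.a₁ * p.a₂ * x * Y * V * p.γ₂ - 8 * p.a₂ ^ 3 * x * X * K
    - 4 * p.a₂ ^ 2 * x * X * Y ^ 2 * S * U + 4 * p.a₂ ^ 2 * x * X * Y ^ 2 * H * V - 8 * p.a₂ ^ 2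
    * x * X * S * U + 8 * p.a₂ ^ 2 * x * X * H * V - 4 * p.a₂ ^ 2 * x * Y * H * U + 2 * p.a₂ ^ 2
    * x * Y * V * p.γ₂) * hY

end QCoeffs

/-! ### Necessity: small carriers and the final linear algebra -/

namespace QCoeffs

open Filter Topology

theorem phase_pow (φ : ℝ) (k : ℕ) : phase φ ^ k = phase (k * φ) := by
  rw [phase, phase, ← Complex.exp_nat_mul]
  congr 1
  push_cast
  ring

theorem linSymbol_eq_cos (p : QCoeffs) (φ ψ : ℝ) (k : ℕ) :
    p.linSymbol (φ + ψ) (ψ - φ) k =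
      phase φ ^ k * ((2 * (p.a₁ * Real.cos (k * φ) + p.a₂ * Real.cos (k * ψ)) : ℝ) : ℂ) := by
  have e : (fun c => centred (phase φ) (phase ψ) c ^ k) =
      centred (phase (k * φ)) (phase (k * ψ)) := by
    funext c
    fin_cases c <;> simp [centred, phase_pow]
  rw [linSymbol_eq, e, linSum_centred_phase]
  push_cast
  ring

/-- As `x → 0` the second and fourth symbols tend to nonzero multiples of `a₁ + a₂`. The third is a
nonzero multiple of `a₁a₂(a₂² - a₁²)x³`, and `sin κ` also has a factor `x`, so zero itself must be
excluded. -/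
theorem eventually_isCarrier {p : QCoeffs} (hp : p.IsDispersive) :
    ∀ᶠ x in 𝓝[>] (0 : ℝ), ∀ φ ψ : ℝ, Real.cos φ = p.a₂ * x → Real.cos ψ = -(p.a₁ * x) →
      p.IsCarrier (φ + ψ) (ψ - φ) := by
  have hs := sum_ne_zero_of_abs_ne hp
  have hd : p.a₂ ^ 2 - p.a₁ ^ 2 ≠ 0 := fun h =>
    hp.2.2 (sq_eq_sq_iff_abs_eq_abs _ _ |>.1 (sub_eq_zero.1 h).symm)
  have h2 : ∀ᶠ x in 𝓝[>] (0 : ℝ), 2 * p.a₁ * p.a₂ * x ^ 2 - 1 ≠ 0 := by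
    have : ContinuousAt (fun x : ℝ => 2 * p.a₁ * p.a₂ * x ^ 2 - 1) 0 := by fun_prop
    exact (this.eventually_ne (by norm_num)).filter_mono nhdsWithin_le_nhds
  have h4 : ∀ᶠ x in 𝓝[>] (0 : ℝ), p.a₁ * (8 * (p.a₂ * x) ^ 4 - 8 * (p.a₂ * x) ^ 2 + 1)
      + p.a₂ * (8 * (p.a₁ * x) ^ 4 - 8 * (p.a₁ * x) ^ 2 + 1) ≠ 0 := by
    have : ContinuousAt (fun x : ℝ => p.a₁ * (8 * (p.a₂ * x) ^ 4 - 8 * (p.a₂ * x) ^ 2 + 1)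
      + p.a₂ * (8 * (p.a₁ * x) ^ 4 - 8 * (p.a₁ * x) ^ 2 + 1)) 0 := by fun_prop
    exact (this.eventually_ne (by simpa using hs)).filter_mono nhdsWithin_le_nhds
  filter_upwards [h2, h4, self_mem_nhdsWithin] with x h2 h4 hx φ ψ hφ hψ
  have hx0 : x ≠ 0 := ne_of_gt hx
  have hcos : p.a₁ * Real.cos φ + p.a₂ * Real.cos ψ = 0 := by
    rw [hφ, hψ]
    ring
  have e4 : ∀ θ : ℝ, Real.cos (4 * θ) = 8 * Real.cos θ ^ 4 - 8 * Real.cos θ ^ 2 + 1 := by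
    intro θ
    rw [show 4 * θ = 2 * (2 * θ) by ring, Real.cos_two_mul, Real.cos_two_mul]
    ring
  refine ⟨?_, ?_, fun k hk hk' => ?_⟩
  · rw [linSymbol_eq_cos]
    simp [hcos]
  · have := (sin_ne_zero_of_cos_eq hp hcos).1
    rw [Real.sin_add, hφ, hψ]
    rw [show Real.sin φ * -(p.a₁ * x) + p.a₂ * x * Real.sin ψ =
      -x * (p.a₁ * Real.sin φ - p.a₂ * Real.sin ψ) by ring]
    exact mul_ne_zero (neg_ne_zero.2 hx0) this
  · rw [linSymbol_eq_cos]
    refine mul_ne_zero (pow_ne_zero _ (phase_ne_zero φ)) (Complex.ofReal_ne_zero.2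
      (mul_ne_zero two_ne_zero ?_))
    interval_cases k
    · push_cast
      rw [Real.cos_two_mul, Real.cos_two_mul, hφ, hψ]
      convert mul_ne_zero hs h2 using 1
      ring
    · push_cast
      rw [Real.cos_three_mul, Real.cos_three_mul, hφ, hψ]
      convert mul_ne_zero (mul_ne_zero (mul_ne_zero hp.1 hp.2.1) (pow_ne_zero 3 hx0))
        (mul_ne_zero four_ne_zero hd) using 1
      ring
    · push_cast
      rw [e4, e4, hφ, hψ]
      convert h4 using 1
      ring

theorem exists_angle {c X : ℝ} (h : X ^ 2 + c ^ 2 = 1) : ∃ φ, Real.cos φ = c ∧ Real.sin φ = X := by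
  have hn : ‖(⟨c, X⟩ : ℂ)‖ = 1 := by
    rw [Complex.norm_def, Complex.normSq_mk, Real.sqrt_eq_one]
    linarith
  have h0 : (⟨c, X⟩ : ℂ) ≠ 0 := fun h => by simp [h] at hn
  exact ⟨Complex.arg ⟨c, X⟩, by rw [Complex.cos_arg h0, hn, div_one],
    by rw [Complex.sin_arg, hn, div_one]⟩

theorem conjDerivRe_smul (p : QCoeffs) (c d X Y s t k : ℝ) :
    p.conjDerivRe c d X Y (k * s) (k * t) = k * p.conjDerivRe c d X Y s t := by
  simp only [conjDerivRe]
  ring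

theorem IsA2Integrable.eventually_eq_zero {p : QCoeffs} (hp : p.IsDispersive) (hγ : p.γ₁ = 0)
    (h : p.IsA2Integrable) : ∀ᶠ x in 𝓝[>] (0 : ℝ), ∀ X Y : ℝ, X ^ 2 + (p.a₂ * x) ^ 2 = 1 →
      Y ^ 2 + (p.a₁ * x) ^ 2 = 1 → p.cubicIm (p.a₂ * x) (-(p.a₁ * x)) X Y = 0 ∧
        p.conjDerivRe (p.a₂ * x) (-(p.a₁ * x)) X Y (p.a₂ * Y) (-(p.a₁ * X)) = 0 := by
  filter_upwards [eventually_isCarrier hp] with x hx X Y hX hY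
  rw [← neg_sq (p.a₁ * x)] at hY
  obtain ⟨φ, hc, rfl⟩ := exists_angle hX
  obtain ⟨ψ, hd, rfl⟩ := exists_angle hY
  have hcar := hx φ ψ hc hd
  rw [← hc, ← hd]
  obtain ⟨v, ρ₁, ρ₂, B, a, b, hred, hρ₂, -, hb⟩ := h _ _ hcar
  obtain ⟨-, μ, ν, σ, σ', τ, H⟩ := (hcar.hasReduction_iff hp).1 hred
  refine ⟨hcar.cubicIm_eq_zero hγ H hρ₂, ?_⟩
  have e : shifts ((1 - v) / 2) ((1 + v) / 2) =
      shifts (((1 - v) / 2 : ℝ) : ℂ) (((1 + v) / 2 : ℝ) : ℂ) := by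
    push_cast
    rfl
  rw [e] at H
  have hv := H.velocity
  rw [linSum_centred_mul_shifts, mul_eq_zero] at hv
  have hv' : p.a₁ * Real.sin φ * ((1 - v) / 2) + p.a₂ * Real.sin ψ * ((1 + v) / 2) = 0 := by
    have := hv.resolve_left (by simp)
    exact_mod_cast this
  have key := hcar.conjDerivRe_eq_zero hγ H hρ₂ hb
  -- The group velocity equation makes the true shifts proportional to `(a₂Y, -a₁X)`, and the
  -- condition is homogeneous in them.
  have e1 : p.a₂ * Real.sin ψ =
      -(p.a₁ * Real.sin φ - p.a₂ * Real.sin ψ) * ((1 - v) / 2) := by linear_combination hv'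
  have e2 : -(p.a₁ * Real.sin φ) =
      -(p.a₁ * Real.sin φ - p.a₂ * Real.sin ψ) * ((1 + v) / 2) := by linear_combination -hv'
  generalize -(p.a₁ * Real.sin φ - p.a₂ * Real.sin ψ) = W at e1 e2
  rw [e2, e1, conjDerivRe_smul, key, mul_zero]

theorem eq_zero_of_eventually {f : ℝ → ℝ} (hf : ContinuousAt f 0)
    (h : ∀ᶠ x in 𝓝[>] (0 : ℝ), f x = 0) : f 0 = 0 :=
  tendsto_nhds_unique (hf.tendsto.mono_left nhdsWithin_le_nhds)
    (tendsto_const_nhds.congr' (h.mono fun _ hx => hx.symm))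

theorem coeffs_eq_zero_of_eventually {c₀ c₁ c₂ : ℝ}
    (h : ∀ᶠ x in 𝓝[>] (0 : ℝ), c₀ + c₁ * x ^ 2 + c₂ * x ^ 4 = 0) : c₀ = 0 ∧ c₁ = 0 ∧ c₂ = 0 := by
  have h0 : c₀ = 0 := by
    simpa using eq_zero_of_eventually (f := fun x => c₀ + c₁ * x ^ 2 + c₂ * x ^ 4)
      (by fun_prop) h
  have h1 : ∀ᶠ x in 𝓝[>] (0 : ℝ), c₁ + c₂ * x ^ 2 = 0 := by
    filter_upwards [h, self_mem_nhdsWithin] with x hx hx0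
    apply mul_left_cancel₀ (pow_ne_zero 2 (ne_of_gt hx0))
    linear_combination hx - h0
  have h1' : c₁ = 0 := by
    simpa using eq_zero_of_eventually (f := fun x => c₁ + c₂ * x ^ 2) (by fun_prop) h1
  refine ⟨h0, h1', ?_⟩
  have h2 : ∀ᶠ x in 𝓝[>] (0 : ℝ), c₂ = 0 := by
    filter_upwards [h1, self_mem_nhdsWithin] with x hx hx0
    apply mul_left_cancel₀ (pow_ne_zero 2 (ne_of_gt hx0))
    linear_combination hx - h1'
  exact h2.exists.choose_spec

/-- Separation of an identity in `X = ±√(1 - a²x²)`, `Y = ±√(1 - b²x²)`. -/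
theorem coeffs_eq_zero_of_forall_sign {a b : ℝ} {c₀ c₁ c₂ d₀ d₁ d₂ : ℝ}
    (h : ∀ᶠ x in 𝓝[>] (0 : ℝ), ∀ X Y : ℝ, X ^ 2 + (a * x) ^ 2 = 1 → Y ^ 2 + (b * x) ^ 2 = 1 →
      X * (c₀ + c₁ * x ^ 2 + c₂ * x ^ 4) + Y * (d₀ + d₁ * x ^ 2 + d₂ * x ^ 4) = 0) :
    (c₀ = 0 ∧ c₁ = 0 ∧ c₂ = 0) ∧ (d₀ = 0 ∧ d₁ = 0 ∧ d₂ = 0) := by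
  have pos : ∀ a : ℝ, ∀ᶠ x in 𝓝[>] (0 : ℝ), 0 < 1 - (a * x) ^ 2 := fun a => by
    have : ContinuousAt (fun x : ℝ => 1 - (a * x) ^ 2) 0 := by fun_prop
    exact (this.eventually (lt_mem_nhds (by norm_num))).filter_mono nhdsWithin_le_nhds
  have key : ∀ᶠ x in 𝓝[>] (0 : ℝ), c₀ + c₁ * x ^ 2 + c₂ * x ^ 4 = 0 ∧
      d₀ + d₁ * x ^ 2 + d₂ * x ^ 4 = 0 := by
    filter_upwards [h, pos a, pos b] with x hx ha hb
    have eX := Real.sq_sqrt ha.le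
    have eY := Real.sq_sqrt hb.le
    -- Half the difference and half the sum of the two sign choices isolate the `X` and `Y` parts.
    have h1 := hx (√(1 - (a * x) ^ 2)) (√(1 - (b * x) ^ 2)) (by rw [eX]; ring) (by rw [eY]; ring)
    have h2 := hx (-√(1 - (a * x) ^ 2)) (√(1 - (b * x) ^ 2)) (by rw [neg_sq, eX]; ring)
      (by rw [eY]; ring)
    constructor
    · apply mul_left_cancel₀ (Real.sqrt_ne_zero'.2 ha)
      linear_combination (h1 - h2) / 2
    · apply mul_left_cancel₀ (Real.sqrt_ne_zero'.2 hb)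
      linear_combination (h1 + h2) / 2
  exact ⟨coeffs_eq_zero_of_eventually (key.mono fun _ h => h.1),
    coeffs_eq_zero_of_eventually (key.mono fun _ h => h.2)⟩

/-- The eight unknowns split into `HU`, `Vγ₂`, `SV`, `F` and `HV`, `Uγ₂`, `SU`, `K`. The first group
occurs in the `X` part of `cubicIm` and the `Y` part of `conjDerivRe`, the second in the opposite
parts. In each group the lowest and highest coefficients in `x` suffice. -/
theorem case1_or_case4_of_isA2Integrable {p : QCoeffs} (hp : p.IsDispersive) (hγ : p.γ₁ = 0)
    (h : p.IsA2Integrable) : p.Case1 ∨ p.Case4 := by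
  have hev := h.eventually_eq_zero hp hγ
  obtain ⟨S, hS⟩ : ∃ S, p.α₁ + p.β₁ = S := ⟨_, rfl⟩
  obtain ⟨H, hH⟩ : ∃ H, p.α₁ - p.β₁ = H := ⟨_, rfl⟩
  obtain ⟨U, hU⟩ : ∃ U, p.α₂ - p.β₂ = U := ⟨_, rfl⟩
  obtain ⟨V, hV⟩ : ∃ V, p.α₂ + p.β₂ = V := ⟨_, rfl⟩
  obtain ⟨F, hF⟩ : ∃ F, p.ξ₁ - p.ξ₂ - p.ξ₃ + p.ξ₄ = F := ⟨_, rfl⟩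
  obtain ⟨K, hK⟩ : ∃ K, p.ξ₁ - p.ξ₂ + p.ξ₃ - p.ξ₄ = K := ⟨_, rfl⟩
  obtain ⟨⟨nx0, -, nx4⟩, ny0, -, ny4⟩ := coeffs_eq_zero_of_forall_sign (hev.mono
    fun x hx X Y hX hY => (p.cubicIm_eq hS hH hU hV hF hK hX hY).symm.trans (hx X Y hX hY).1)
  obtain ⟨⟨rx1, -, rx5⟩, ry1, -, ry5⟩ := coeffs_eq_zero_of_forall_sign (by
    filter_upwards [hev, self_mem_nhdsWithin] with x hx hx0 X Y hX hY
    refine (mul_eq_zero.1 ((p.conjDerivRe_eq hS hH hU hV hF hK hX hY).symm.trans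
      (hx X Y hX hY).2)).resolve_left (ne_of_gt hx0))
  clear hev
  obtain ⟨ha, hb, hab⟩ := hp
  have hs : p.a₁ + p.a₂ ≠ 0 := sum_ne_zero_of_abs_ne ⟨ha, hb, hab⟩
  have hd : p.a₁ ^ 2 - p.a₂ ^ 2 ≠ 0 := fun h =>
    hab (sq_eq_sq_iff_abs_eq_abs _ _ |>.1 (sub_eq_zero.1 h))
  -- the products `H U`, `V G`, `V S` and `F`
  have n4 : p.a₂ * (H * U) - p.a₁ * p.a₂ * F - p.a₁ * (V * p.γ₂) = 0 := by
    apply mul_left_cancel₀ (mul_ne_zero (pow_ne_zero 2 ha) hs)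
    linear_combination nx4 / 16
  have f1 : p.a₁ ^ 2 * F - (2 * p.a₁ - p.a₂) * (H * U) = 0 := by
    linear_combination n4 - p.a₁ / 6 * nx0
  have f2 : p.a₁ ^ 2 * (V * p.γ₂) - p.a₂ * (p.a₂ - p.a₁) * (H * U) = 0 := by
    linear_combination -p.a₁ * n4 - p.a₂ * f1
  have f3 : S * V + H * U = 0 := by
    apply mul_left_cancel₀ (mul_ne_zero (pow_ne_zero 3 ha) (pow_ne_zero 3 hb))
    linear_combination -ry5 / 16 + p.a₁ * p.a₂ ^ 2 * (p.a₂ * (p.a₁ + p.a₂) * f1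
      + (2 * p.a₁ + p.a₂) * f2)
  -- The other products have been expressed through `HU`; the remaining equation is `HU` times
  -- `a₁a₂(a₁² - a₂²)`, which is where `|a₁| ≠ |a₂|` is decisive.
  have hHU : H * U = 0 := by
    apply mul_left_cancel₀ (mul_ne_zero (mul_ne_zero ha hb) hd)
    linear_combination (-p.a₁ ^ 2 * ry1 + 2 * (p.a₁ + p.a₂) * (4 * p.a₁ ^ 2 + p.a₂ ^ 2) * f1
      + (16 * p.a₁ ^ 2 + 8 * p.a₁ * p.a₂ + 2 * p.a₂ ^ 2) * f2
      + p.a₁ ^ 2 * (8 * p.a₁ ^ 2 - 16 * p.a₁ * p.a₂) * f3) / 8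
  have hF0 : F = 0 := by
    apply mul_left_cancel₀ (pow_ne_zero 2 ha)
    linear_combination f1 + (2 * p.a₁ - p.a₂) * hHU
  have hVG : V * p.γ₂ = 0 := by
    apply mul_left_cancel₀ (pow_ne_zero 2 ha)
    linear_combination f2 + p.a₂ * (p.a₂ - p.a₁) * hHU
  have hSV : S * V = 0 := by linear_combination f3 - hHU
  -- the products `H V`, `U G`, `U S` and `K`
  have g1 : p.a₂ * K - H * V = 0 := by
    apply mul_left_cancel₀ (mul_ne_zero (mul_ne_zero ha (pow_ne_zero 2 hb)) hs)
    linear_combination ny4 / 16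
  have g2 : p.a₂ * (U * p.γ₂) - (p.a₂ - p.a₁) * (H * V) = 0 := by
    linear_combination p.a₂ / 6 * ny0 - (p.a₁ + p.a₂) * g1
  have g3 : p.a₂ ^ 2 * (S * U) + p.a₁ ^ 2 * (H * V) = 0 := by
    apply mul_left_cancel₀ (mul_ne_zero (pow_ne_zero 3 ha) (pow_ne_zero 2 hb))
    linear_combination p.a₂ / 16 * rx5 + p.a₁ ^ 3 * p.a₂ ^ 2 * (p.a₂ * (p.a₁ + p.a₂) * g1
      + p.a₁ * g2)
  have hHV : H * V = 0 := by
    apply mul_left_cancel₀ (mul_ne_zero (mul_ne_zero ha hb) hd)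
    linear_combination (-p.a₂ ^ 2 * rx1
      - 2 * (p.a₁ + p.a₂) * (p.a₁ ^ 2 + 4 * p.a₂ ^ 2) * p.a₂ * g1
      - 10 * p.a₁ ^ 2 * p.a₂ * g2 + (16 * p.a₁ * p.a₂ - 8 * p.a₂ ^ 2) * g3) / 8
  have hK0 : K = 0 := by
    apply mul_left_cancel₀ hb
    linear_combination g1 + hHV
  have hUG : U * p.γ₂ = 0 := by
    apply mul_left_cancel₀ hb
    linear_combination g2 + (p.a₂ - p.a₁) * hHV
  have hSU : S * U = 0 := by
    apply mul_left_cancel₀ (pow_ne_zero 2 hb)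
    linear_combination g3 - p.a₁ ^ 2 * hHV
  have hξ : p.ξ₁ = p.ξ₂ := by linarith
  have hξ' : p.ξ₃ = p.ξ₄ := by linarith
  by_cases h0 : U = 0 ∧ V = 0
  · exact Or.inl ⟨by linarith, by linarith, hξ, hξ'⟩
  -- Whichever of `U`, `V` is nonzero, its products with `H`, `S`, `γ₂` vanish, which empties the
  -- even quadratic part.
  · have key : H = 0 ∧ S = 0 ∧ p.γ₂ = 0 := by
      by_cases hU0 : U = 0
      · have hV0 : V ≠ 0 := fun h => h0 ⟨hU0, h⟩
        exact ⟨(mul_eq_zero.1 hHV).resolve_right hV0, (mul_eq_zero.1 hSV).resolve_right hV0,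
          (mul_eq_zero.1 hVG).resolve_left hV0⟩
      · exact ⟨(mul_eq_zero.1 hHU).resolve_right hU0, (mul_eq_zero.1 hSU).resolve_right hU0,
          (mul_eq_zero.1 hUG).resolve_left hU0⟩
    obtain ⟨hH0, hS0, hG0⟩ := key
    refine Or.inr ⟨?_, ?_, ?_, ?_, ?_, fun h => h0 ?_⟩
    · rw [hγ, mul_zero, zero_div]
      linarith
    · rw [hγ, mul_zero, zero_div]
      linarith
    · rw [hγ, mul_zero, zero_div, hG0]
    · rw [hγ, hξ]
      ring
    · rw [hγ, hξ']
      ring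
    · obtain ⟨h1, h2⟩ := Prod.mk.inj h
      constructor <;> linarith

theorem not_case1_and_case4 (p : QCoeffs) : ¬(p.Case1 ∧ p.Case4) :=
  fun ⟨⟨h1, h2, _⟩, h⟩ => h.2.2.2.2.2 (Prod.ext h1 h2)

theorem isA2Integrable_iff {p : QCoeffs} (hp : p.IsDispersive) :
    p.IsA2Integrable ↔ p.Case1 ∨ p.Case4 := by
  -- a Möbius transformation achieves `γ₁ = 0`
  have hC := hp.mobius (-p.γ₁ / (2 * p.a₁)) one_ne_zero
  have hγ : (p.mobius (-p.γ₁ / (2 * p.a₁)) 1).γ₁ = 0 := by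
    have := hp.1
    simp only [QCoeffs.mobius]
    field_simp
    ring
  rw [← isA2Integrable_mobius hp (-p.γ₁ / (2 * p.a₁)),
    ← p.case1_mobius (-p.γ₁ / (2 * p.a₁)) one_ne_zero,
    ← case4_mobius hp.1 (-p.γ₁ / (2 * p.a₁)) one_ne_zero]
  refine ⟨case1_or_case4_of_isA2Integrable hC hγ, ?_⟩
  rintro (h | h)
  · exact isA2Integrable_of_isReversible hC (isReversible_one h)
  · exact isA2Integrable_of_isReversible hC (isReversible_neg_one h hγ hC.1)

theorem existsUnique_case1 (a₁ a₂ α₁ β₁ γ₁ γ₂ ξ₁ ξ₃ ζ : ℝ) : ∃! p : QCoeffs, p.Case1 ∧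
    p.a₁ = a₁ ∧ p.a₂ = a₂ ∧ p.α₁ = α₁ ∧ p.β₁ = β₁ ∧ p.γ₁ = γ₁ ∧ p.γ₂ = γ₂ ∧
    p.ξ₁ = ξ₁ ∧ p.ξ₃ = ξ₃ ∧ p.ζ = ζ := by
  refine ⟨⟨a₁, a₂, α₁, 0, β₁, 0, γ₁, γ₂, ξ₁, ξ₁, ξ₃, ξ₃, ζ⟩,
    ⟨⟨rfl, rfl, rfl, rfl⟩, rfl, rfl, rfl, rfl, rfl, rfl, rfl, rfl, rfl⟩, ?_⟩
  rintro ⟨⟩ ⟨⟨h1, h2, h3, h4⟩, rfl, rfl, rfl, rfl, rfl, rfl, rfl, rfl, rfl⟩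
  simp only at h1 h2 h3 h4
  simp only [h1, h2, h3, h4]

theorem existsUnique_case4 (a₁ a₂ α₂ β₂ γ₁ ξ₁ ξ₃ ζ : ℝ) (ha : a₁ ≠ 0) (h : (α₂, β₂) ≠ (0, 0)) :
    ∃! p : QCoeffs, p.Case4 ∧ p.a₁ = a₁ ∧ p.a₂ = a₂ ∧ p.α₂ = α₂ ∧ p.β₂ = β₂ ∧ p.γ₁ = γ₁ ∧
      p.ξ₁ = ξ₁ ∧ p.ξ₃ = ξ₃ ∧ p.ζ = ζ := by
  refine ⟨⟨a₁, a₂, (a₁ + a₂) * γ₁ / (2 * a₁), α₂, (a₁ + a₂) * γ₁ / (2 * a₁), β₂, γ₁,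
    a₂ * γ₁ / a₁, ξ₁, ξ₁ + α₂ * γ₁ / a₁, ξ₃, ξ₃ - β₂ * γ₁ / a₁, ζ⟩,
    ⟨⟨rfl, rfl, rfl, ?_, ?_, h⟩, rfl, rfl, rfl, rfl, rfl, rfl, rfl, rfl⟩, ?_⟩
  · field_simp
    ring
  · field_simp
    ring
  · rintro ⟨⟩ ⟨⟨h1, h2, h3, h4, h5, -⟩, rfl, rfl, rfl, rfl, rfl, rfl, rfl, rfl⟩
    simp only at h1 h2 h3 h4 h5 ha
    simp only [mk.injEq, true_and, and_true, h1, h2, h3]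
    constructor
    · field_simp
      linear_combination -h4
    · field_simp
      linear_combination -h5

end QCoeffs

end

theorem mainTheorem3 :
    -- the conditions at order `ε⁴`
    (∀ p : QCoeffs, p.IsDispersive → (p.IsA2Integrable ↔ p.Case1 ∨ p.Case4)) ∧
    -- the two subclasses do not overlap
    (∀ p : QCoeffs, ¬ (p.Case1 ∧ p.Case4)) ∧
    -- invariance under the restricted Möbius transformations
    (∀ p : QCoeffs, p.IsDispersive → ∀ C D : ℝ, D ≠ 0 →
      (p.mobius C D).IsDispersive ∧
      ((p.mobius C D).Case1 ↔ p.Case1) ∧ ((p.mobius C D).Case4 ↔ p.Case4)) ∧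
    -- Case 1 has nine free parameters
    (∀ a₁ a₂ α₁ β₁ γ₁ γ₂ ξ₁ ξ₃ ζ : ℝ, ∃! p : QCoeffs, p.Case1 ∧
      p.a₁ = a₁ ∧ p.a₂ = a₂ ∧ p.α₁ = α₁ ∧ p.β₁ = β₁ ∧ p.γ₁ = γ₁ ∧ p.γ₂ = γ₂ ∧
      p.ξ₁ = ξ₁ ∧ p.ξ₃ = ξ₃ ∧ p.ζ = ζ) ∧
    -- the restricted Case 4 has eight free parameters
    (∀ a₁ a₂ α₂ β₂ γ₁ ξ₁ ξ₃ ζ : ℝ, a₁ ≠ 0 → (α₂, β₂) ≠ (0, 0) → ∃! p : QCoeffs, p.Case4 ∧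
      p.a₁ = a₁ ∧ p.a₂ = a₂ ∧ p.α₂ = α₂ ∧ p.β₂ = β₂ ∧ p.γ₁ = γ₁ ∧
      p.ξ₁ = ξ₁ ∧ p.ξ₃ = ξ₃ ∧ p.ζ = ζ) :=
  ⟨fun _ hp => QCoeffs.isA2Integrable_iff hp, QCoeffs.not_case1_and_case4,
    fun p hp C _ hD => ⟨hp.mobius C hD, p.case1_mobius C hD, QCoeffs.case4_mobius hp.1 C hD⟩,
    QCoeffs.existsUnique_case1, QCoeffs.existsUnique_case4⟩
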